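/- Let $B=(a_1,b_1)\times(a_2,b_2)\subset\mathbb{R}^2$ be an open bounded box and let $S\subset B$ be a compact set with Lipschitz boundary (near each point of $\partial S$ the set $S$ is, in suitable orthonormal coordinates, the set of points on or below the graph of a Lipschitz function) such that $B\setminus S$ is connected. Let $k>0$ and let $\eta\in\mathbb{R}$, $\eta\neq 0$. Let $H^1_\Delta(B\setminus S):=\{U\in H^1(B\setminus S): \Delta U\in L^2(B\setminus S)\}$, where functions are complex valued and derivatives are taken in the distributional sense. Let $H^{1/2}(\partial B)$ be the Sobolev–Slobodeckij space with norm $\|g\|^2=\int_{\partial B}|g|^2\,ds+\int_{\partial B}\int_{\partial B}\frac{|g(x)-g(y)|^2}{|x-y|^2}\,ds(x)\,ds(y)$, and let $H^{-1/2}(\partial B)$ be its dual, containing $L^2(\partial B)$ through the pairing $\langle h,g\rangle=\int_{\partial B}hg\,ds$. Then for every $f\in H^{-1/2}(\partial B)$ the boundary value problem $$\Delta u+k^2u=0\ \text{ in } B\setminus S,\qquad u=0\ \text{ on }\partial S,\qquad \partial_n u-i\eta u=f\ \text{ on }\partial B$$ has exactly one solution $u\in H^1_\Delta(B\setminus S)$.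 Here the values of $u$ on $\partial S$ and $\partial B$ are Dirichlet traces, $n$ is the unit normal on $\partial B$ pointing out of $B$, and $\partial_n u\in H^{-1/2}(\partial B)$ is the normal derivative defined by Green's identity $\langle \partial_n u, v|_{\partial B}\rangle=\int_{B\setminus S}(\nabla u\cdot\nabla v+(\Delta u)\,v)\,dx$ for all $v\in H^1(B\setminus S)$ with $v=0$ on $\partial S$. -/

import Mathlib

open MeasureTheory Filter Topology
open scoped ContDiff ENNReal NNReal

noncomputable section

namespace HelmholtzBox

/-- The Euclidean plane. -/
abbrev Plane : Type := EuclideanSpace ℝ (Fin 2)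

/-! ### Geometry -/

/-- The open box `(a₀, b₀) × (a₁, b₁)`. -/
def box (a b : Plane) : Set Plane := {x | ∀ i, a i < x i ∧ x i < b i}

/-- `S` is a compact set with Lipschitz boundary: near each of its boundary points it is, in a
suitable orthonormal coordinate system, the set of points on or below the graph of a Lipschitz
function. -/
def IsCompactLipschitz (S : Set Plane) : Prop :=
  IsCompact S ∧ ∀ p ∈ frontier S, ∃ (R : Plane ≃ₗᵢ[ℝ] Plane) (K : ℝ≥0) (h : ℝ → ℝ) (r : ℝ),
    LipschitzWith K h ∧ 0 < r ∧ ∀ x ∈ Metric.ball p r, x ∈ S ↔ R x 1 ≤ h (R x 0)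

/-- Arc length on a curve `Γ`: the one-dimensional Hausdorff measure restricted to `Γ`. -/
def arcLength (Γ : Set Plane) : Measure Plane := (μH[1]).restrict Γ

theorem frontier_box_subset (a b : Plane) :
    frontier (box a b) ⊆
      (segment ℝ !₂[a 0, a 1] !₂[b 0, a 1] ∪ segment ℝ !₂[a 0, b 1] !₂[b 0, b 1]) ∪
      (segment ℝ !₂[a 0, a 1] !₂[a 0, b 1] ∪ segment ℝ !₂[b 0, a 1] !₂[b 0, b 1]) := by
  have hopen : IsOpen (box a b) := by
    have : box a b = ⋂ i, {x : Plane | a i < x i ∧ x i < b i} := by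
      ext x; simp [box]
    rw [this]
    refine isOpen_iInter_of_finite fun i => ?_
    have hi : Continuous fun x : Plane => x i := by fun_prop
    exact (isOpen_lt continuous_const hi).inter (isOpen_lt hi continuous_const)
  have hcl : closure (box a b) ⊆ {x : Plane | ∀ i, a i ≤ x i ∧ x i ≤ b i} := by
    refine closure_minimal (fun x hx i => ⟨(hx i).1.le, (hx i).2.le⟩) ?_
    have : {x : Plane | ∀ i, a i ≤ x i ∧ x i ≤ b i} =
        ⋂ i, {x : Plane | a i ≤ x i ∧ x i ≤ b i} := by
      ext x; simp
    rw [this]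
    refine isClosed_iInter fun i => ?_
    have hi : Continuous fun x : Plane => x i := by fun_prop
    exact (isClosed_le continuous_const hi).inter (isClosed_le hi continuous_const)
  have key : ∀ s t y : ℝ, s ≤ y → y ≤ t → ∃ α β : ℝ, 0 ≤ α ∧ 0 ≤ β ∧ α + β = 1 ∧
      α * s + β * t = y := by
    intro s t y h1 h2
    have : y ∈ segment ℝ s t := by
      rw [segment_eq_Icc (h1.trans h2)]; exact ⟨h1, h2⟩
    obtain ⟨α, β, h⟩ := this
    exact ⟨α, β, by simpa using h⟩
  have hz : ∀ (α β : ℝ), α + β = 1 → ∀ c : ℝ, α * c + β * c = c := by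
    intro α β h c; rw [← add_mul, h, one_mul]
  intro x hx
  rw [hopen.frontier_eq] at hx
  have h := hcl hx.1
  have hx2 := hx.2
  obtain ⟨h00, h01⟩ := h 0
  obtain ⟨h10, h11⟩ := h 1
  obtain ⟨α, β, hα, hβ, hαβ, h0⟩ := key _ _ _ h00 h01
  obtain ⟨α', β', hα', hβ', hαβ', h1⟩ := key _ _ _ h10 h11
  have hor : (x 0 = a 0 ∨ x 0 = b 0) ∨ (x 1 = a 1 ∨ x 1 = b 1) := by
    by_contra hne
    push Not at hne
    apply hx2
    intro i
    fin_cases i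
    · exact ⟨lt_of_le_of_ne h00 hne.1.1.symm, lt_of_le_of_ne h01 hne.1.2⟩
    · exact ⟨lt_of_le_of_ne h10 hne.2.1.symm, lt_of_le_of_ne h11 hne.2.2⟩
  rcases hor with (h' | h') | (h' | h')
  · refine Or.inr (Or.inl ⟨α', β', hα', hβ', hαβ', ?_⟩)
    ext i; fin_cases i
    · simp [hz _ _ hαβ', h']
    · simpa using h1
  · refine Or.inr (Or.inr ⟨α', β', hα', hβ', hαβ', ?_⟩)
    ext i; fin_cases i
    · simp [hz _ _ hαβ', h']
    · simpa using h1
  · refine Or.inl (Or.inl ⟨α, β, hα, hβ, hαβ, ?_⟩)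
    ext i; fin_cases i
    · simpa using h0
    · simp [hz _ _ hαβ, h']
  · refine Or.inl (Or.inr ⟨α, β, hα, hβ, hαβ, ?_⟩)
    ext i; fin_cases i
    · simpa using h0
    · simp [hz _ _ hαβ, h']

instance isFiniteMeasure_arcLength_box (a b : Plane) :
    IsFiniteMeasure (arcLength (frontier (box a b))) := by
  have hs : ∀ x y : Plane, μH[1] (segment ℝ x y) < ⊤ := by
    intro x y
    rw [hausdorffMeasure_segment]
    exact edist_lt_top x y
  refine ⟨?_⟩
  rw [arcLength, Measure.restrict_apply_univ]
  refine (measure_mono (frontier_box_subset a b)).trans_lt ?_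
  exact measure_union_lt_top (measure_union_lt_top (hs _ _) (hs _ _))
    (measure_union_lt_top (hs _ _) (hs _ _))

/-! ### Sobolev spaces on an open set `Ω` -/

/-- `L²(Ω; ℂ)`. -/
abbrev L2 (Ω : Set Plane) : Type := Lp ℂ 2 ((volume : Measure Plane).restrict Ω)

/-- Real test functions on `Ω`: smooth, with compact support contained in `Ω`. -/
def IsTest (Ω : Set Plane) (φ : Plane → ℝ) : Prop :=
  ContDiff ℝ ∞ φ ∧ HasCompactSupport φ ∧ tsupport φ ⊆ Ω

/-- The classical partial derivative `∂ᵢ v`. -/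
def partialDeriv {F : Type*} [NormedAddCommGroup F] [NormedSpace ℝ F] (i : Fin 2)
    (v : Plane → F) (x : Plane) : F :=
  fderiv ℝ v x (EuclideanSpace.single i 1)

/-- `G` is the weak gradient, with components in `L²(Ω)`, of `u ∈ L²(Ω)`. -/
def HasWeakGrad (Ω : Set Plane) (u : L2 Ω) (G : Fin 2 → L2 Ω) : Prop :=
  ∀ i, ∀ φ : Plane → ℝ, IsTest Ω φ →
    ∫ x in Ω, partialDeriv i φ x • u x = - ∫ x in Ω, φ x • G i x

/-- `w ∈ L²(Ω)` is the distributional Laplacian of `u ∈ L²(Ω)`. -/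
def HasWeakLaplacian (Ω : Set Plane) (u w : L2 Ω) : Prop :=
  ∀ φ : Plane → ℝ, IsTest Ω φ →
    ∫ x in Ω, Laplacian.laplacian φ x • u x = ∫ x in Ω, φ x • w x

/-- `H¹(Ω)`. -/
def H1 (Ω : Set Plane) : Set (L2 Ω) := {u | ∃ G, HasWeakGrad Ω u G}

/-- `H¹_Δ(Ω) = {u ∈ H¹(Ω) : Δu ∈ L²(Ω)}`. -/
def H1Delta (Ω : Set Plane) : Set (L2 Ω) := {u | u ∈ H1 Ω ∧ ∃ w, HasWeakLaplacian Ω u w}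

/-! ### Dirichlet traces and the spaces `H^{±1/2}` on the boundary of the box -/

/-- `g` is the Dirichlet trace on `Γ` of `u ∈ H¹(Ω)`. The trace operator is the continuous
extension to `H¹(Ω)` of the restriction map `v ↦ v|_Γ` for `v` smooth up to the boundary: some
sequence of smooth functions `vₙ` satisfies `vₙ → u` in `H¹(Ω)` and `vₙ|_Γ → g` in `L²(Γ)`. -/
def HasTrace (Ω Γ : Set Plane) (u : L2 Ω) (g : Plane → ℂ) : Prop :=
  ∃ G, HasWeakGrad Ω u G ∧ ∃ v : ℕ → Plane → ℂ, (∀ n, ContDiff ℝ ∞ (v n)) ∧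
    Tendsto (fun n => eLpNorm (fun x => v n x - u x) 2 (volume.restrict Ω)) atTop (𝓝 0) ∧
    (∀ i, Tendsto (fun n => eLpNorm (fun x => partialDeriv i (v n) x - G i x) 2
      (volume.restrict Ω)) atTop (𝓝 0)) ∧
    Tendsto (fun n => eLpNorm (fun x => v n x - g x) 2 (arcLength Γ)) atTop (𝓝 0)

/-- The Sobolev–Slobodeckij space `H^{1/2}` over a one-dimensional measure `μ`, i.e. the space of
all `g ∈ L²(μ)` for which `(x, y) ↦ (g x - g y) / |x - y|` lies in `L²(μ ⊗ μ)`. Such a `g` is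
stored together with this quotient, so that the inherited Hilbert norm is
`‖g‖² = ∫ |g|² dμ + ∬ |g x - g y|² / |x - y|² dμ dμ`. -/
def HHalf (μ : Measure Plane) [IsFiniteMeasure μ] :
    Submodule ℂ (WithLp 2 (Lp ℂ 2 μ × Lp ℂ 2 (μ.prod μ))) where
  carrier := {p | ∀ᵐ z ∂(μ.prod μ), p.snd z = (p.fst z.1 - p.fst z.2) / (‖z.1 - z.2‖ : ℂ)}
  zero_mem' := by
    have h0 := Lp.coeFn_zero ℂ 2 μ
    have h1 := Measure.quasiMeasurePreserving_fst (μ := μ) (ν := μ) |>.ae h0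
    have h2 := Measure.quasiMeasurePreserving_snd (μ := μ) (ν := μ) |>.ae h0
    filter_upwards [h1, h2, Lp.coeFn_zero ℂ 2 (μ.prod μ)] with z hz1 hz2 hz
    simp_all
  add_mem' := by
    intro p q hp hq
    rw [Set.mem_ofPred_eq] at hp hq ⊢
    have h0 := Lp.coeFn_add p.fst q.fst
    have h1 := Measure.quasiMeasurePreserving_fst (μ := μ) (ν := μ) |>.ae h0
    have h2 := Measure.quasiMeasurePreserving_snd (μ := μ) (ν := μ) |>.ae h0
    filter_upwards [h1, h2, Lp.coeFn_add p.snd q.snd, hp, hq] with z hz1 hz2 hz hp hq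
    rw [WithLp.add_fst, WithLp.add_snd, hz1, hz2, hz, Pi.add_apply, Pi.add_apply, Pi.add_apply,
      hp, hq]
    ring
  smul_mem' := by
    intro c p hp
    rw [Set.mem_ofPred_eq] at hp ⊢
    have h0 := Lp.coeFn_smul c p.fst
    have h1 := Measure.quasiMeasurePreserving_fst (μ := μ) (ν := μ) |>.ae h0
    have h2 := Measure.quasiMeasurePreserving_snd (μ := μ) (ν := μ) |>.ae h0
    filter_upwards [h1, h2, Lp.coeFn_smul c p.snd, hp] with z hz1 hz2 hz hp
    rw [WithLp.smul_fst, WithLp.smul_snd, hz1, hz2, hz, Pi.smul_apply, Pi.smul_apply,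
      Pi.smul_apply, hp, smul_eq_mul, smul_eq_mul, smul_eq_mul]
    ring

/-- `H^{1/2}(∂B)` for the box `B` with corners `a`, `b`. -/
abbrev HHalfBox (a b : Plane) : Type := HHalf (arcLength (frontier (box a b)))

/-- The boundary function underlying an element of `H^{1/2}(∂B)`. -/
def HHalfBox.toFun {a b : Plane} (g : HHalfBox a b) : Plane → ℂ :=
  g.1.fst

/-- `H^{-1/2}(∂B)`, the dual of `H^{1/2}(∂B)`. -/
abbrev HNegHalfBox (a b : Plane) : Type := StrongDual ℂ (HHalfBox a b)

/-! ### The boundary value problem -/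

/-- `ψ ∈ H^{-1/2}(∂B)` is the outward normal derivative on `∂B` of `u ∈ H¹_Δ(B \ S)`, defined by
Green's identity: `⟨ψ, v|_∂B⟩ = ∫_{B \ S} (∇u · ∇v + (Δu) v)` for all `v ∈ H¹(B \ S)` with
`v = 0` on `∂S`. -/
def IsNormalDerivative (a b : Plane) (S : Set Plane) (u : L2 (box a b \ S))
    (ψ : HNegHalfBox a b) : Prop :=
  ∃ (G : Fin 2 → L2 (box a b \ S)) (w : L2 (box a b \ S)),
    HasWeakGrad (box a b \ S) u G ∧ HasWeakLaplacian (box a b \ S) u w ∧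
    ∀ (v : L2 (box a b \ S)) (H : Fin 2 → L2 (box a b \ S)) (g : HHalfBox a b),
      HasWeakGrad (box a b \ S) v H →
      HasTrace (box a b \ S) (frontier S) v 0 →
      HasTrace (box a b \ S) (frontier (box a b)) v g.toFun →
      ψ g = ∫ x in box a b \ S, (∑ i, G i x * H i x + w x * v x)

/-- The Robin condition `∂ₙu - iηu = f` on `∂B`, as an identity in `H^{-1/2}(∂B)`; the trace
`t ∈ H^{1/2}(∂B)` of `u` acts on `H^{1/2}(∂B)` through the `L²(∂B)` pairing. -/
def RobinCondition (a b : Plane) (S : Set Plane) (η : ℝ) (f : HNegHalfBox a b)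
    (u : L2 (box a b \ S)) : Prop :=
  ∃ (ψ : HNegHalfBox a b) (t : HHalfBox a b),
    IsNormalDerivative a b S u ψ ∧
    HasTrace (box a b \ S) (frontier (box a b)) u t.toFun ∧
    ∀ g : HHalfBox a b,
      ψ g - Complex.I * η * ∫ x, t.toFun x * g.toFun x ∂(arcLength (frontier (box a b))) = f g

/-- The Helmholtz equation `Δu + k²u = 0` in `Ω`. -/
def HelmholtzEquation (Ω : Set Plane) (k : ℝ) (u : L2 Ω) : Prop :=
  ∃ w, HasWeakLaplacian Ω u w ∧ w + ((k : ℂ) ^ 2) • u = 0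

end HelmholtzBox

end

open HelmholtzBox

/-! Write Ω = B \ S. Tested with v ∈ H¹(Ω), v = 0 on ∂S, the boundary value problem reads ∫∇u·∇v −
k²∫uv − iη∫_∂B uv = ⟨f, v|_∂B⟩. The left side is bilinear, while Hilbert space methods need a
sesquilinear form; the unknown is therefore the conjugate w of u, and the form is `robinForm`. The
variational problem lives on `energy`, a closed space of triples (v, ∇v, v|_∂B), and
`robinProblem_iff` shows that it is equivalent to the boundary value problem.

Existence follows from uniqueness by the Fredholm alternative. The form is represented by A − K,
where Re⟨w, Aw⟩ is the squared H¹ norm of w and K is 1 + k² times the embedding into L²(Ω) followed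
by its adjoint. `surjective_of_coercive_sub_compact` applies once A is coercive, K is compact and A
− K is injective.

Coercivity rests on the trace inequality `exists_traceBound`, which controls the H^{1/2}(∂B) norm by
the H¹(Ω) norm. Differences of boundary values are estimated by a detour through a collar of ∂B that
avoids S: Hardy's inequality bounds the legs normal to the boundary and Cauchy–Schwarz the leg
parallel to it. Boundary points at distance at least ρ contribute only an L²(∂B) term. The same
inequality merges the two approximating sequences that witness the trace on ∂S and the trace on ∂B
into a single one (`triple_mem_energy`).

Compactness is Rellich's theorem, proved without extension operators. Grid squares inside Ω are
handled by Poincaré's inequality, up to finitely many means (`poincare_square`). What remains of Ω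
lies in a layer near ∂Ω, where the L² norm is small relative to the H¹ norm because Ω contains a
column of fixed length over each point of a Lipschitz graph (`isThin_boundary_layer`). Thus the
embedding is small on subspaces of finite codimension, hence compact.

Uniqueness (`Energy.eq_zero_of_robinForm`): for f = 0 the imaginary part of the form at (w, w) is −η
times the squared L²(∂B) norm of w, so w vanishes on ∂B. The extension of w by zero then solves the
Helmholtz equation across ∂B, in the union of Ω and a small disc centred on ∂B, and it vanishes in
the part of the disc outside B. As this union is connected, w = 0 by unique continuation, which
comes from a Carleman estimate with weight |x − p|⁻ⁿ exp(λ|x − p|²) whose constant does not depend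
on n (`carleman_laplacian`). -/

noncomputable section

namespace HelmholtzBox

section

/-! ### Functional analysis -/

section FunctionalAnalysis

open scoped InnerProductSpace

variable {W F : Type*} [NormedAddCommGroup W] [InnerProductSpace ℂ W] [CompleteSpace W]
  [NormedAddCommGroup F] [NormedSpace ℂ F] [CompleteSpace F]

/-- The Lax–Milgram theorem over `ℂ`. -/
theorem bijective_of_coercive (A : W →L[ℂ] W) {c : ℝ} (hc : 0 < c)
    (hA : ∀ w, c * ‖w‖ ^ 2 ≤ (⟪w, A w⟫_ℂ).re) : Function.Bijective A := by
  have hb : ∀ w, c * ‖w‖ ≤ ‖A w‖ := by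
    intro w
    rcases eq_or_ne w 0 with rfl | hw
    · simp
    have h1 : c * ‖w‖ ^ 2 ≤ ‖w‖ * ‖A w‖ :=
      (hA w).trans ((Complex.re_le_norm _).trans (norm_inner_le_norm _ _))
    have : 0 < ‖w‖ := norm_pos_iff.2 hw
    nlinarith
  -- The lower bound yields injectivity and a closed range at once; only density of the range
  -- remains.
  have hanti : AntilipschitzWith (c⁻¹).toNNReal A := by
    refine ContinuousLinearMap.antilipschitz_of_bound A fun w => ?_
    rw [Real.coe_toNNReal _ (inv_pos.2 hc).le, inv_mul_eq_div, le_div_iff₀ hc, mul_comm]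
    exact hb w
  refine ⟨hanti.injective, ?_⟩
  have hcl : IsClosed (A.range : Set W) := hanti.isClosed_range A.uniformContinuous
  have := hcl.completeSpace_coe
  have htop : A.range = ⊤ := by
    rw [← A.range.orthogonal_orthogonal, Submodule.eq_top_iff']
    -- A vector w orthogonal to the range is in particular orthogonal to A w, and coercivity forces
    -- w = 0.
    intro v w hw
    have h0 : ⟪w, A w⟫_ℂ = 0 := by
      rw [← inner_conj_symm, hw (A w) ⟨w, rfl⟩, map_zero]
    have := hA w
    rw [h0] at this
    have : ‖w‖ = 0 := by
      by_contra h
      have : 0 < ‖w‖ ^ 2 := by positivity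
      have h2 := mul_pos hc this
      simp only [Complex.zero_re] at *
      linarith
    rw [norm_eq_zero.1 this, inner_zero_left]
  intro y
  have : y ∈ A.range := htop ▸ Submodule.mem_top
  exact this

/-- An injective compact perturbation of a coercive operator is surjective. -/
theorem surjective_of_coercive_sub_compact (A K : W →L[ℂ] W) {c : ℝ} (hc : 0 < c)
    (hA : ∀ w, c * ‖w‖ ^ 2 ≤ (⟪w, A w⟫_ℂ).re) (hK : IsCompactOperator K)
    (hinj : Function.Injective (A - K)) : Function.Surjective (A - K) := by
  have hbij := bijective_of_coercive A hc hA
  let e : W ≃L[ℂ] W := ContinuousLinearEquiv.ofBijective A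
    (LinearMap.ker_eq_bot.2 hbij.1) (LinearMap.range_eq_top.2 hbij.2)
  have he : ∀ w, e w = A w := fun w => rfl
  let T : W →L[ℂ] W := (e.symm : W →L[ℂ] W).comp K
  have hT : IsCompactOperator T := hK.clm_comp (e.symm : W →L[ℂ] W)
  have hfac : ∀ w, (A - K) w = e (w - T w) := by
    intro w
    simp [T, he w]
  -- Fredholm alternative for T = A⁻¹K at the value 1, using A − K = A(1 − T). An eigenvector for 1
  -- would lie in the kernel of A − K.
  rcases hT.hasEigenvalue_or_mem_resolventSet (μ := (1 : ℂ)) one_ne_zero with h | h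
  · obtain ⟨w, hw⟩ := h.exists_hasEigenvector
    have h1 : T w = w := by simpa using hw.apply_eq_smul
    refine absurd ?_ hw.2
    apply hinj
    rw [hfac, h1]
    simp
  · rw [spectrum.mem_resolventSet_iff] at h
    obtain ⟨u, hu⟩ := h
    intro y
    refine ⟨(↑u⁻¹ : W →L[ℂ] W) (e.symm y), ?_⟩
    have h2 : ∀ x, (u : W →L[ℂ] W) x = x - T x := by
      intro x; rw [hu]; simp
    rw [hfac, ← h2]
    have : (u : W →L[ℂ] W) ((↑u⁻¹ : W →L[ℂ] W) (e.symm y)) = e.symm y := by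
      rw [← mul_apply_eq_comp, Units.mul_inv]; rfl
    rw [this]; simp

/-- An operator which is small on subspaces cut out by finitely many functionals is compact. -/
theorem isCompactOperator_of_forall_le (J : W →L[ℂ] F)
    (h : ∀ ε : ℝ, 0 < ε → ∃ (ι : Type) (_ : Fintype ι) (T : W →L[ℂ] (ι → ℂ)), ∀ w, T w = 0 →
      ‖J w‖ ≤ ε * ‖w‖) : IsCompactOperator J := by
  have hcl : IsClosed {f : W →L[ℂ] F | IsCompactOperator f} :=
    isClosed_setOfPred_isCompactOperator
  refine hcl.closure_subset (a := J) ?_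
  rw [Metric.mem_closure_iff]
  intro ε hε
  obtain ⟨ι, _, T, hT⟩ := h (ε / 2) (half_pos hε)
  let N : Submodule ℂ W := T.ker
  have hNcl : IsClosed (N : Set W) := T.isClosed_ker
  have : CompleteSpace N := hNcl.completeSpace_coe
  -- T is injective on the orthogonal complement of its kernel and has finite-dimensional target.
  have hfin : FiniteDimensional ℂ Nᗮ := by
    refine FiniteDimensional.of_injective ((T : W →ₗ[ℂ] (ι → ℂ)).comp Nᗮ.subtype) ?_
    rw [← LinearMap.ker_eq_bot, Submodule.eq_bot_iff]
    rintro ⟨x, hx⟩ hx'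
    have hxN : x ∈ N := by simpa [N] using hx'
    have h0 : ⟪x, x⟫_ℂ = 0 := hx x hxN
    simpa using h0
  have : LocallyCompactSpace Nᗮ := by
    have := FiniteDimensional.proper ℂ Nᗮ
    infer_instance
  -- The finite rank approximant is J after projection to Nᗮ. The error is J after projection to N,
  -- where J is small by hypothesis.
  refine ⟨(J.comp Nᗮ.subtypeL).comp Nᗮ.orthogonalProjectionOnto, ?_, ?_⟩
  · exact IsCompactOperator.clm_comp (f := Nᗮ.orthogonalProjectionOnto)
      (isCompactOperator_of_locallyCompactSpace_dom _) (J.comp Nᗮ.subtypeL)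
  · rw [dist_eq_norm]
    refine lt_of_le_of_lt (ContinuousLinearMap.opNorm_le_bound _ (half_pos hε).le fun w => ?_)
      (half_lt_self hε)
    have hw : (J - (J.comp Nᗮ.subtypeL).comp Nᗮ.orthogonalProjectionOnto) w =
        J (N.orthogonalProjectionOnto w) := by
      have h1 : w = N.orthogonalProjectionOnto w + Nᗮ.orthogonalProjectionOnto w := by
        have := N.starProjection_add_starProjection_orthogonal w
        exact this.symm
      have h2 := congrArg J h1
      rw [map_add] at h2
      rw [sub_apply, h2]
      simp
    rw [hw]
    refine (hT _ ?_).trans (by gcongr; exact N.norm_orthogonalProjectionOnto_apply_le w)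
    exact (N.orthogonalProjectionOnto w).2

end FunctionalAnalysis

end

section

/-! ### Calculus of partial derivatives -/

section PartialDeriv

variable {F G : Type*} [NormedAddCommGroup F] [NormedSpace ℝ F] [NormedAddCommGroup G]
  [NormedSpace ℝ G] {i j : Fin 2} {x : Plane}

theorem _root_.ContDiff.partialDeriv {v : Plane → F} (hv : ContDiff ℝ ∞ v) (i : Fin 2) :
    ContDiff ℝ ∞ (partialDeriv i v) := by
  have : ContDiff ℝ ∞ (fderiv ℝ v) := hv.fderiv_right (by simp)
  exact this.clm_apply contDiff_const

theorem _root_.HasCompactSupport.partialDeriv {v : Plane → F} (hv : HasCompactSupport v)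
    (i : Fin 2) : HasCompactSupport (partialDeriv i v) :=
  hv.fderiv_apply (𝕜 := ℝ) _

theorem tsupport_partialDeriv_subset {v : Plane → F} (i : Fin 2) :
    tsupport (partialDeriv i v) ⊆ tsupport v :=
  tsupport_fderiv_apply_subset ℝ _

theorem _root_.Filter.EventuallyEq.partialDeriv_eq {u v : Plane → F} (h : u =ᶠ[𝓝 x] v) :
    partialDeriv i u x = partialDeriv i v x := by
  unfold HelmholtzBox.partialDeriv; rw [h.fderiv_eq]

theorem partialDeriv_add {u v : Plane → F} (hu : DifferentiableAt ℝ u x)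
    (hv : DifferentiableAt ℝ v x) :
    partialDeriv i (fun y => u y + v y) x = partialDeriv i u x + partialDeriv i v x := by
  unfold partialDeriv; rw [fderiv_fun_add hu hv]; rfl

theorem partialDeriv_clm_comp (L : F →L[ℝ] G) {v : Plane → F} (hv : DifferentiableAt ℝ v x) :
    partialDeriv i (fun y => L (v y)) x = L (partialDeriv i v x) := by
  unfold partialDeriv
  rw [show (fun y => L (v y)) = L ∘ v from rfl, (L.hasFDerivAt.comp x hv.hasFDerivAt).fderiv]
  rfl

theorem partialDeriv_smul {c : Plane → ℝ} {v : Plane → F} (hc : DifferentiableAt ℝ c x)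
    (hv : DifferentiableAt ℝ v x) :
    partialDeriv i (fun y => c y • v y) x =
      c x • partialDeriv i v x + partialDeriv i c x • v x := by
  unfold partialDeriv; rw [fderiv_fun_smul hc hv]; simp

theorem partialDeriv_mul {𝔸 : Type*} [NormedCommRing 𝔸] [NormedAlgebra ℝ 𝔸] {u v : Plane → 𝔸}
    (hu : DifferentiableAt ℝ u x) (hv : DifferentiableAt ℝ v x) :
    partialDeriv i (fun y => u y * v y) x = u x * partialDeriv i v x + partialDeriv i u x * v x := by
  unfold partialDeriv; rw [fderiv_fun_mul hu hv]; simp [mul_comm]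

theorem partialDeriv_const_mul {𝔸 : Type*} [NormedCommRing 𝔸] [NormedAlgebra ℝ 𝔸] (c : 𝔸)
    {v : Plane → 𝔸} (hv : DifferentiableAt ℝ v x) :
    partialDeriv i (fun y => c * v y) x = c * partialDeriv i v x := by
  unfold partialDeriv; rw [fderiv_const_mul hv]; simp

theorem partialDeriv_coord_sub (p : Plane) (j : Fin 2) :
    partialDeriv i (fun y : Plane => y j - p j) x = if i = j then 1 else 0 := by
  unfold partialDeriv
  have h : HasFDerivAt (fun y : Plane => y j - p j) (EuclideanSpace.proj j : Plane →L[ℝ] ℝ) x :=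
    ((EuclideanSpace.proj j : Plane →L[ℝ] ℝ).hasFDerivAt).sub_const _
  rw [h.fderiv]
  simp [eq_comm]

theorem partialDeriv_comm {v : Plane → F} (hv : ContDiff ℝ ∞ v) (i j : Fin 2) (x : Plane) :
    partialDeriv i (partialDeriv j v) x = partialDeriv j (partialDeriv i v) x := by
  have hs : IsSymmSndFDerivAt ℝ v x :=
    hv.contDiffAt.isSymmSndFDerivAt (by
      rw [minSmoothness_of_isRCLikeNormedField]; exact WithTop.coe_le_coe.2 (le_top : (2 : ℕ∞) ≤ ⊤))
  have hd : DifferentiableAt ℝ (fderiv ℝ v) x :=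
    ((hv.fderiv_right (m := ∞) (by simp)).differentiable (by simp)) x
  have key : ∀ i j : Fin 2, partialDeriv i (partialDeriv j v) x =
      fderiv ℝ (fderiv ℝ v) x (EuclideanSpace.single i 1) (EuclideanSpace.single j 1) := by
    intro i j
    unfold partialDeriv
    rw [fderiv_clm_apply hd (differentiableAt_const _)]
    simp
  rw [key, key]
  exact hs _ _

theorem laplacian_eq_partialDeriv {v : Plane → F} (hv : ContDiff ℝ ∞ v) (x : Plane) :
    Laplacian.laplacian v x =
      partialDeriv 0 (partialDeriv 0 v) x + partialDeriv 1 (partialDeriv 1 v) x := by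
  have hd : DifferentiableAt ℝ (fderiv ℝ v) x :=
    ((hv.fderiv_right (m := ∞) (by simp)).differentiable (by simp)) x
  have key : ∀ i : Fin 2, partialDeriv i (partialDeriv i v) x =
      fderiv ℝ (fderiv ℝ v) x (EuclideanSpace.single i 1) (EuclideanSpace.single i 1) := by
    intro i
    unfold partialDeriv
    rw [fderiv_clm_apply hd (differentiableAt_const _)]
    simp
  rw [InnerProductSpace.laplacian_eq_iteratedFDeriv_orthonormalBasis v
    (EuclideanSpace.basisFun (Fin 2) ℝ), key, key]
  simp [iteratedFDeriv_two_apply]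

/-- Integration by parts against the constant function 1. -/
theorem integral_partialDeriv_eq_zero {v : Plane → F} (hv : ContDiff ℝ ∞ v)
    (hc : HasCompactSupport v) (i : Fin 2) : ∫ x, partialDeriv i v x = 0 := by
  have h := integral_smul_fderiv_eq_neg_fderiv_smul_of_integrable (𝕜 := ℝ) (μ := (volume : Measure Plane))
    (f := fun _ : Plane => (1 : ℝ)) (g := v) (v := EuclideanSpace.single i 1) (by simp)
    (by
      simp only [one_smul]
      exact (hv.partialDeriv i).continuous.integrable_of_hasCompactSupport (hc.partialDeriv i))
    (by simpa using hv.continuous.integrable_of_hasCompactSupport hc)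
    (fun x _ => differentiableAt_const _) (fun x _ => (hv.differentiable (by simp)) x)
  simp only [one_smul, fderiv_fun_const, Pi.zero_apply, zero_apply, zero_smul,
    integral_zero, neg_zero] at h
  exact h

end PartialDeriv

/-! ### A Carleman estimate for the Cauchy–Riemann operators -/

section Carleman

open Complex (I)

/-- The complex coordinate centred at `p`. -/
def zCoord (p x : Plane) : ℂ := ((x 0 - p 0 : ℝ) : ℂ) + ((x 1 - p 1 : ℝ) : ℂ) * I

/-- The operator `∂₀ + i ∂₁`. -/
def dbar (f : Plane → ℂ) (x : Plane) : ℂ := partialDeriv 0 f x + I * partialDeriv 1 f x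

/-- The operator `∂₀ - i ∂₁`. -/
def dz (f : Plane → ℂ) (x : Plane) : ℂ := partialDeriv 0 f x - I * partialDeriv 1 f x

theorem norm_zCoord (p x : Plane) : ‖zCoord p x‖ = dist x p := by
  rw [EuclideanSpace.dist_eq, Fin.sum_univ_two, zCoord, Complex.norm_add_mul_I]
  simp [Real.dist_eq]

theorem contDiff_zCoord (p : Plane) : ContDiff ℝ ∞ (zCoord p) := by
  unfold zCoord
  have h : ∀ i : Fin 2, ContDiff ℝ ∞ fun x : Plane => ((x i - p i : ℝ) : ℂ) := fun i =>
    Complex.ofRealCLM.contDiff.comp (g := Complex.ofRealCLM)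
      (f := fun x : Plane => x i - p i) (by fun_prop)
  exact (h 0).add ((h 1).mul contDiff_const)

theorem ContDiff.dbar {f : Plane → ℂ} (hf : ContDiff ℝ ∞ f) : ContDiff ℝ ∞ (dbar f) :=
  (hf.partialDeriv 0).add (contDiff_const.mul (hf.partialDeriv 1))

theorem HasCompactSupport.dbar {f : Plane → ℂ} (hf : HasCompactSupport f) :
    HasCompactSupport (dbar f) :=
  (hf.partialDeriv 0).add (hf.partialDeriv 1).mul_left

theorem dz_dbar {f : Plane → ℂ} (hf : ContDiff ℝ ∞ f) (x : Plane) :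
    dz (dbar f) x = Laplacian.laplacian f x := by
  have h0 : ∀ i, DifferentiableAt ℝ (partialDeriv i f) x := fun i =>
    ((hf.partialDeriv i).differentiable (by simp)) x
  have h1 : DifferentiableAt ℝ (fun y => I * partialDeriv 1 f y) x := (h0 1).const_mul _
  rw [laplacian_eq_partialDeriv hf]
  unfold dz dbar
  rw [partialDeriv_add (h0 0) h1, partialDeriv_add (h0 0) h1, partialDeriv_const_mul _ (h0 1),
    partialDeriv_const_mul _ (h0 1), partialDeriv_comm hf 1 0]
  linear_combination (-partialDeriv 1 (partialDeriv 1 f) x) * Complex.I_sq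

theorem partialDeriv_re {f : Plane → ℂ} (hf : ContDiff ℝ ∞ f) (i : Fin 2) (x : Plane) :
    partialDeriv i (fun y => (f y).re) x = (partialDeriv i f x).re :=
  partialDeriv_clm_comp Complex.reCLM ((hf.differentiable (by simp)) x)

theorem partialDeriv_im {f : Plane → ℂ} (hf : ContDiff ℝ ∞ f) (i : Fin 2) (x : Plane) :
    partialDeriv i (fun y => (f y).im) x = (partialDeriv i f x).im :=
  partialDeriv_clm_comp Complex.imCLM ((hf.differentiable (by simp)) x)

/-- The two operators are P = `dbar` − 2λz and, up to sign, its formal adjoint P*. The identity says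
‖Pg‖² − ‖P*g‖² = ⟨[P*, P]g, g⟩, and the commutator is the constant 8λ because `dz` z = `dbar` z̄ =
2. -/
theorem carleman_identity {g : Plane → ℂ} (hg : ContDiff ℝ ∞ g) (hc : HasCompactSupport g)
    (p : Plane) (lam : ℝ) :
    ∫ x, (‖dbar g x - 2 * lam * zCoord p x * g x‖ ^ 2 -
      ‖dz g x + 2 * lam * (starRingEnd ℂ) (zCoord p x) * g x‖ ^ 2 - 8 * lam * ‖g x‖ ^ 2) = 0 := by
  set α : Plane → ℝ := fun y => (g y).re with hα
  set β : Plane → ℝ := fun y => (g y).im with hβ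
  have cα : ContDiff ℝ ∞ α := Complex.reCLM.contDiff.comp hg
  have cβ : ContDiff ℝ ∞ β := Complex.imCLM.contDiff.comp hg
  have sα : HasCompactSupport α := hc.comp_left (g := Complex.re) rfl
  have sβ : HasCompactSupport β := hc.comp_left (g := Complex.im) rfl
  have dα : ∀ x, DifferentiableAt ℝ α x := fun x => (cα.differentiable (by simp)) x
  have dβ : ∀ x, DifferentiableAt ℝ β x := fun x => (cβ.differentiable (by simp)) x
  have cX : ∀ i : Fin 2, ContDiff ℝ ∞ fun y : Plane => y i - p i := fun i => by fun_prop
  have dX : ∀ (i : Fin 2) x, DifferentiableAt ℝ (fun y : Plane => y i - p i) x := fun i x =>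
    ((cX i).differentiable (by simp)) x
  have cβ' := fun i => cβ.partialDeriv i
  have dβ' : ∀ i x, DifferentiableAt ℝ (partialDeriv i β) x := fun i x =>
    ((cβ' i).differentiable (by simp)) x
  set N : Plane → ℝ := fun y => α y * α y + β y * β y with hN
  have cN : ContDiff ℝ ∞ N := (cα.mul cα).add (cβ.mul cβ)
  have sN : HasCompactSupport N := (sα.mul_left (f := α)).add (sβ.mul_left (f := β))
  have dN : ∀ x, DifferentiableAt ℝ N x := fun x => (cN.differentiable (by simp)) x
  have pN : ∀ i x, partialDeriv i N x =
      2 * (α x * partialDeriv i α x) + 2 * (β x * partialDeriv i β x) := by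
    intro i x
    rw [hN, partialDeriv_add ((dα x).fun_mul (dα x)) ((dβ x).fun_mul (dβ x)),
      partialDeriv_mul (dα x) (dα x), partialDeriv_mul (dβ x) (dβ x)]
    ring
  have I0 : ∀ v : Plane → ℝ, ContDiff ℝ ∞ v → HasCompactSupport v → ∀ i,
      Integrable (partialDeriv i v) ∧ ∫ x, partialDeriv i v x = 0 := fun v hv hs i =>
    ⟨(hv.partialDeriv i).continuous.integrable_of_hasCompactSupport (hs.partialDeriv i),
      integral_partialDeriv_eq_zero hv hs i⟩
  obtain ⟨i1, e1⟩ := I0 (fun y => α y * partialDeriv 1 β y) (cα.mul (cβ' 1))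
    (sα.mul_right) 0
  obtain ⟨i2, e2⟩ := I0 (fun y => α y * partialDeriv 0 β y) (cα.mul (cβ' 0))
    (sα.mul_right) 1
  obtain ⟨i3, e3⟩ := I0 (fun y => (y 0 - p 0) * N y) ((cX 0).mul cN) (sN.mul_left) 0
  obtain ⟨i4, e4⟩ := I0 (fun y => (y 1 - p 1) * N y) ((cX 1).mul cN) (sN.mul_left) 1
  -- Pointwise the integrand is a divergence: the first two terms are the null Lagrangian of the
  -- real and imaginary parts of g, the last two the divergence of −4λ(x − p)|g|².
  have key : ∀ x, ‖dbar g x - 2 * lam * zCoord p x * g x‖ ^ 2 -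
      ‖dz g x + 2 * lam * (starRingEnd ℂ) (zCoord p x) * g x‖ ^ 2 - 8 * lam * ‖g x‖ ^ 2 =
      -4 * partialDeriv 0 (fun y => α y * partialDeriv 1 β y) x +
      4 * partialDeriv 1 (fun y => α y * partialDeriv 0 β y) x +
      (-(4 * lam)) * partialDeriv 0 (fun y => (y 0 - p 0) * N y) x +
      (-(4 * lam)) * partialDeriv 1 (fun y => (y 1 - p 1) * N y) x := by
    intro x
    rw [partialDeriv_mul (dα x) (dβ' 1 x), partialDeriv_mul (dα x) (dβ' 0 x),
      partialDeriv_mul (dX 0 x) (dN x), partialDeriv_mul (dX 1 x) (dN x),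
      partialDeriv_coord_sub, partialDeriv_coord_sub, pN, pN, partialDeriv_comm cβ 1 0]
    simp only [hα, hβ, partialDeriv_re hg, partialDeriv_im hg, hN, if_true]
    simp only [← Complex.normSq_eq_norm_sq, Complex.normSq_apply, dbar, dz, zCoord]
    simp
    ring
  simp_rw [key]
  rw [integral_add ?_ (i4.const_mul _), integral_add ?_ (i3.const_mul _),
    integral_add (i1.const_mul _) (i2.const_mul _)]
  simp only [integral_const_mul, e1, e2, e3, e4]
  · simp
  · exact (i1.const_mul _).add (i2.const_mul _)
  · exact ((i1.const_mul _).add (i2.const_mul _)).add (i3.const_mul _)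

end Carleman

end

section

/-! ### Carleman estimates with Gaussian and singular weights -/

section CarlemanWeighted

open Complex (I)

/-- The Gaussian weight `exp (λ |x - p|²)`. -/
def gaussWeight (p : Plane) (lam : ℝ) (x : Plane) : ℝ :=
  Real.exp (lam * ((x 0 - p 0) ^ 2 + (x 1 - p 1) ^ 2))

theorem one_le_gaussWeight (p : Plane) {lam : ℝ} (hl : 0 ≤ lam) (x : Plane) :
    1 ≤ gaussWeight p lam x :=
  Real.one_le_exp (by positivity)

theorem contDiff_gaussWeight (p : Plane) (lam : ℝ) : ContDiff ℝ ∞ (gaussWeight p lam) := by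
  unfold gaussWeight; fun_prop

theorem partialDeriv_gaussWeight (p : Plane) (lam : ℝ) (i : Fin 2) (x : Plane) :
    partialDeriv i (gaussWeight p lam) x = 2 * lam * (x i - p i) * gaussWeight p lam x := by
  have h : ∀ j : Fin 2, HasFDerivAt (fun y : Plane => y j - p j)
      (EuclideanSpace.proj j : Plane →L[ℝ] ℝ) x := fun j =>
    ((EuclideanSpace.proj j : Plane →L[ℝ] ℝ).hasFDerivAt).sub_const _
  have h2 := ((((h 0).pow 2).add ((h 1).pow 2)).const_mul lam).exp
  have h3 : HasFDerivAt (gaussWeight p lam) _ x := h2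
  unfold partialDeriv
  rw [h3.fderiv]
  fin_cases i <;> simp [gaussWeight] <;> ring

/-- `carleman_identity` is applied to g = E f, where E is the weight, and the nonnegative adjoint
term is dropped. -/
theorem carleman_gaussWeight {f : Plane → ℂ} (hf : ContDiff ℝ ∞ f) (hc : HasCompactSupport f)
    (p : Plane) (lam : ℝ) :
    8 * lam * ∫ x, gaussWeight p lam x ^ 2 * ‖f x‖ ^ 2 ≤
      ∫ x, gaussWeight p lam x ^ 2 * ‖dbar f x‖ ^ 2 := by
  have cE := contDiff_gaussWeight p lam
  have hE := partialDeriv_gaussWeight p lam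
  generalize gaussWeight p lam = E at cE hE ⊢
  obtain ⟨g, hg⟩ : ∃ g : Plane → ℂ, g = fun x => E x • f x := ⟨_, rfl⟩
  have cg : ContDiff ℝ ∞ g := by
    rw [hg]; exact cE.smul hf
  have sg : HasCompactSupport g := by
    rw [hg]; exact HasCompactSupport.smul_left (f := E) (f' := f) hc
  -- Since `dbar` E = 2λzE, conjugating `dbar` by the weight produces exactly the operator of
  -- `carleman_identity`.
  have hdg : ∀ x, dbar g x - 2 * lam * zCoord p x * g x = E x • dbar f x := by
    intro x
    have h1 : DifferentiableAt ℝ E x := (cE.differentiable (by simp)) x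
    have h2 : DifferentiableAt ℝ f x := (hf.differentiable (by simp)) x
    simp only [dbar, hg]
    rw [partialDeriv_smul h1 h2, partialDeriv_smul h1 h2, hE, hE]
    simp only [zCoord, Complex.real_smul]
    push_cast
    ring
  have hid := carleman_identity cg sg p lam
  have i1 : Integrable fun x => E x ^ 2 * ‖dbar f x‖ ^ 2 := by
    refine Continuous.integrable_of_hasCompactSupport ?_ ?_
    · have := (ContDiff.dbar hf).continuous
      have := cE.continuous
      fun_prop
    · exact HasCompactSupport.mul_left ((HasCompactSupport.dbar hc).comp_left
        (g := fun z : ℂ => ‖z‖ ^ 2) (by simp))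
  have i2 : Integrable fun x => E x ^ 2 * ‖f x‖ ^ 2 := by
    refine Continuous.integrable_of_hasCompactSupport ?_ ?_
    · have := hf.continuous
      have := cE.continuous
      fun_prop
    · exact HasCompactSupport.mul_left (hc.comp_left (g := fun z : ℂ => ‖z‖ ^ 2) (by simp))
  have i3 : Integrable fun x =>
      ‖dz g x + 2 * lam * (starRingEnd ℂ) (zCoord p x) * g x‖ ^ 2 := by
    refine Continuous.integrable_of_hasCompactSupport ?_ ?_
    · have h1 := (cg.partialDeriv 0).continuous
      have h2 := (cg.partialDeriv 1).continuous
      have h3 := cg.continuous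
      have h4 := (contDiff_zCoord p).continuous
      have h5 : Continuous fun x => (starRingEnd ℂ) (zCoord p x) := Complex.continuous_conj.comp h4
      unfold dz
      fun_prop
    · refine HasCompactSupport.comp_left (g := fun z : ℂ => ‖z‖ ^ 2) ?_ (by simp)
      exact ((sg.partialDeriv 0).sub (sg.partialDeriv 1).mul_left).add sg.mul_left
  have e1 : ∀ x, ‖dbar g x - 2 * lam * zCoord p x * g x‖ ^ 2 = E x ^ 2 * ‖dbar f x‖ ^ 2 := by
    intro x
    rw [hdg, norm_smul, mul_pow, Real.norm_eq_abs, sq_abs]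
  have e2 : ∀ x, ‖g x‖ ^ 2 = E x ^ 2 * ‖f x‖ ^ 2 := by
    intro x
    rw [hg, norm_smul, mul_pow, Real.norm_eq_abs, sq_abs]
  simp_rw [e1, e2] at hid
  rw [integral_sub (by exact i1.sub i3) (i2.const_mul _), integral_sub i1 i3, integral_const_mul] at hid
  have h0 : 0 ≤ ∫ x, ‖dz g x + 2 * lam * (starRingEnd ℂ) (zCoord p x) * g x‖ ^ 2 :=
    integral_nonneg fun x => sq_nonneg _
  linarith

theorem zCoord_ne_zero {p x : Plane} (h : x ≠ p) : zCoord p x ≠ 0 := by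
  rw [← norm_ne_zero_iff, norm_zCoord]; exact dist_ne_zero.2 h

theorem partialDeriv_zCoord (p x : Plane) :
    partialDeriv 0 (zCoord p) x = 1 ∧ partialDeriv 1 (zCoord p) x = I := by
  have h : ∀ j : Fin 2, HasFDerivAt (fun y : Plane => ((y j - p j : ℝ) : ℂ))
      (Complex.ofRealCLM.comp (EuclideanSpace.proj j : Plane →L[ℝ] ℝ)) x := fun j =>
    Complex.ofRealCLM.hasFDerivAt.comp x
      (((EuclideanSpace.proj j : Plane →L[ℝ] ℝ).hasFDerivAt).sub_const _)
  have h2 : HasFDerivAt (zCoord p) _ x := (h 0).add ((h 1).mul_const I)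
  unfold partialDeriv
  rw [h2.fderiv]
  simp

/-- The only singularity of the factor is at p, near which f vanishes. -/
theorem contDiff_inv_zCoord_pow_mul {f : Plane → ℂ} (hf : ContDiff ℝ ∞ f) {p : Plane}
    (h0 : f =ᶠ[𝓝 p] 0) (n : ℕ) : ContDiff ℝ ∞ fun x => (zCoord p x)⁻¹ ^ n * f x := by
  rw [contDiff_iff_contDiffAt]
  intro x
  rcases eq_or_ne x p with rfl | hx
  · have : (fun y => (zCoord x y)⁻¹ ^ n * f y) =ᶠ[𝓝 x] fun _ => 0 := by
      filter_upwards [h0] with y hy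
      simp [hy]
    exact contDiffAt_const.congr_of_eventuallyEq this
  · exact (((contDiff_zCoord p).contDiffAt.inv (zCoord_ne_zero hx)).pow n).mul hf.contDiffAt

/-- Negative powers of the complex coordinate are holomorphic away from p, so they commute with
`dbar`; near p everything vanishes. -/
theorem dbar_inv_zCoord_pow_mul {f : Plane → ℂ} (hf : ContDiff ℝ ∞ f) {p : Plane}
    (h0 : f =ᶠ[𝓝 p] 0) (n : ℕ) (x : Plane) :
    dbar (fun x => (zCoord p x)⁻¹ ^ n * f x) x = (zCoord p x)⁻¹ ^ n * dbar f x := by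
  rcases eq_or_ne x p with rfl | hx
  · have h1 : (fun y => (zCoord x y)⁻¹ ^ n * f y) =ᶠ[𝓝 x] fun _ => 0 := by
      filter_upwards [h0] with y hy
      simp [hy]
    have h2 : f =ᶠ[𝓝 x] fun _ => 0 := h0
    have h3 : ∀ i, partialDeriv i (fun _ : Plane => (0 : ℂ)) x = 0 := by
      intro i; simp [partialDeriv]
    simp only [dbar, h1.partialDeriv_eq, h2.partialDeriv_eq, h3]
    simp
  · have hz := zCoord_ne_zero hx
    obtain ⟨q', hq⟩ : ∃ q', HasDerivAt (fun z : ℂ => z⁻¹ ^ n) q' (zCoord p x) :=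
      ⟨_, ((hasDerivAt_inv hz).pow n)⟩
    have hzd : DifferentiableAt ℝ (zCoord p) x := ((contDiff_zCoord p).differentiable (by simp)) x
    have hfd : DifferentiableAt ℝ f x := (hf.differentiable (by simp)) x
    have hcomp := (hq.complexToReal_fderiv).comp x hzd.hasFDerivAt
    have hp : ∀ i, partialDeriv i (fun y => (zCoord p y)⁻¹ ^ n) x =
        q' * partialDeriv i (zCoord p) x := by
      intro i
      unfold partialDeriv
      rw [show (fun y => (zCoord p y)⁻¹ ^ n) = (fun z : ℂ => z⁻¹ ^ n) ∘ zCoord p from rfl,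
        hcomp.fderiv]
      simp
    have hcd : DifferentiableAt ℝ (fun y => (zCoord p y)⁻¹ ^ n) x := hcomp.differentiableAt
    simp only [dbar]
    rw [partialDeriv_mul hcd hfd, partialDeriv_mul hcd hfd, hp, hp, (partialDeriv_zCoord p x).1,
      (partialDeriv_zCoord p x).2]
    -- The derivative of the holomorphic factor enters multiplied by `dbar` z = 1 + i·i = 0.
    linear_combination q' * f x * Complex.I_sq

/-- The singular weight `|x - p|⁻ⁿ exp (λ |x - p|²)`. -/
def singWeight (p : Plane) (lam : ℝ) (n : ℕ) (x : Plane) : ℝ :=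
  gaussWeight p lam x * (dist x p)⁻¹ ^ n

/-- The singular factor is absorbed into f as the modulus of z⁻ⁿ, which commutes with `dbar`. For
this reason the constant does not depend on n. -/
theorem carleman_dbar {f : Plane → ℂ} (hf : ContDiff ℝ ∞ f) (hc : HasCompactSupport f)
    {p : Plane} (h0 : f =ᶠ[𝓝 p] 0) (lam : ℝ) (n : ℕ) :
    8 * lam * ∫ x, singWeight p lam n x ^ 2 * ‖f x‖ ^ 2 ≤
      ∫ x, singWeight p lam n x ^ 2 * ‖dbar f x‖ ^ 2 := by
  have h := carleman_gaussWeight (contDiff_inv_zCoord_pow_mul hf h0 n) hc.mul_left p lam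
  simp_rw [dbar_inv_zCoord_pow_mul hf h0] at h
  simpa only [singWeight, norm_mul, norm_pow, norm_inv, norm_zCoord, mul_pow, mul_assoc] using h

theorem dbar_conj {f : Plane → ℂ} (hf : ContDiff ℝ ∞ f) (x : Plane) :
    dbar (fun y => (starRingEnd ℂ) (f y)) x = (starRingEnd ℂ) (dz f x) := by
  have h := fun i => partialDeriv_clm_comp (i := i) (Complex.conjCLE : ℂ →L[ℝ] ℂ)
    ((hf.differentiable (by simp)) x)
  have h' : ∀ i, partialDeriv i (fun y => (starRingEnd ℂ) (f y)) x =
    (starRingEnd ℂ) (partialDeriv i f x) := h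
  simp [dbar, dz, h']

/-- Complex conjugation exchanges `dz` and `dbar` and preserves the norms. -/
theorem carleman_dz {f : Plane → ℂ} (hf : ContDiff ℝ ∞ f) (hc : HasCompactSupport f)
    {p : Plane} (h0 : f =ᶠ[𝓝 p] 0) (lam : ℝ) (n : ℕ) :
    8 * lam * ∫ x, singWeight p lam n x ^ 2 * ‖f x‖ ^ 2 ≤
      ∫ x, singWeight p lam n x ^ 2 * ‖dz f x‖ ^ 2 := by
  have h := carleman_dbar (f := fun y => (starRingEnd ℂ) (f y))
    (Complex.conjCLE.contDiff.comp hf) (hc.comp_left (map_zero _)) (p := p)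
    (by filter_upwards [h0] with y hy; simp [hy]) lam n
  simpa only [dbar_conj hf, RCLike.norm_conj] using h

/-- Carleman's estimate for the Laplacian. -/
theorem carleman_laplacian {f : Plane → ℂ} (hf : ContDiff ℝ ∞ f) (hc : HasCompactSupport f)
    {p : Plane} (h0 : f =ᶠ[𝓝 p] 0) {lam : ℝ} (hl : 0 ≤ lam) (n : ℕ) :
    (8 * lam) ^ 2 * ∫ x, singWeight p lam n x ^ 2 * ‖f x‖ ^ 2 ≤
      ∫ x, singWeight p lam n x ^ 2 * ‖Laplacian.laplacian f x‖ ^ 2 := by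
  have h1 := carleman_dbar hf hc h0 lam n
  -- The Laplacian factors as `dz` after `dbar`. The estimate for `dz` is applied to `dbar` f, which
  -- also vanishes near p.
  have hd0 : dbar f =ᶠ[𝓝 p] 0 := by
    filter_upwards [h0.eventuallyEq_nhds] with y hy
    have h3 : ∀ i, partialDeriv i (0 : Plane → ℂ) y = 0 := by
      intro i; simp [partialDeriv]
    simp [dbar, hy.partialDeriv_eq, h3]
  have h2 := carleman_dz (ContDiff.dbar hf) (HasCompactSupport.dbar hc) hd0 lam n
  simp_rw [dz_dbar hf] at h2
  have := mul_le_mul_of_nonneg_left h1 (by positivity : 0 ≤ 8 * lam)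
  nlinarith

end CarlemanWeighted

end

section

/-! ### Unique continuation for the Helmholtz equation -/

section UniqueContinuation

theorem _root_.ContDiff.laplacian {F : Type*} [NormedAddCommGroup F] [NormedSpace ℝ F]
    {v : Plane → F} (hv : ContDiff ℝ ∞ v) : ContDiff ℝ ∞ (Laplacian.laplacian v) := by
  have : Laplacian.laplacian v = fun x =>
      partialDeriv 0 (partialDeriv 0 v) x + partialDeriv 1 (partialDeriv 1 v) x :=
    funext fun x => laplacian_eq_partialDeriv hv x
  rw [this]
  exact ((hv.partialDeriv 0).partialDeriv 0).add ((hv.partialDeriv 1).partialDeriv 1)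

theorem hasCompactSupport_laplacian {F : Type*} [NormedAddCommGroup F] [NormedSpace ℝ F]
    {v : Plane → F} (hv : ContDiff ℝ ∞ v) (hc : HasCompactSupport v) :
    HasCompactSupport (Laplacian.laplacian v) := by
  have : Laplacian.laplacian v = fun x =>
      partialDeriv 0 (partialDeriv 0 v) x + partialDeriv 1 (partialDeriv 1 v) x :=
    funext fun x => laplacian_eq_partialDeriv hv x
  rw [this]
  exact ((hc.partialDeriv 0).partialDeriv 0).add ((hc.partialDeriv 1).partialDeriv 1)

theorem integrable_singWeight_mul {f : Plane → ℂ} (hf : ContDiff ℝ ∞ f)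
    (hc : HasCompactSupport f) {p : Plane} (h0 : f =ᶠ[𝓝 p] 0) (lam : ℝ) (n : ℕ) :
    Integrable fun x => singWeight p lam n x ^ 2 * ‖f x‖ ^ 2 := by
  have h1 := (contDiff_inv_zCoord_pow_mul hf h0 n).continuous
  have h2 := (contDiff_gaussWeight p lam).continuous
  have h3 : (fun x => singWeight p lam n x ^ 2 * ‖f x‖ ^ 2) =
      fun x => gaussWeight p lam x ^ 2 * ‖(zCoord p x)⁻¹ ^ n * f x‖ ^ 2 := by
    ext x
    simp only [singWeight, norm_mul, norm_pow, norm_inv, norm_zCoord]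
    ring
  rw [h3]
  refine Continuous.integrable_of_hasCompactSupport (by fun_prop) ?_
  refine HasCompactSupport.mul_left ?_
  exact (HasCompactSupport.mul_left (f := fun x => (zCoord p x)⁻¹ ^ n) hc).comp_left
    (g := fun z : ℂ => ‖z‖ ^ 2) (by simp)

theorem integrable_gaussWeight_mul {f : Plane → ℂ} (hf : Continuous f)
    (hc : HasCompactSupport f) (p : Plane) (lam : ℝ) :
    Integrable fun x => gaussWeight p lam x ^ 2 * ‖f x‖ ^ 2 := by
  have h2 := (contDiff_gaussWeight p lam).continuous
  refine Continuous.integrable_of_hasCompactSupport (by fun_prop) ?_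
  exact HasCompactSupport.mul_left (hc.comp_left (g := fun z : ℂ => ‖z‖ ^ 2) (by simp))

/-- A smooth solution of the Helmholtz equation in a disc which vanishes near the centre vanishes
in the whole disc. -/
theorem helmholtz_eq_zero_of_eventuallyEq {u : Plane → ℂ} (hu : ContDiff ℝ ∞ u) {p : Plane}
    {R : ℝ} (k : ℝ) (hΔ : ∀ x ∈ Metric.ball p R, Laplacian.laplacian u x = -(k : ℂ) ^ 2 * u x)
    (h0 : u =ᶠ[𝓝 p] 0) : ∀ x ∈ Metric.ball p R, u x = 0 := by
  intro y hy
  -- The point y lies within R₀, and the cut-off function is 1 up to R₁ > R₀; the ratio R₀/R₁ < 1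
  -- drives the final limit.
  obtain ⟨R₀, hyR₀, hR₀⟩ := exists_between (Metric.mem_ball.1 hy)
  obtain ⟨R₁, hR₀₁, hR₁⟩ := exists_between hR₀
  obtain ⟨R₂, hR₁₂, hR₂⟩ := exists_between hR₁
  have hR₀pos : 0 < R₀ := dist_nonneg.trans_lt hyR₀
  have hR₁pos : 0 < R₁ := hR₀pos.trans hR₀₁
  let χ : ContDiffBump p := ⟨R₁, R₂, hR₁pos, hR₁₂⟩
  obtain ⟨w, hw⟩ : ∃ w : Plane → ℂ, w = fun x => χ x • u x := ⟨_, rfl⟩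
  have cw : ContDiff ℝ ∞ w := by
    rw [hw]; exact χ.contDiff.smul hu
  have sw : HasCompactSupport w := by
    rw [hw]; exact HasCompactSupport.smul_right (f := χ) (f' := u) χ.hasCompactSupport
  have hwu : ∀ x ∈ Metric.ball p R₁, w x = u x := by
    intro x hx
    rw [hw]
    simp only
    rw [χ.one_of_mem_closedBall (Metric.ball_subset_closedBall hx), one_smul]
  have w0 : w =ᶠ[𝓝 p] 0 := by
    filter_upwards [h0] with x hx
    simp [hw, hx]
  have cΔ := cw.laplacian
  have sΔ := hasCompactSupport_laplacian cw sw
  have Δ0 : Laplacian.laplacian w =ᶠ[𝓝 p] 0 := by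
    filter_upwards [w0.eventuallyEq_nhds] with x hx
    rw [InnerProductSpace.laplacian_congr_nhds hx |>.self_of_nhds]
    have : (0 : Plane → ℂ) = fun _ => 0 := rfl
    rw [this, InnerProductSpace.laplacian_const]
    rfl
  have hΔw : ∀ x ∈ Metric.ball p R₁, Laplacian.laplacian w x = -(k : ℂ) ^ 2 * w x := by
    intro x hx
    have : w =ᶠ[𝓝 x] u := by
      filter_upwards [Metric.isOpen_ball.mem_nhds hx] with z hz using hwu z hz
    rw [InnerProductSpace.laplacian_congr_nhds this |>.self_of_nhds,
      hΔ x (Metric.ball_subset_ball hR₁.le hx), hwu x hx]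
  -- With this λ the constant (8λ)² is (k² + 1)², which exceeds k⁴ by at least 1; so the part of Δw
  -- equal to −k²w can be absorbed on the left.
  set lam : ℝ := (k ^ 2 + 1) / 8 with hlam
  have hl : 0 ≤ lam := by positivity
  set C := ∫ x, gaussWeight p lam x ^ 2 * ‖Laplacian.laplacian w x‖ ^ 2 with hC
  have hb : ∀ n : ℕ, ∫ x in Metric.ball p R₀, ‖w x‖ ^ 2 ≤ C * ((R₀ / R₁) ^ 2) ^ n := by
    intro n
    have i1 := integrable_singWeight_mul cw sw w0 lam n
    have i2 := integrable_singWeight_mul cΔ sΔ Δ0 lam n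
    have i3 := integrable_gaussWeight_mul cΔ.continuous sΔ p lam
    have h1 := carleman_laplacian cw sw w0 hl n
    -- Inside the disc of radius R₁ the equation holds for w. Outside it the singular factor is at
    -- most R₁⁻ⁿ, and C bounds what is left.
    have h2 : ∫ x, singWeight p lam n x ^ 2 * ‖Laplacian.laplacian w x‖ ^ 2 ≤
        ∫ x, (k ^ 4 * (singWeight p lam n x ^ 2 * ‖w x‖ ^ 2) +
          (R₁⁻¹ ^ n) ^ 2 * (gaussWeight p lam x ^ 2 * ‖Laplacian.laplacian w x‖ ^ 2)) := by
      refine integral_mono i2 ((i1.const_mul _).add (i3.const_mul _)) fun x => ?_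
      simp only
      by_cases hx : x ∈ Metric.ball p R₁
      · rw [hΔw x hx, norm_mul, norm_neg, norm_pow, Complex.norm_real, Real.norm_eq_abs, sq_abs]
        have : 0 ≤ (R₁⁻¹ ^ n) ^ 2 * (gaussWeight p lam x ^ 2 * (k ^ 2 * ‖w x‖) ^ 2) := by
          positivity
        nlinarith
      · have hx' : R₁ ≤ dist x p := by simpa using hx
        have h3 : (dist x p)⁻¹ ^ n ≤ R₁⁻¹ ^ n := by gcongr
        have h4 : 0 ≤ k ^ 4 * (singWeight p lam n x ^ 2 * ‖w x‖ ^ 2) := by positivity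
        have h5 : singWeight p lam n x ^ 2 ≤ (R₁⁻¹ ^ n) ^ 2 * gaussWeight p lam x ^ 2 := by
          rw [singWeight, mul_pow, mul_comm]
          gcongr
        calc _ ≤ (R₁⁻¹ ^ n) ^ 2 * gaussWeight p lam x ^ 2 * ‖Laplacian.laplacian w x‖ ^ 2 := by
              gcongr
          _ ≤ _ := by linarith
    rw [integral_add (i1.const_mul _) (i3.const_mul _), integral_const_mul, integral_const_mul,
      ← hC] at h2
    have h6 : 0 ≤ ∫ x, singWeight p lam n x ^ 2 * ‖w x‖ ^ 2 :=
      integral_nonneg fun x => by positivity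
    have h7 : ∫ x, singWeight p lam n x ^ 2 * ‖w x‖ ^ 2 ≤ (R₁⁻¹ ^ n) ^ 2 * C := by
      have : 8 * lam = k ^ 2 + 1 := by rw [hlam]; ring
      rw [this] at h1
      nlinarith [mul_nonneg (sq_nonneg k) h6]
    -- On the disc of radius R₀ the weight is at least R₀⁻ⁿ, the Gaussian factor being at least 1.
    -- Comparison with `h7` gives the decay (R₀/R₁)²ⁿ.
    have h8 : (R₀⁻¹ ^ n) ^ 2 * ∫ x in Metric.ball p R₀, ‖w x‖ ^ 2 ≤
        ∫ x, singWeight p lam n x ^ 2 * ‖w x‖ ^ 2 := by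
      rw [← integral_const_mul]
      refine le_trans ?_ (setIntegral_le_integral (s := Metric.ball p R₀) i1
        (Eventually.of_forall fun x => by positivity))
      refine setIntegral_mono_on ?_ i1.integrableOn measurableSet_ball fun x hx => ?_
      · refine Integrable.integrableOn (Integrable.const_mul ?_ _)
        refine Continuous.integrable_of_hasCompactSupport (by
          have := cw.continuous; fun_prop) (sw.comp_left (g := fun z : ℂ => ‖z‖ ^ 2) (by simp))
      · rcases eq_or_ne x p with rfl | hxp
        · have : w x = 0 := w0.self_of_nhds
          simp [this]
        · have hd : 0 < dist x p := dist_pos.2 hxp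
          have h9 : R₀⁻¹ ^ n ≤ (dist x p)⁻¹ ^ n := by
            gcongr
            exact (Metric.mem_ball.1 hx).le
          have h10 := one_le_gaussWeight p hl x
          gcongr
          rw [singWeight]
          exact h9.trans (le_mul_of_one_le_left (by positivity) h10)
    have h11 : (R₀⁻¹ ^ n) ^ 2 * ∫ x in Metric.ball p R₀, ‖w x‖ ^ 2 ≤ (R₁⁻¹ ^ n) ^ 2 * C :=
      h8.trans h7
    have h12 : (R₀ ^ n) ^ 2 * (R₀⁻¹ ^ n) ^ 2 = 1 := by
      rw [← mul_pow, ← mul_pow, mul_inv_cancel₀ hR₀pos.ne']; simp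
    calc ∫ x in Metric.ball p R₀, ‖w x‖ ^ 2
        = (R₀ ^ n) ^ 2 * ((R₀⁻¹ ^ n) ^ 2 * ∫ x in Metric.ball p R₀, ‖w x‖ ^ 2) := by
          rw [← mul_assoc, h12, one_mul]
      _ ≤ (R₀ ^ n) ^ 2 * ((R₁⁻¹ ^ n) ^ 2 * C) := by gcongr
      _ = C * ((R₀ / R₁) ^ 2) ^ n := by
          rw [div_eq_mul_inv, mul_pow, mul_pow, ← pow_mul, ← pow_mul, ← pow_mul, ← pow_mul]
          ring
  have hlim : Tendsto (fun n : ℕ => C * ((R₀ / R₁) ^ 2) ^ n) atTop (𝓝 (C * 0)) := by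
    refine (tendsto_pow_atTop_nhds_zero_of_lt_one (by positivity) ?_).const_mul C
    have : R₀ / R₁ < 1 := (div_lt_one hR₁pos).2 hR₀₁
    have h0 : 0 ≤ R₀ / R₁ := by positivity
    nlinarith
  have hz : ∫ x in Metric.ball p R₀, ‖w x‖ ^ 2 ≤ 0 := by
    have := ge_of_tendsto' hlim hb
    simpa using this
  have hz' : ∫ x in Metric.ball p R₀, ‖w x‖ ^ 2 = 0 :=
    le_antisymm hz (integral_nonneg fun x => by positivity)
  have iw : IntegrableOn (fun x => ‖w x‖ ^ 2) (Metric.ball p R₀) :=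
    (Continuous.integrable_of_hasCompactSupport (by have := cw.continuous; fun_prop)
      (sw.comp_left (g := fun z : ℂ => ‖z‖ ^ 2) (by simp))).integrableOn
  have hae := (setIntegral_eq_zero_iff_of_nonneg_ae (Eventually.of_forall fun x => by positivity)
    iw).1 hz'
  have heq : Set.EqOn (fun x => ‖w x‖ ^ 2) 0 (Metric.ball p R₀) :=
    Measure.eqOn_open_of_ae_eq hae Metric.isOpen_ball (by
      have := cw.continuous; fun_prop) continuousOn_const
  have := heq (Metric.mem_ball.2 hyR₀)
  rw [← hwu y (Metric.mem_ball.2 (hyR₀.trans hR₀₁))]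
  simpa using this

/-! ### Mollification and unique continuation for distributional solutions -/

/-- Convolution of a kernel `ρ` with `u`. -/
def mollify (ρ : Plane → ℝ) (u : Plane → ℂ) (x : Plane) : ℂ := ∫ t, ρ (x - t) • u t

open scoped Convolution in
theorem mollify_eq_convolution (ρ : Plane → ℝ) (u : Plane → ℂ) :
    mollify ρ u = MeasureTheory.convolution u ρ (ContinuousLinearMap.lsmul ℝ ℝ).flip volume := by
  ext x
  simp [mollify, convolution_def]

theorem contDiff_mollify {ρ : Plane → ℝ} {u : Plane → ℂ} (hρ : ContDiff ℝ ∞ ρ)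
    (hc : HasCompactSupport ρ) (hu : LocallyIntegrable u) : ContDiff ℝ ∞ (mollify ρ u) := by
  rw [mollify_eq_convolution]
  exact hc.contDiff_convolution_right _ hu hρ

theorem partialDeriv_mollify {ρ : Plane → ℝ} {u : Plane → ℂ} (hρ : ContDiff ℝ ∞ ρ)
    (hc : HasCompactSupport ρ) (hu : LocallyIntegrable u) (i : Fin 2) :
    partialDeriv i (mollify ρ u) = mollify (partialDeriv i ρ) u := by
  ext x
  have h := hc.hasFDerivAt_convolution_right (ContinuousLinearMap.lsmul ℝ ℝ).flip hu
    (hρ.of_le (by simp)) x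
  rw [mollify_eq_convolution, mollify_eq_convolution, partialDeriv, h.fderiv,
    convolution_precompR_apply _ hu (hc.fderiv ℝ) (hρ.continuous_fderiv (by simp))]
  rfl

theorem partialDeriv_const_sub {F : Type*} [NormedAddCommGroup F] [NormedSpace ℝ F]
    {v : Plane → F} (hv : ContDiff ℝ ∞ v) (x t : Plane) (i : Fin 2) :
    partialDeriv i (fun s => v (x - s)) t = -partialDeriv i v (x - t) := by
  have h1 : HasFDerivAt v (fderiv ℝ v (x - t)) (x - t) :=
    ((hv.differentiable (by simp)) _).hasFDerivAt
  have h2 : HasFDerivAt (fun s => x - s) (-ContinuousLinearMap.id ℝ Plane) t :=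
    (hasFDerivAt_id t).const_sub x
  have h3 : HasFDerivAt (fun s => v (x - s)) _ t := h1.comp t h2
  unfold partialDeriv
  rw [h3.fderiv]
  simp

theorem laplacian_const_sub {F : Type*} [NormedAddCommGroup F] [NormedSpace ℝ F]
    {v : Plane → F} (hv : ContDiff ℝ ∞ v) (x t : Plane) :
    Laplacian.laplacian (fun s => v (x - s)) t = Laplacian.laplacian v (x - t) := by
  have h1 : ContDiff ℝ ∞ fun s => v (x - s) := hv.comp (by fun_prop)
  have key : ∀ i, partialDeriv i (partialDeriv i (fun s => v (x - s))) t =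
      partialDeriv i (partialDeriv i v) (x - t) := by
    intro i
    have h2 : partialDeriv i (fun s => v (x - s)) = fun s => -partialDeriv i v (x - s) :=
      funext fun s => partialDeriv_const_sub hv x s i
    have h3 : ContDiff ℝ ∞ fun y => -partialDeriv i v y := (hv.partialDeriv i).neg
    rw [h2, partialDeriv_const_sub h3]
    unfold partialDeriv
    rw [fderiv_fun_neg]
    simp
  rw [laplacian_eq_partialDeriv h1, laplacian_eq_partialDeriv hv, key, key]

/-- All derivatives fall on the kernel, so the distributional equation for u can be tested with
translates of the kernel. -/
theorem laplacian_mollify {ρ : Plane → ℝ} {u : Plane → ℂ} (hρ : ContDiff ℝ ∞ ρ)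
    (hc : HasCompactSupport ρ) (hu : LocallyIntegrable u) (x : Plane) :
    Laplacian.laplacian (mollify ρ u) x = mollify (Laplacian.laplacian ρ) u x := by
  rw [laplacian_eq_partialDeriv (contDiff_mollify hρ hc hu)]
  rw [partialDeriv_mollify hρ hc hu, partialDeriv_mollify hρ hc hu,
    partialDeriv_mollify (hρ.partialDeriv 0) (hc.partialDeriv 0) hu,
    partialDeriv_mollify (hρ.partialDeriv 1) (hc.partialDeriv 1) hu]
  have hint : ∀ i, Integrable fun t => partialDeriv i (partialDeriv i ρ) (x - t) • u t := by
    intro i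
    have := ((hc.partialDeriv i).partialDeriv i).convolutionExists_right
      (ContinuousLinearMap.lsmul ℝ ℝ).flip hu
      ((hρ.partialDeriv i).partialDeriv i).continuous x
    simpa [ConvolutionExistsAt] using this
  simp only [mollify]
  rw [← integral_add (hint 0) (hint 1)]
  congr 1
  ext t
  rw [laplacian_eq_partialDeriv hρ, add_smul]

/-- Unique continuation from the centre of a disc for distributional solutions of the Helmholtz
equation. -/
theorem weak_helmholtz_ae_eq_zero {u : Plane → ℂ} (hu : LocallyIntegrable u) {p : Plane}
    {R ε : ℝ} (hε : 0 < ε) (k : ℝ)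
    (hweak : ∀ φ : Plane → ℝ, IsTest (Metric.ball p R) φ →
      ∫ x, (Laplacian.laplacian φ x + k ^ 2 * φ x) • u x = 0)
    (h0 : ∀ᵐ x ∂(volume.restrict (Metric.ball p ε)), u x = 0) :
    ∀ᵐ x ∂(volume.restrict (Metric.ball p R)), u x = 0 := by
  have hδ : ∀ n : ℕ, 0 < 1 / ((n : ℝ) + 1) := fun n => by positivity
  let φ : ℕ → ContDiffBump (0 : Plane) := fun n =>
    ⟨1 / ((n : ℝ) + 1) / 2, 1 / ((n : ℝ) + 1), half_pos (hδ n), half_lt_self (hδ n)⟩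
  have hφout : ∀ n, (φ n).rOut = 1 / ((n : ℝ) + 1) := fun n => rfl
  have hlim : Tendsto (fun n => (φ n).rOut) atTop (𝓝 0) :=
    tendsto_one_div_add_atTop_nhds_zero_nat
  have hconv := ContDiffBump.ae_convolution_tendsto_right_of_locallyIntegrable (μ := volume)
    (K := 2) hlim (Eventually.of_forall fun n => by
      change 1 / ((n : ℝ) + 1) ≤ 2 * (1 / ((n : ℝ) + 1) / 2); linarith) hu
  rw [ae_restrict_iff' measurableSet_ball]
  filter_upwards [hconv] with x hx hxR
  have hx' : Tendsto (fun n => mollify ((φ n).normed volume) u x) atTop (𝓝 (u x)) := by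
    refine hx.congr fun n => ?_
    rw [convolution_lsmul_swap]; rfl
  -- At almost every x the mollifications converge to u(x); it suffices that they eventually vanish
  -- at x, by the smooth case.
  refine tendsto_nhds_unique hx' (tendsto_const_nhds.congr' ?_)
  have hRx : 0 < R - dist x p := sub_pos.2 hxR
  filter_upwards [hlim.eventually (gt_mem_nhds (lt_min (half_pos hRx) (half_pos hε)))] with n hn
  have hn1 : (φ n).rOut < (R - dist x p) / 2 := lt_of_lt_of_le hn (min_le_left _ _)
  have hn2 : (φ n).rOut < ε / 2 := lt_of_lt_of_le hn (min_le_right _ _)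
  set ρ := (φ n).normed volume with hρ
  have cρ : ContDiff ℝ ∞ ρ := (φ n).contDiff_normed
  have sρ : HasCompactSupport ρ := (φ n).hasCompactSupport_normed
  have tρ : tsupport ρ = Metric.closedBall 0 (φ n).rOut := (φ n).tsupport_normed_eq
  have zρ : ∀ y, (φ n).rOut < ‖y‖ → ρ y = 0 := by
    intro y hy
    apply image_eq_zero_of_notMem_tsupport
    rw [tρ]; simpa using hy
  symm
  refine helmholtz_eq_zero_of_eventuallyEq (p := p) (R := R - (φ n).rOut)
    (contDiff_mollify cρ sρ hu) k ?_ ?_ x ?_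
  · intro y hy
    have hc1 : ContDiff ℝ ∞ fun t => ρ (y - t) := cρ.comp (by fun_prop)
    have hsub : Function.support (fun t => ρ (y - t)) ⊆ Metric.closedBall y (φ n).rOut := by
      intro t ht
      by_contra h
      apply ht
      apply zρ
      rw [Metric.mem_closedBall, dist_comm, dist_eq_norm] at h
      exact not_le.1 h
    have hts : tsupport (fun t => ρ (y - t)) ⊆ Metric.closedBall y (φ n).rOut :=
      closure_minimal hsub Metric.isClosed_closedBall
    -- For y in the shrunken disc the translated kernel is supported in the disc of radius R, so the
    -- mollification solves the equation at y.
    have htest : IsTest (Metric.ball p R) fun t => ρ (y - t) := by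
      refine ⟨hc1, HasCompactSupport.of_support_subset_isCompact (isCompact_closedBall y _) hsub,
        hts.trans ?_⟩
      refine Metric.closedBall_subset_ball' ?_
      have := Metric.mem_ball.1 hy
      linarith
    have h1 := hweak _ htest
    rw [laplacian_mollify cρ sρ hu]
    have hi1 : Integrable fun t => Laplacian.laplacian ρ (y - t) • u t := by
      have := (hasCompactSupport_laplacian cρ sρ).convolutionExists_right
        (ContinuousLinearMap.lsmul ℝ ℝ).flip hu cρ.laplacian.continuous y
      simpa [ConvolutionExistsAt] using this
    have hi2 : Integrable fun t => ρ (y - t) • u t := by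
      have := sρ.convolutionExists_right
        (ContinuousLinearMap.lsmul ℝ ℝ).flip hu cρ.continuous y
      simpa [ConvolutionExistsAt] using this
    simp_rw [laplacian_const_sub cρ, add_smul, mul_smul] at h1
    rw [integral_add hi1 (by exact hi2.smul (k ^ 2)), integral_smul] at h1
    simp only [mollify]
    rw [eq_neg_of_add_eq_zero_left h1, Complex.real_smul]
    push_cast
    ring
  · filter_upwards [Metric.ball_mem_nhds p (half_pos hε)] with y hy
    simp only [mollify, Pi.zero_apply]
    refine integral_eq_zero_of_ae ?_
    rw [ae_restrict_iff' measurableSet_ball] at h0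
    filter_upwards [h0] with t ht
    by_cases htb : t ∈ Metric.ball p ε
    · simp [ht htb]
    · have : ρ (y - t) = 0 := by
        apply zρ
        rw [Metric.mem_ball, not_lt] at htb
        have h2 := dist_triangle t y p
        rw [← dist_eq_norm, dist_comm]
        have := Metric.mem_ball.1 hy
        linarith
      simp [this]
  · rw [Metric.mem_ball]; linarith

end UniqueContinuation

end

section

/-- Unique continuation in a connected open set. -/
theorem weak_helmholtz_ae_eq_zero_of_isPreconnected {u : Plane → ℂ} (hu : LocallyIntegrable u)
    {Ω : Set Plane} (hΩ : IsOpen Ω) (hconn : IsPreconnected Ω) (k : ℝ)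
    (hweak : ∀ φ : Plane → ℝ, IsTest Ω φ →
      ∫ x, (Laplacian.laplacian φ x + k ^ 2 * φ x) • u x = 0)
    {p : Plane} (hp : p ∈ Ω) {ε : ℝ} (hε : 0 < ε)
    (h0 : ∀ᵐ x ∂(volume.restrict (Metric.ball p ε)), u x = 0) :
    ∀ᵐ x ∂(volume.restrict Ω), u x = 0 := by
  -- The set of points near which u vanishes is open. It remains to see that it is relatively closed
  -- in Ω.
  let A : Set Plane := {x | ∃ r > 0, ∀ᵐ y ∂(volume.restrict (Metric.ball x r)), u y = 0}
  have hmono : ∀ {s t : Set Plane}, s ⊆ t → (∀ᵐ y ∂(volume.restrict t), u y = 0) →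
      ∀ᵐ y ∂(volume.restrict s), u y = 0 := fun hst h => ae_restrict_of_ae_restrict_of_subset hst h
  have hA : IsOpen A := by
    rw [Metric.isOpen_iff]
    rintro x ⟨r, hr, hx⟩
    refine ⟨r / 2, half_pos hr, fun y hy => ⟨r / 2, half_pos hr, hmono ?_ hx⟩⟩
    refine Metric.ball_subset_ball' ?_
    have := Metric.mem_ball.1 hy
    linarith
  have hsub : Ω ⊆ A := by
    refine hconn.subset_of_closure_inter_subset hA ⟨p, hp, ε, hε, h0⟩ ?_
    rintro x ⟨hxA, hxΩ⟩
    obtain ⟨r, hr, hrΩ⟩ := Metric.isOpen_iff.1 hΩ x hxΩ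
    obtain ⟨y, ⟨s, hs, hy⟩, hxy⟩ := Metric.mem_closure_iff.1 hxA (r / 3) (by positivity)
    -- With y within r/3 of x, the disc of radius 2r/3 about y stays in Ω and still contains the
    -- disc of radius r/3 about x.
    have hyΩ : Metric.ball y (2 * r / 3) ⊆ Ω := by
      refine (Metric.ball_subset_ball' ?_).trans hrΩ
      rw [dist_comm]; linarith
    have := weak_helmholtz_ae_eq_zero hu (R := 2 * r / 3) hs k (fun φ hφ =>
      hweak φ ⟨hφ.1, hφ.2.1, hφ.2.2.trans hyΩ⟩) hy
    refine ⟨r / 3, by positivity, hmono (Metric.ball_subset_ball' ?_) this⟩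
    linarith
  rw [ae_restrict_iff' hΩ.measurableSet, ae_iff]
  refine measure_null_of_locally_null _ fun x hx => ?_
  have hxΩ : x ∈ Ω := by
    by_contra h; exact hx fun h' => absurd h' h
  obtain ⟨r, hr, hx'⟩ := hsub hxΩ
  rw [ae_restrict_iff' measurableSet_ball, ae_iff] at hx'
  refine ⟨_, ?_, hx'⟩
  filter_upwards [mem_nhdsWithin_of_mem_nhds (Metric.ball_mem_nhds x hr),
    self_mem_nhdsWithin] with y hy hy' h
  exact hy' fun _ => h hy

/-! ### Weak derivatives -/

theorem isOpen_box (a b : Plane) : IsOpen (box a b) := by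
  have : box a b = ⋂ i, {x : Plane | a i < x i ∧ x i < b i} := by
    ext x; simp [box]
  rw [this]
  refine isOpen_iInter_of_finite fun i => ?_
  have hi : Continuous fun x : Plane => x i := by fun_prop
  exact (isOpen_lt continuous_const hi).inter (isOpen_lt hi continuous_const)

theorem norm_sub_le_of_mem_box {a b x : Plane} (hx : ∀ i, a i ≤ x i ∧ x i ≤ b i) :
    ‖x - a‖ ≤ ‖b - a‖ := by
  rw [EuclideanSpace.norm_eq, EuclideanSpace.norm_eq]
  refine Real.sqrt_le_sqrt (Finset.sum_le_sum fun i _ => ?_)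
  have := hx i
  simp only [PiLp.sub_apply, Real.norm_eq_abs]
  rw [abs_of_nonneg (by linarith), abs_of_nonneg (by linarith)]
  have h0 : 0 ≤ x i - a i := by linarith
  gcongr
  linarith

theorem closure_box_subset (a b : Plane) :
    closure (box a b) ⊆ {x : Plane | ∀ i, a i ≤ x i ∧ x i ≤ b i} := by
  refine closure_minimal (fun x hx i => ⟨(hx i).1.le, (hx i).2.le⟩) ?_
  have : {x : Plane | ∀ i, a i ≤ x i ∧ x i ≤ b i} =
      ⋂ i, {x : Plane | a i ≤ x i ∧ x i ≤ b i} := by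
    ext x; simp
  rw [this]
  refine isClosed_iInter fun i => ?_
  have hi : Continuous fun x : Plane => x i := by fun_prop
  exact (isClosed_le continuous_const hi).inter (isClosed_le hi continuous_const)

theorem closure_box_subset_closedBall (a b : Plane) :
    closure (box a b) ⊆ Metric.closedBall a ‖b - a‖ := fun x hx => by
  rw [Metric.mem_closedBall, dist_eq_norm]
  exact norm_sub_le_of_mem_box (closure_box_subset a b hx)

instance isFiniteMeasure_restrict_box_diff (a b : Plane) (S : Set Plane) :
    IsFiniteMeasure ((volume : Measure Plane).restrict (box a b \ S)) := by
  refine ⟨?_⟩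
  rw [Measure.restrict_apply_univ]
  refine lt_of_le_of_lt (measure_mono ?_) (measure_closedBall_lt_top (x := a) (r := ‖b - a‖))
  exact Set.sdiff_subset.trans (subset_closure.trans (closure_box_subset_closedBall a b))

theorem memLp_box_diff (a b : Plane) (S : Set Plane) {v : Plane → ℂ} (hv : Continuous v) :
    MemLp v 2 ((volume : Measure Plane).restrict (box a b \ S)) := by
  obtain ⟨C, hC⟩ := (isCompact_closedBall a ‖b - a‖).exists_bound_of_continuousOn hv.continuousOn
  have h1 : MemLp v 2 ((volume : Measure Plane).restrict (Metric.closedBall a ‖b - a‖)) := by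
    have : IsFiniteMeasure ((volume : Measure Plane).restrict (Metric.closedBall a ‖b - a‖)) :=
      ⟨by rw [Measure.restrict_apply_univ]; exact measure_closedBall_lt_top⟩
    refine MemLp.of_bound hv.aestronglyMeasurable C ?_
    rw [ae_restrict_iff' measurableSet_closedBall]
    exact Eventually.of_forall hC
  refine h1.mono_measure (Measure.restrict_mono ?_ le_rfl)
  exact Set.sdiff_subset.trans (subset_closure.trans (closure_box_subset_closedBall a b))

theorem memLp_arcLength_box (a b : Plane) {v : Plane → ℂ} (hv : Continuous v) :
    MemLp v 2 (arcLength (frontier (box a b))) := by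
  obtain ⟨C, hC⟩ := (isCompact_closedBall a ‖b - a‖).exists_bound_of_continuousOn hv.continuousOn
  refine MemLp.of_bound hv.aestronglyMeasurable C ?_
  rw [arcLength, ae_restrict_iff' isClosed_frontier.measurableSet]
  exact Eventually.of_forall fun x hx =>
    hC x (closure_box_subset_closedBall a b (frontier_subset_closure hx))

/-- The difference quotient of a boundary function. -/
def diffQuot (v : Plane → ℂ) (z : Plane × Plane) : ℂ := (v z.1 - v z.2) / (‖z.1 - z.2‖ : ℂ)

theorem ae_arcLength_box (a b : Plane) :
    ∀ᵐ x ∂(arcLength (frontier (box a b))), x ∈ Metric.closedBall a ‖b - a‖ := by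
  rw [arcLength, ae_restrict_iff' isClosed_frontier.measurableSet]
  exact Eventually.of_forall fun x hx =>
    closure_box_subset_closedBall a b (frontier_subset_closure hx)

/-- A smooth function is Lipschitz on a disc containing the boundary, so the quotient is bounded,
and the measure is finite. -/
theorem memLp_diffQuot (a b : Plane) {v : Plane → ℂ} (hv : ContDiff ℝ ∞ v) :
    MemLp (diffQuot v) 2
      ((arcLength (frontier (box a b))).prod (arcLength (frontier (box a b)))) := by
  obtain ⟨C, hC⟩ := (isCompact_closedBall a ‖b - a‖).exists_bound_of_continuousOn
    (hv.continuous_fderiv (by simp)).continuousOn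
  have hm : Measurable (diffQuot v) := by
    have := hv.continuous.measurable
    unfold diffQuot
    fun_prop
  refine MemLp.of_bound hm.aestronglyMeasurable (max C 0) ?_
  have h1 := Measure.quasiMeasurePreserving_fst (μ := arcLength (frontier (box a b)))
    (ν := arcLength (frontier (box a b))) |>.ae (ae_arcLength_box a b)
  have h2 := Measure.quasiMeasurePreserving_snd (μ := arcLength (frontier (box a b)))
    (ν := arcLength (frontier (box a b))) |>.ae (ae_arcLength_box a b)
  filter_upwards [h1, h2] with z hz1 hz2
  have h3 := (convex_closedBall a ‖b - a‖).norm_image_sub_le_of_norm_fderiv_le (𝕜 := ℝ) (f := v)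
    (fun x _ => (hv.differentiable (by simp)) x) hC hz2 hz1
  rw [diffQuot, norm_div, Complex.norm_real, norm_norm]
  refine div_le_of_le_mul₀ (norm_nonneg _) (le_max_right _ _) (h3.trans ?_)
  gcongr
  exact le_max_left _ _

/-! ### Smooth functions as elements of L², H^{1/2} and the ambient Hilbert space -/

/-- Smooth complex functions on the plane. -/
def smoothFun : Submodule ℂ (Plane → ℂ) where
  carrier := {v | ContDiff ℝ ∞ v}
  zero_mem' := by rw [Set.mem_ofPred_eq]; exact contDiff_const
  add_mem' h1 h2 := by
    rw [Set.mem_ofPred_eq] at *; exact h1.add h2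
  smul_mem' c v h := by
    rw [Set.mem_ofPred_eq] at *; exact contDiff_const.smul h

theorem smoothFun.contDiff (v : smoothFun) : ContDiff ℝ ∞ v.1 := v.2

variable (a b : Plane) (S : Set Plane)

/-- The class of a smooth function in `L²(Ω)`. -/
def smoothL2 : smoothFun →ₗ[ℂ] L2 (box a b \ S) where
  toFun v := (memLp_box_diff a b S (smoothFun.contDiff v).continuous).toLp v.1
  map_add' _ _ := MemLp.toLp_add _ _
  map_smul' _ _ := MemLp.toLp_const_smul _ _

/-- Partial differentiation of smooth functions. -/
def smoothDeriv (i : Fin 2) : smoothFun →ₗ[ℂ] smoothFun where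
  toFun v := ⟨partialDeriv i v.1, (smoothFun.contDiff v).partialDeriv i⟩
  map_add' u v := by
    ext x
    exact partialDeriv_add (((smoothFun.contDiff u).differentiable (by simp)) x) (((smoothFun.contDiff v).differentiable (by simp)) x)
  map_smul' c v := by
    ext x
    exact partialDeriv_const_mul c (((smoothFun.contDiff v).differentiable (by simp)) x)

/-- The class of a smooth function in `H^{1/2}(∂B)`. -/
def smoothHHalf : smoothFun →ₗ[ℂ] HHalfBox a b where
  toFun v := ⟨WithLp.toLp 2 ((memLp_arcLength_box a b (smoothFun.contDiff v).continuous).toLp v.1,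
      (memLp_diffQuot a b (smoothFun.contDiff v)).toLp _), by
    have h0 := (memLp_arcLength_box a b (smoothFun.contDiff v).continuous).coeFn_toLp
    have h1 := Measure.quasiMeasurePreserving_fst (μ := arcLength (frontier (box a b)))
      (ν := arcLength (frontier (box a b))) |>.ae h0
    have h2 := Measure.quasiMeasurePreserving_snd (μ := arcLength (frontier (box a b)))
      (ν := arcLength (frontier (box a b))) |>.ae h0
    filter_upwards [h1, h2, (memLp_diffQuot a b (smoothFun.contDiff v)).coeFn_toLp] with z hz1 hz2 hz
    refine hz.trans ?_
    rw [diffQuot, ← hz1, ← hz2]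
    rfl⟩
  map_add' u v := by
    refine Subtype.ext (WithLp.ofLp_injective 2 (Prod.ext ?_ ?_))
    · exact MemLp.toLp_add (memLp_arcLength_box a b (smoothFun.contDiff u).continuous)
        (memLp_arcLength_box a b (smoothFun.contDiff v).continuous)
    · refine Eq.trans ?_ (MemLp.toLp_add (memLp_diffQuot a b (smoothFun.contDiff u)) (memLp_diffQuot a b (smoothFun.contDiff v)))
      refine MemLp.toLp_congr (memLp_diffQuot a b (smoothFun.contDiff (u + v))) _
        (Eventually.of_forall fun z => ?_)
      simp only [diffQuot, Pi.add_apply, Submodule.coe_add]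
      ring
  map_smul' c v := by
    refine Subtype.ext (WithLp.ofLp_injective 2 (Prod.ext ?_ ?_))
    · exact MemLp.toLp_const_smul c (memLp_arcLength_box a b (smoothFun.contDiff v).continuous)
    · refine Eq.trans ?_ (MemLp.toLp_const_smul c (memLp_diffQuot a b (smoothFun.contDiff v)))
      refine MemLp.toLp_congr (memLp_diffQuot a b (smoothFun.contDiff (c • v))) _
        (Eventually.of_forall fun z => ?_)
      simp only [diffQuot, Pi.smul_apply, Submodule.coe_smul, smul_eq_mul]
      ring

/-- The Hilbert space of all triples `(u, G, g)` in `L²(Ω) × L²(Ω)² × H^{1/2}(∂B)`. -/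
abbrev Ambient : Type :=
  WithLp 2 ((PiLp 2 fun _ : Option (Fin 2) => L2 (box a b \ S)) × HHalfBox a b)

/-- Along a subsequence, L² convergence becomes convergence almost everywhere, and the relation
between the function and its quotient passes to the limit. This is what makes H^{1/2} complete. -/
theorem isClosed_HHalf (μ : Measure Plane) [IsFiniteMeasure μ] :
    IsClosed (HHalf μ : Set (WithLp 2 (Lp ℂ 2 μ × Lp ℂ 2 (μ.prod μ)))) := by
  refine IsSeqClosed.isClosed fun p q hp hpq => ?_
  have h1 : Tendsto (fun n => (p n).fst) atTop (𝓝 q.fst) :=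
    ((WithLp.prod_continuous_ofLp 2 _ _).fst.tendsto q).comp hpq
  have h2 : Tendsto (fun n => (p n).snd) atTop (𝓝 q.snd) :=
    ((WithLp.prod_continuous_ofLp 2 _ _).snd.tendsto q).comp hpq
  obtain ⟨ns, hns, hae1⟩ := (tendstoInMeasure_of_tendsto_Lp h1).exists_seq_tendsto_ae
  obtain ⟨ms, hms, hae2⟩ :=
    -- The second subsequence is extracted from the first, so that both components converge almost
    -- everywhere along it.
    (tendstoInMeasure_of_tendsto_Lp (h2.comp hns.tendsto_atTop)).exists_seq_tendsto_ae
  have h3 := Measure.quasiMeasurePreserving_fst (μ := μ) (ν := μ) |>.ae hae1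
  have h4 := Measure.quasiMeasurePreserving_snd (μ := μ) (ν := μ) |>.ae hae1
  have h5 : ∀ᵐ z ∂(μ.prod μ), ∀ n, (p n).snd z = ((p n).fst z.1 - (p n).fst z.2) /
      (‖z.1 - z.2‖ : ℂ) := ae_all_iff.2 fun n => hp n
  filter_upwards [h3, h4, h5, hae2] with z hz1 hz2 hz3 hz4
  have h6 := ((hz1.sub hz2).div_const (‖z.1 - z.2‖ : ℂ)).comp hms.tendsto_atTop
  refine tendsto_nhds_unique hz4 (h6.congr fun n => ?_)
  simp [hz3]

instance (μ : Measure Plane) [IsFiniteMeasure μ] : CompleteSpace (HHalf μ) :=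
  (isClosed_HHalf μ).completeSpace_coe

end

section

open scoped InnerProductSpace

variable {a b : Plane} {S : Set Plane}

/-! ### The energy space -/

/-- The components of a triple `(u, G, g)` in `L²(Ω)`: `none` stands for `u`, `some i` for `Gᵢ`. -/
def comp (o : Option (Fin 2)) : Ambient a b S →L[ℂ] L2 (box a b \ S) :=
  (PiLp.proj 2 (fun _ : Option (Fin 2) => L2 (box a b \ S)) o).comp
    (WithLp.fstL 2 ℂ (PiLp 2 fun _ : Option (Fin 2) => L2 (box a b \ S)) (HHalfBox a b))

/-- The boundary component of a triple `(u, G, g)`. -/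
def bdry : Ambient a b S →L[ℂ] HHalfBox a b :=
  WithLp.sndL 2 ℂ (PiLp 2 fun _ : Option (Fin 2) => L2 (box a b \ S)) (HHalfBox a b)

variable (a b S) in
/-- The triple `(u, G, g)`. -/
def triple (u : L2 (box a b \ S)) (G : Fin 2 → L2 (box a b \ S)) (g : HHalfBox a b) :
    Ambient a b S :=
  WithLp.toLp 2 (WithLp.toLp 2 fun o => o.elim u G, g)

@[simp] theorem comp_none_triple (u : L2 (box a b \ S)) (G : Fin 2 → L2 (box a b \ S))
    (g : HHalfBox a b) : comp none (triple a b S u G g) = u := rfl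

@[simp] theorem comp_some_triple (u : L2 (box a b \ S)) (G : Fin 2 → L2 (box a b \ S))
    (g : HHalfBox a b) (i : Fin 2) : comp (some i) (triple a b S u G g) = G i := rfl

@[simp] theorem bdry_triple (u : L2 (box a b \ S)) (G : Fin 2 → L2 (box a b \ S))
    (g : HHalfBox a b) : bdry (triple a b S u G g) = g := rfl

theorem ambient_ext {x y : Ambient a b S} (h : ∀ o, comp o x = comp o y)
    (hb : bdry x = bdry y) : x = y := by
  refine WithLp.ofLp_injective 2 (Prod.ext (WithLp.ofLp_injective 2 (funext h)) hb)

theorem ambient_norm_sq (x : Ambient a b S) :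
    ‖x‖ ^ 2 = ∑ o, ‖comp o x‖ ^ 2 + ‖bdry x‖ ^ 2 := by
  rw [WithLp.prod_norm_sq_eq_of_L2, PiLp.norm_sq_eq_of_L2]
  rfl

theorem tendsto_ambient_iff {ι : Type*} {l : Filter ι} {f : ι → Ambient a b S}
    {x : Ambient a b S} : Tendsto f l (𝓝 x) ↔
      (∀ o, Tendsto (fun n => comp o (f n)) l (𝓝 (comp o x))) ∧
        Tendsto (fun n => bdry (f n)) l (𝓝 (bdry x)) := by
  constructor
  · intro h
    exact ⟨fun o => ((comp o).continuous.tendsto x).comp h, (bdry.continuous.tendsto x).comp h⟩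
  · rintro ⟨h1, h2⟩
    rw [tendsto_iff_norm_sub_tendsto_zero]
    have h3 : Tendsto (fun n => ‖f n - x‖ ^ 2) l (𝓝 0) := by
      have : (fun n => ‖f n - x‖ ^ 2) =
          fun n => ∑ o, ‖comp o (f n) - comp o x‖ ^ 2 + ‖bdry (f n) - bdry x‖ ^ 2 := by
        ext n
        rw [ambient_norm_sq]
        simp only [map_sub]
      rw [this]
      have h4 : Tendsto (fun n => ∑ o, ‖comp o (f n) - comp o x‖ ^ 2 +
          ‖bdry (f n) - bdry x‖ ^ 2) l (𝓝 (∑ _o : Option (Fin 2), (0 : ℝ) ^ 2 + 0 ^ 2)) :=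
        (tendsto_finsetSum _ fun o _ =>
          ((tendsto_iff_norm_sub_tendsto_zero.1 (h1 o)).pow 2)).add
          ((tendsto_iff_norm_sub_tendsto_zero.1 h2).pow 2)
      simpa using h4
    have h5 := h3.sqrt
    simpa using h5

variable (a b S) in
/-- The triple `(v, ∇v, v|_∂B)` of a smooth function. -/
def smoothTriple : smoothFun →ₗ[ℂ] Ambient a b S where
  toFun v := triple a b S (smoothL2 a b S v) (fun i => smoothL2 a b S (smoothDeriv i v))
    (smoothHHalf a b v)
  map_add' u v := by
    refine ambient_ext (fun o => ?_) ?_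
    · cases o <;> simp only [map_add, comp_none_triple, comp_some_triple]
    · simp only [map_add, bdry_triple]
  map_smul' c v := by
    refine ambient_ext (fun o => ?_) ?_
    · cases o <;> simp only [map_smul, comp_none_triple, comp_some_triple, RingHom.id_apply]
    · simp only [map_smul, bdry_triple, RingHom.id_apply]

@[simp] theorem comp_none_smoothTriple (v : smoothFun) :
    comp none (smoothTriple a b S v) = smoothL2 a b S v := rfl

@[simp] theorem comp_some_smoothTriple (v : smoothFun) (i : Fin 2) :
    comp (some i) (smoothTriple a b S v) = smoothL2 a b S (smoothDeriv i v) := rfl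

@[simp] theorem bdry_smoothTriple (v : smoothFun) :
    bdry (smoothTriple a b S v) = smoothHHalf a b v := rfl

variable (a b S) in
/-- The energy space: the triples `(u, ∇u, u|_∂B)` for `u ∈ H¹(Ω)` with `u = 0` on `∂S`. -/
def energy : Submodule ℂ (Ambient a b S) where
  carrier := {x | ∃ v : ℕ → smoothFun, Tendsto (fun n => smoothTriple a b S (v n)) atTop (𝓝 x) ∧
    Tendsto (fun n => eLpNorm (v n).1 2 (arcLength (frontier S))) atTop (𝓝 0)}
  zero_mem' := by
    rw [Set.mem_ofPred_eq]
    exact ⟨fun _ => 0, by simp, by simp⟩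
  add_mem' := by
    intro x y hx hy
    rw [Set.mem_ofPred_eq] at *
    obtain ⟨v, hv, hv'⟩ := hx
    obtain ⟨w, hw, hw'⟩ := hy
    refine ⟨fun n => v n + w n, by simpa using hv.add hw, ?_⟩
    have := hv'.add hw'
    rw [add_zero] at this
    refine tendsto_of_tendsto_of_tendsto_of_le_of_le tendsto_const_nhds this
      (fun _ => zero_le) fun n => ?_
    exact eLpNorm_add_le (smoothFun.contDiff (v n)).continuous.aestronglyMeasurable
      (smoothFun.contDiff (w n)).continuous.aestronglyMeasurable (by norm_num)
  smul_mem' := by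
    intro c x hx
    rw [Set.mem_ofPred_eq] at *
    obtain ⟨v, hv, hv'⟩ := hx
    refine ⟨fun n => c • v n, by simpa using hv.const_smul c, ?_⟩
    have : ∀ n, eLpNorm (c • v n : smoothFun).1 2 (arcLength (frontier S)) =
        ‖c‖ₑ * eLpNorm (v n).1 2 (arcLength (frontier S)) := fun n => eLpNorm_const_smul _ _ _ _
    simp_rw [this]
    have h := ENNReal.Tendsto.const_mul hv' (a := ‖c‖ₑ) (Or.inr (by simp))
    simpa using h

theorem mem_energy {x : Ambient a b S} : x ∈ energy a b S ↔ ∃ v : ℕ → smoothFun,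
    Tendsto (fun n => smoothTriple a b S (v n)) atTop (𝓝 x) ∧
    Tendsto (fun n => eLpNorm (v n).1 2 (arcLength (frontier S))) atTop (𝓝 0) := Iff.rfl

/-- Diagonal argument: the smooth approximations of approximating triples can be chosen so that both
the distance in the ambient space and the L²(∂S) norm tend to zero. -/
theorem isClosed_energy : IsClosed (energy a b S : Set (Ambient a b S)) := by
  refine isClosed_of_closure_subset fun x hx => ?_
  have hδ : ∀ n : ℕ, 0 < 1 / ((n : ℝ) + 1) := fun n => by positivity
  have key : ∀ n : ℕ, ∃ v : smoothFun, ‖smoothTriple a b S v - x‖ < 2 * (1 / ((n : ℝ) + 1)) ∧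
      eLpNorm v.1 2 (arcLength (frontier S)) < ENNReal.ofReal (1 / ((n : ℝ) + 1)) := by
    intro n
    obtain ⟨y, hy, hxy⟩ := Metric.mem_closure_iff.1 hx _ (hδ n)
    obtain ⟨v, hv, hv'⟩ := mem_energy.1 hy
    have h1 := hv.eventually (Metric.ball_mem_nhds y (hδ n))
    have h2 := hv'.eventually (gt_mem_nhds (ENNReal.ofReal_pos.2 (hδ n)))
    obtain ⟨m, hm1, hm2⟩ := (h1.and h2).exists
    refine ⟨v m, ?_, hm2⟩
    rw [← dist_eq_norm]
    have := dist_triangle (smoothTriple a b S (v m)) y x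
    rw [dist_comm y x] at this
    have hm1 := Metric.mem_ball.1 hm1
    linarith
  choose v hv1 hv2 using key
  have h0 := tendsto_one_div_add_atTop_nhds_zero_nat (𝕜 := ℝ)
  refine mem_energy.2 ⟨v, ?_, ?_⟩
  · rw [tendsto_iff_norm_sub_tendsto_zero]
    have h1 := h0.const_mul 2
    rw [mul_zero] at h1
    exact squeeze_zero (fun _ => norm_nonneg _) (fun n => (hv1 n).le) h1
  · have h1 := (ENNReal.continuous_ofReal.tendsto 0).comp h0
    rw [ENNReal.ofReal_zero] at h1
    exact tendsto_of_tendsto_of_tendsto_of_le_of_le tendsto_const_nhds h1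
      (fun _ => zero_le) fun n => (hv2 n).le

theorem coeFn_smoothL2 (v : smoothFun) :
    smoothL2 a b S v =ᵐ[volume.restrict (box a b \ S)] v.1 :=
  (memLp_box_diff a b S (smoothFun.contDiff v).continuous).coeFn_toLp

/-- A real smooth function as an element of `smoothFun`. -/
def realSmooth (φ : Plane → ℝ) (hφ : ContDiff ℝ ∞ φ) : smoothFun :=
  ⟨fun x => (φ x : ℂ), Complex.ofRealCLM.contDiff.comp hφ⟩

theorem smoothDeriv_realSmooth {φ : Plane → ℝ} (hφ : ContDiff ℝ ∞ φ) (i : Fin 2) :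
    smoothDeriv i (realSmooth φ hφ) = realSmooth (partialDeriv i φ) (hφ.partialDeriv i) := by
  ext x
  exact partialDeriv_clm_comp Complex.ofRealCLM ((hφ.differentiable (by simp)) x)

/-- Pairing with a test function becomes an inner product with a fixed element of L²(Ω), hence
continuous in u. -/
theorem integral_smul_eq_inner {φ : Plane → ℝ} (hφ : ContDiff ℝ ∞ φ) (u : L2 (box a b \ S)) :
    ∫ x in box a b \ S, φ x • u x = ⟪smoothL2 a b S (realSmooth φ hφ), u⟫_ℂ := by
  rw [L2.inner_def]
  refine integral_congr_ae ?_
  filter_upwards [coeFn_smoothL2 (a := a) (b := b) (S := S) (realSmooth φ hφ)] with x hx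
  rw [hx]
  simp [realSmooth, mul_comm]

theorem hasWeakGrad_smooth (v : smoothFun) : HasWeakGrad (box a b \ S) (smoothL2 a b S v)
    fun i => smoothL2 a b S (smoothDeriv i v) := by
  intro i φ hφ
  obtain ⟨cφ, sφ, tφ⟩ := hφ
  have cv := smoothFun.contDiff v
  have e1 : ∫ x in box a b \ S, partialDeriv i φ x • smoothL2 a b S v x =
      ∫ x, partialDeriv i φ x • v.1 x := by
    refine Eq.trans (integral_congr_ae (g := fun x => partialDeriv i φ x • v.1 x) ?_)
      (setIntegral_eq_integral_of_forall_compl_eq_zero fun x hx => ?_)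
    · filter_upwards [coeFn_smoothL2 (a := a) (b := b) (S := S) v] with x hx
      rw [hx]
    · have : x ∉ tsupport (partialDeriv i φ) := fun h =>
        hx (tφ (tsupport_partialDeriv_subset i h))
      rw [image_eq_zero_of_notMem_tsupport this, zero_smul]
  have e2 : ∫ x in box a b \ S, φ x • smoothL2 a b S (smoothDeriv i v) x =
      ∫ x, φ x • partialDeriv i v.1 x := by
    refine Eq.trans (integral_congr_ae (g := fun x => φ x • partialDeriv i v.1 x) ?_)
      (setIntegral_eq_integral_of_forall_compl_eq_zero fun x hx => ?_)
    · filter_upwards [coeFn_smoothL2 (a := a) (b := b) (S := S) (smoothDeriv i v)] with x hx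
      rw [hx]; rfl
    · have : x ∉ tsupport φ := fun h => hx (tφ h)
      rw [image_eq_zero_of_notMem_tsupport this, zero_smul]
  rw [e1, e2, eq_neg_iff_add_eq_zero, add_comm]
  have h0 := integral_partialDeriv_eq_zero (cφ.smul cv)
    (HasCompactSupport.smul_right (f := φ) (f' := v.1) sφ) i
  have h1 : ∀ x, partialDeriv i (fun y => φ y • v.1 y) x =
      φ x • partialDeriv i v.1 x + partialDeriv i φ x • v.1 x := fun x =>
    partialDeriv_smul ((cφ.differentiable (by simp)) x) ((cv.differentiable (by simp)) x)
  rw [← integral_add, ← h0]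
  · exact integral_congr_ae (Eventually.of_forall fun x => (h1 x).symm)
  · exact Continuous.integrable_of_hasCompactSupport
      (cφ.continuous.smul (cv.partialDeriv i).continuous)
      (HasCompactSupport.smul_right (f := φ) (f' := partialDeriv i v.1) sφ)
  · exact Continuous.integrable_of_hasCompactSupport
      ((cφ.partialDeriv i).continuous.smul cv.continuous)
      (HasCompactSupport.smul_right (f := partialDeriv i φ) (f' := v.1) (sφ.partialDeriv i))

/-- For a fixed test function both sides of the defining identity are continuous on L²(Ω). -/
theorem hasWeakGrad_of_tendsto {u : ℕ → L2 (box a b \ S)} {G : ℕ → Fin 2 → L2 (box a b \ S)}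
    {u' : L2 (box a b \ S)} {G' : Fin 2 → L2 (box a b \ S)}
    (h : ∀ n, HasWeakGrad (box a b \ S) (u n) (G n)) (hu : Tendsto u atTop (𝓝 u'))
    (hG : ∀ i, Tendsto (fun n => G n i) atTop (𝓝 (G' i))) :
    HasWeakGrad (box a b \ S) u' G' := by
  intro i φ hφ
  rw [integral_smul_eq_inner hφ.1, integral_smul_eq_inner (hφ.1.partialDeriv i)]
  have h1 : Tendsto (fun n => ⟪smoothL2 a b S (realSmooth _ (hφ.1.partialDeriv i)), u n⟫_ℂ) atTop
      (𝓝 ⟪smoothL2 a b S (realSmooth _ (hφ.1.partialDeriv i)), u'⟫_ℂ) :=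
    tendsto_const_nhds.inner hu
  have h2 : Tendsto (fun n => -⟪smoothL2 a b S (realSmooth φ hφ.1), G n i⟫_ℂ) atTop
      (𝓝 (-⟪smoothL2 a b S (realSmooth φ hφ.1), G' i⟫_ℂ)) :=
    (tendsto_const_nhds.inner (hG i)).neg
  refine tendsto_nhds_unique h1 (h2.congr fun n => ?_)
  have := h n i φ hφ
  rw [integral_smul_eq_inner hφ.1, integral_smul_eq_inner (hφ.1.partialDeriv i)] at this
  exact this.symm

theorem hasWeakGrad_of_mem_energy {x : Ambient a b S} (hx : x ∈ energy a b S) :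
    HasWeakGrad (box a b \ S) (comp none x) fun i => comp (some i) x := by
  obtain ⟨v, hv, -⟩ := mem_energy.1 hx
  obtain ⟨h1, -⟩ := tendsto_ambient_iff.1 hv
  exact hasWeakGrad_of_tendsto (fun n => hasWeakGrad_smooth (v n)) (h1 none)
    fun i => h1 (some i)

/-! ### Traces of elements of the energy space -/

theorem tendsto_eLpNorm_smoothL2 {v : ℕ → smoothFun} {u : L2 (box a b \ S)} :
    Tendsto (fun n => smoothL2 a b S (v n)) atTop (𝓝 u) ↔
      Tendsto (fun n => eLpNorm (fun x => (v n).1 x - u x) 2 (volume.restrict (box a b \ S)))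
        atTop (𝓝 0) := by
  rw [Lp.tendsto_Lp_iff_tendsto_eLpNorm']
  refine tendsto_congr fun n => eLpNorm_congr_ae ?_
  filter_upwards [coeFn_smoothL2 (a := a) (b := b) (S := S) (v n)] with x hx
  simp [hx]

/-- The function underlying an element of `H^{1/2}` as an element of `L²(∂B)`. -/
def HHalfBox.toL2 (a b : Plane) :
    HHalfBox a b →L[ℂ] Lp ℂ 2 (arcLength (frontier (box a b))) :=
  (WithLp.fstL 2 ℂ _ _).comp (HHalf (arcLength (frontier (box a b)))).subtypeL

theorem HHalfBox.toFun_eq_toL2 (g : HHalfBox a b) : g.toFun = HHalfBox.toL2 a b g := rfl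

theorem tendsto_eLpNorm_smoothHHalf {v : ℕ → smoothFun}
    {g : Lp ℂ 2 (arcLength (frontier (box a b)))} :
    Tendsto (fun n => HHalfBox.toL2 a b (smoothHHalf a b (v n))) atTop (𝓝 g) ↔
      Tendsto (fun n => eLpNorm (fun x => (v n).1 x - g x) 2 (arcLength (frontier (box a b))))
        atTop (𝓝 0) := by
  rw [Lp.tendsto_Lp_iff_tendsto_eLpNorm']
  refine tendsto_congr fun n => eLpNorm_congr_ae ?_
  have := (memLp_arcLength_box a b (smoothFun.contDiff (v n)).continuous).coeFn_toLp
  filter_upwards [this] with x hx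
  exact congrArg (· - g x) hx

theorem exists_seq_of_mem_energy {x : Ambient a b S} (hx : x ∈ energy a b S) :
    ∃ v : ℕ → smoothFun,
      Tendsto (fun n => eLpNorm (fun y => (v n).1 y - comp none x y) 2
        (volume.restrict (box a b \ S))) atTop (𝓝 0) ∧
      (∀ i, Tendsto (fun n => eLpNorm (fun y => partialDeriv i (v n).1 y - comp (some i) x y) 2
        (volume.restrict (box a b \ S))) atTop (𝓝 0)) ∧
      Tendsto (fun n => eLpNorm (v n).1 2 (arcLength (frontier S))) atTop (𝓝 0) ∧
      Tendsto (fun n => eLpNorm (fun y => (v n).1 y - (bdry x).toFun y) 2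
        (arcLength (frontier (box a b)))) atTop (𝓝 0) := by
  obtain ⟨v, hv, hv'⟩ := mem_energy.1 hx
  obtain ⟨h1, h2⟩ := tendsto_ambient_iff.1 hv
  have h3 : Tendsto (fun n => smoothL2 a b S (v n)) atTop (𝓝 (comp none x)) := h1 none
  have h4 : ∀ i, Tendsto (fun n => smoothL2 a b S (smoothDeriv i (v n))) atTop
      (𝓝 (comp (some i) x)) := fun i => h1 (some i)
  have h5 : Tendsto (fun n => HHalfBox.toL2 a b (smoothHHalf a b (v n))) atTop
      (𝓝 (HHalfBox.toL2 a b (bdry x))) :=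
    ((HHalfBox.toL2 a b).continuous.tendsto (bdry x)).comp h2
  refine ⟨v, tendsto_eLpNorm_smoothL2.1 h3, fun i => ?_, hv', ?_⟩
  · exact (tendsto_eLpNorm_smoothL2 (v := fun n => smoothDeriv i (v n))).1 (h4 i)
  · rw [HHalfBox.toFun_eq_toL2]
    exact tendsto_eLpNorm_smoothHHalf.1 h5

theorem hasTrace_obstacle_of_mem_energy {x : Ambient a b S} (hx : x ∈ energy a b S) :
    HasTrace (box a b \ S) (frontier S) (comp none x) 0 := by
  obtain ⟨v, h1, h2, h3, -⟩ := exists_seq_of_mem_energy hx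
  refine ⟨fun i => comp (some i) x, hasWeakGrad_of_mem_energy hx, fun n => (v n).1,
    fun n => smoothFun.contDiff (v n), h1, h2, ?_⟩
  simpa only [Pi.zero_apply, sub_zero] using h3

theorem hasTrace_box_of_mem_energy {x : Ambient a b S} (hx : x ∈ energy a b S) :
    HasTrace (box a b \ S) (frontier (box a b)) (comp none x) (bdry x).toFun := by
  obtain ⟨v, h1, h2, -, h3⟩ := exists_seq_of_mem_energy hx
  exact ⟨fun i => comp (some i) x, hasWeakGrad_of_mem_energy hx, fun n => (v n).1,
    fun n => smoothFun.contDiff (v n), h1, h2, h3⟩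

/-! ### Uniqueness of weak derivatives and of boundary data -/

theorem ae_eq_of_forall_test {Ω : Set Plane} (hΩ : IsOpen Ω) {u w : L2 Ω}
    (h : ∀ φ : Plane → ℝ, IsTest Ω φ → ∫ x in Ω, φ x • u x = ∫ x in Ω, φ x • w x) : u = w := by
  have hloc : ∀ f : L2 Ω, LocallyIntegrable f (volume.restrict Ω) := fun f =>
    (Lp.memLp f).locallyIntegrable (by norm_num)
  have hae := hΩ.ae_eq_zero_of_integral_contDiff_smul_eq_zero (μ := volume.restrict Ω)
    (f := fun x => u x - w x)
    (((hloc u).sub (hloc w)).locallyIntegrableOn _) (fun φ h1 h2 h3 => by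
      have hi : ∀ f : L2 Ω, Integrable (fun x => φ x • f x) (volume.restrict Ω) := fun f =>
        (hloc f).integrable_smul_left_of_hasCompactSupport h1.continuous h2
      simp_rw [smul_sub]
      rw [integral_sub (hi u) (hi w), h φ ⟨h1, h2, h3⟩, sub_self])
  refine Lp.ext ?_
  filter_upwards [hae, ae_restrict_mem hΩ.measurableSet] with x hx hxΩ
  exact sub_eq_zero.1 (hx hxΩ)

theorem HasWeakGrad.unique {Ω : Set Plane} (hΩ : IsOpen Ω) {u : L2 Ω} {G H : Fin 2 → L2 Ω}
    (hG : HasWeakGrad Ω u G) (hH : HasWeakGrad Ω u H) : G = H := by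
  ext1 i
  refine ae_eq_of_forall_test hΩ fun φ hφ => ?_
  exact neg_injective ((hG i φ hφ).symm.trans (hH i φ hφ))

theorem HasWeakLaplacian.unique {Ω : Set Plane} (hΩ : IsOpen Ω) {u v w : L2 Ω}
    (hv : HasWeakLaplacian Ω u v) (hw : HasWeakLaplacian Ω u w) : v = w :=
  ae_eq_of_forall_test hΩ fun φ hφ => (hv φ hφ).symm.trans (hw φ hφ)

/-- The difference quotient component is determined almost everywhere by the function component. -/
theorem HHalfBox.ext_toL2 {g h : HHalfBox a b} (hgh : HHalfBox.toL2 a b g = HHalfBox.toL2 a b h) :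
    g = h := by
  refine Subtype.ext (WithLp.ofLp_injective 2 (Prod.ext hgh ?_))
  refine Lp.ext ?_
  have h1 : ∀ᵐ z ∂((arcLength (frontier (box a b))).prod (arcLength (frontier (box a b)))),
      g.1.snd z = (g.1.fst z.1 - g.1.fst z.2) / (‖z.1 - z.2‖ : ℂ) := g.2
  have h2 : ∀ᵐ z ∂((arcLength (frontier (box a b))).prod (arcLength (frontier (box a b)))),
      h.1.snd z = (h.1.fst z.1 - h.1.fst z.2) / (‖z.1 - z.2‖ : ℂ) := h.2
  have h3 : g.1.fst = h.1.fst := hgh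
  filter_upwards [h1, h2] with z hz1 hz2
  exact hz1.trans (by rw [h3]; exact hz2.symm)

/-- The bound in the trace theorem for smooth functions. -/
def TraceBound (a b : Plane) (S : Set Plane) (C : ℝ) : Prop :=
  ∀ v : smoothFun, ‖smoothHHalf a b v‖ ^ 2 ≤ C * ∑ o, ‖comp o (smoothTriple a b S v)‖ ^ 2

theorem TraceBound.tendsto_zero {C : ℝ} (hC : TraceBound a b S C) {ι : Type*} {l : Filter ι}
    {v : ι → smoothFun} (hv : ∀ o, Tendsto (fun n => comp o (smoothTriple a b S (v n))) l (𝓝 0)) :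
    Tendsto (fun n => smoothHHalf a b (v n)) l (𝓝 0) := by
  have h1 : Tendsto (fun n => C * ∑ o, ‖comp o (smoothTriple a b S (v n))‖ ^ 2) l
      (𝓝 (C * ∑ _o : Option (Fin 2), (0 : ℝ) ^ 2)) :=
    (tendsto_finsetSum _ fun o _ => (tendsto_zero_iff_norm_tendsto_zero.1 (hv o)).pow 2).const_mul C
  have h2 : C * ∑ _o : Option (Fin 2), (0 : ℝ) ^ 2 = 0 := by simp
  rw [h2] at h1
  have h3 := (squeeze_zero (fun n => sq_nonneg _) (fun n => hC (v n)) h1).sqrt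
  rw [tendsto_zero_iff_norm_tendsto_zero]
  simpa using h3

/-- Triples `(v, H, g)` with the traces prescribed in Green's identity lie in the energy space. -/
theorem triple_mem_energy (hS : IsClosed S) {C : ℝ} (hC : TraceBound a b S C)
    {v : L2 (box a b \ S)} {H : Fin 2 → L2 (box a b \ S)} {g : HHalfBox a b}
    (hH : HasWeakGrad (box a b \ S) v H) (hvS : HasTrace (box a b \ S) (frontier S) v 0)
    (hvB : HasTrace (box a b \ S) (frontier (box a b)) v g.toFun) :
    triple a b S v H g ∈ energy a b S := by
  have hΩ : IsOpen (box a b \ S) := (isOpen_box a b).sdiff hS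
  obtain ⟨H₁, hH₁, v₁, cv₁, hv₁, hdv₁, hΓ₁⟩ := hvS
  obtain ⟨H₂, hH₂, v₂, cv₂, hv₂, hdv₂, hΓ₂⟩ := hvB
  obtain rfl := hH₁.unique hΩ hH
  obtain rfl := hH₂.unique hΩ hH₁
  -- The first sequence has the right values on ∂S, the second on ∂B. The trace bound shows that the
  -- first one serves for both.
  let w₁ : ℕ → smoothFun := fun n => ⟨v₁ n, cv₁ n⟩
  let w₂ : ℕ → smoothFun := fun n => ⟨v₂ n, cv₂ n⟩
  have t1 : ∀ o, Tendsto (fun n => comp o (smoothTriple a b S (w₁ n))) atTop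
      (𝓝 (comp o (triple a b S v H₂ g))) := by
    rintro (_ | i)
    · exact tendsto_eLpNorm_smoothL2.2 hv₁
    · exact (tendsto_eLpNorm_smoothL2 (v := fun n => smoothDeriv i (w₁ n))).2 (hdv₁ i)
  have t2 : ∀ o, Tendsto (fun n => comp o (smoothTriple a b S (w₂ n))) atTop
      (𝓝 (comp o (triple a b S v H₂ g))) := by
    rintro (_ | i)
    · exact tendsto_eLpNorm_smoothL2.2 hv₂
    · exact (tendsto_eLpNorm_smoothL2 (v := fun n => smoothDeriv i (w₂ n))).2 (hdv₂ i)
  have hb2 : Tendsto (fun n => HHalfBox.toL2 a b (smoothHHalf a b (w₂ n))) atTop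
      (𝓝 (HHalfBox.toL2 a b g)) := tendsto_eLpNorm_smoothHHalf.2 hΓ₂
  -- The trace bound turns the Cauchy property in H¹(Ω) into the Cauchy property in H^{1/2}(∂B).
  have hcauchy : CauchySeq fun n => smoothHHalf a b (w₁ n) := by
    rw [cauchySeq_iff_tendsto_dist_atTop_0]
    have h0 : ∀ o, Tendsto (fun p : ℕ × ℕ => comp o (smoothTriple a b S (w₁ p.1 - w₁ p.2)))
        atTop (𝓝 0) := by
      intro o
      rw [← prod_atTop_atTop_eq]
      have h1 : Tendsto (fun p : ℕ × ℕ => comp o (smoothTriple a b S (w₁ p.1))) (atTop ×ˢ atTop)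
        (𝓝 (comp o (triple a b S v H₂ g))) := (t1 o).comp tendsto_fst
      have h2 : Tendsto (fun p : ℕ × ℕ => comp o (smoothTriple a b S (w₁ p.2))) (atTop ×ˢ atTop)
        (𝓝 (comp o (triple a b S v H₂ g))) := (t1 o).comp tendsto_snd
      have := h1.sub h2
      simpa only [map_sub, sub_self] using this
    have h1 := tendsto_zero_iff_norm_tendsto_zero.1 (hC.tendsto_zero h0)
    simpa only [map_sub, ← dist_eq_norm] using h1
  obtain ⟨g', hg'⟩ := cauchySeq_tendsto_of_complete hcauchy
  have hdiff : Tendsto (fun n => smoothHHalf a b (w₁ n - w₂ n)) atTop (𝓝 0) := by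
    refine hC.tendsto_zero fun o => ?_
    have := (t1 o).sub (t2 o)
    simpa only [map_sub, sub_self] using this
  -- The differences of the two sequences tend to zero in H¹(Ω), hence so do their boundary values.
  -- The two limits are compared in L²(∂B), where the second one is known.
  have hgg' : g' = g := by
    refine HHalfBox.ext_toL2 (tendsto_nhds_unique
      (((HHalfBox.toL2 a b).continuous.tendsto g').comp hg') ?_)
    have h1 := (((HHalfBox.toL2 a b).continuous.tendsto 0).comp hdiff).add hb2
    simp only [map_zero, zero_add] at h1
    refine h1.congr fun n => ?_
    simp
  refine mem_energy.2 ⟨w₁, tendsto_ambient_iff.2 ⟨t1, ?_⟩, ?_⟩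
  · rw [bdry_triple, ← hgg']
    exact hg'
  · simpa only [Pi.zero_apply, sub_zero] using hΓ₁

end

section

/-! ### Integral inequalities on the line -/

section Line

open Set

theorem sq_lintegral_mul_le {α : Type*} [MeasurableSpace α] (μ : Measure α) {f g : α → ℝ≥0∞}
    (hf : AEMeasurable f μ) (hg : AEMeasurable g μ) :
    (∫⁻ x, f x * g x ∂μ) ^ 2 ≤ (∫⁻ x, f x ^ 2 ∂μ) * ∫⁻ x, g x ^ 2 ∂μ := by
  have h := ENNReal.lintegral_mul_le_Lp_mul_Lq μ Real.HolderConjugate.two_two hf hg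
  simp only [Pi.mul_apply, ENNReal.rpow_ofNat] at h
  calc (∫⁻ x, f x * g x ∂μ) ^ 2
      ≤ ((∫⁻ x, f x ^ 2 ∂μ) ^ (1 / 2 : ℝ) * (∫⁻ x, g x ^ 2 ∂μ) ^ (1 / 2 : ℝ)) ^ 2 := by gcongr
    _ = _ := by
      rw [mul_pow, ← ENNReal.rpow_natCast, ← ENNReal.rpow_natCast, ← ENNReal.rpow_mul,
        ← ENNReal.rpow_mul]
      norm_num

theorem sq_lintegral_le {α : Type*} [MeasurableSpace α] (μ : Measure α) {f : α → ℝ≥0∞}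
    (hf : AEMeasurable f μ) : (∫⁻ x, f x ∂μ) ^ 2 ≤ μ univ * ∫⁻ x, f x ^ 2 ∂μ := by
  have := sq_lintegral_mul_le μ (aemeasurable_const (b := (1 : ℝ≥0∞))) hf
  simpa using this

theorem add_sq_le_two_mul (x y : ℝ≥0∞) : (x + y) ^ 2 ≤ 2 * x ^ 2 + 2 * y ^ 2 := by
  have := ENNReal.rpow_add_le_mul_rpow_add_rpow x y (p := 2) (by norm_num)
  norm_num at this
  calc _ ≤ 2 * (x ^ 2 + y ^ 2) := by simpa using this
    _ = _ := by ring

theorem enorm_sub_le_lintegral {φ φ' : ℝ → ℂ} (hφ : ∀ t, HasDerivAt φ (φ' t) t)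
    (hc : Continuous φ') {s t : ℝ} (hst : s ≤ t) :
    ‖φ t - φ s‖ₑ ≤ ∫⁻ y in Ioo s t, ‖φ' y‖ₑ := by
  rw [← intervalIntegral.integral_eq_sub_of_hasDerivAt (fun x _ => hφ x)
    (hc.intervalIntegrable s t), intervalIntegral.integral_of_le hst,
    integral_Ioc_eq_integral_Ioo]
  exact enorm_integral_le_lintegral_enorm _

theorem enorm_sub_le_lintegral_of_mem {φ φ' : ℝ → ℂ} (hφ : ∀ t, HasDerivAt φ (φ' t) t)
    (hc : Continuous φ') {ρ s t : ℝ} (hs : s ∈ Icc 0 ρ) (ht : t ∈ Icc 0 ρ) :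
    ‖φ s - φ t‖ₑ ≤ ∫⁻ y in Ioo 0 ρ, ‖φ' y‖ₑ := by
  rcases le_total t s with h | h
  · exact (enorm_sub_le_lintegral hφ hc h).trans
      (lintegral_mono_set (Ioo_subset_Ioo ht.1 hs.2))
  · rw [← enorm_neg, neg_sub]
    exact (enorm_sub_le_lintegral hφ hc h).trans
      (lintegral_mono_set (Ioo_subset_Ioo hs.1 ht.2))

/-- The one-dimensional Sobolev inequality. -/
theorem enorm_sq_le_lintegral {φ φ' : ℝ → ℂ} (hφ : ∀ t, HasDerivAt φ (φ' t) t)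
    (hc : Continuous φ') {ρ : ℝ} (hρ : 0 < ρ) {s : ℝ} (hs : s ∈ Icc 0 ρ) :
    ‖φ s‖ₑ ^ 2 ≤ ENNReal.ofReal (2 / ρ) * (∫⁻ t in Ioo 0 ρ, ‖φ t‖ₑ ^ 2) +
      ENNReal.ofReal (2 * ρ) * ∫⁻ t in Ioo 0 ρ, ‖φ' t‖ₑ ^ 2 := by
  have hφc : Continuous φ := continuous_iff_continuousAt.2 fun t => (hφ t).continuousAt
  set D := ∫⁻ t in Ioo 0 ρ, ‖φ' t‖ₑ ^ 2 with hD
  set A := ∫⁻ t in Ioo 0 ρ, ‖φ t‖ₑ ^ 2 with hA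
  have hvol : (volume.restrict (Ioo (0 : ℝ) ρ)) univ = ENNReal.ofReal ρ := by simp
  -- The value at s is compared with the value at an arbitrary t; averaging over t then gives the
  -- claim.
  have h1 : ∀ t ∈ Ioo 0 ρ, ‖φ s‖ₑ ^ 2 ≤ 2 * ‖φ t‖ₑ ^ 2 + 2 * (ENNReal.ofReal ρ * D) := by
    intro t ht
    have h2 : ‖φ s‖ₑ ≤ ‖φ t‖ₑ + ∫⁻ y in Ioo 0 ρ, ‖φ' y‖ₑ := by
      calc ‖φ s‖ₑ = ‖φ t + (φ s - φ t)‖ₑ := by rw [add_sub_cancel]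
        _ ≤ ‖φ t‖ₑ + ‖φ s - φ t‖ₑ := enorm_add_le _ _
        _ ≤ _ := by
          gcongr
          exact enorm_sub_le_lintegral_of_mem hφ hc hs (Ioo_subset_Icc_self ht)
    calc ‖φ s‖ₑ ^ 2 ≤ (‖φ t‖ₑ + ∫⁻ y in Ioo 0 ρ, ‖φ' y‖ₑ) ^ 2 := by gcongr
      _ ≤ 2 * ‖φ t‖ₑ ^ 2 + 2 * (∫⁻ y in Ioo 0 ρ, ‖φ' y‖ₑ) ^ 2 := add_sq_le_two_mul _ _
      _ ≤ _ := by
        gcongr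
        rw [← hvol]
        exact sq_lintegral_le _ hc.enorm.measurable.aemeasurable
  have h3 : ENNReal.ofReal ρ * ‖φ s‖ₑ ^ 2 ≤
      2 * A + 2 * (ENNReal.ofReal ρ * D) * ENNReal.ofReal ρ := by
    calc ENNReal.ofReal ρ * ‖φ s‖ₑ ^ 2 = ∫⁻ _t in Ioo 0 ρ, ‖φ s‖ₑ ^ 2 := by
          rw [setLIntegral_const]; simp [mul_comm]
      _ ≤ ∫⁻ t in Ioo 0 ρ, (2 * ‖φ t‖ₑ ^ 2 + 2 * (ENNReal.ofReal ρ * D)) :=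
          setLIntegral_mono' measurableSet_Ioo h1
      _ = _ := by
          rw [lintegral_add_right _ measurable_const, lintegral_const_mul _
            (hφc.enorm.measurable.pow_const 2), setLIntegral_const]
          simp [hA]
  have h4 : ENNReal.ofReal ρ⁻¹ * ENNReal.ofReal ρ = 1 := by
    rw [← ENNReal.ofReal_mul (by positivity), inv_mul_cancel₀ hρ.ne', ENNReal.ofReal_one]
  calc ‖φ s‖ₑ ^ 2 = ENNReal.ofReal ρ⁻¹ * (ENNReal.ofReal ρ * ‖φ s‖ₑ ^ 2) := by
        rw [← mul_assoc, h4, one_mul]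
    _ ≤ ENNReal.ofReal ρ⁻¹ * (2 * A + 2 * (ENNReal.ofReal ρ * D) * ENNReal.ofReal ρ) := by gcongr
    _ = 2 * ENNReal.ofReal ρ⁻¹ * A +
        2 * ENNReal.ofReal ρ * D * (ENNReal.ofReal ρ⁻¹ * ENNReal.ofReal ρ) := by ring
    _ = _ := by
        rw [h4, mul_one, div_eq_mul_inv, ENNReal.ofReal_mul (by norm_num),
          ENNReal.ofReal_mul (by norm_num)]
        simp

theorem lintegral_rpow_neg_half_le {t : ℝ} (ht : 0 < t) :
    ∫⁻ y in Ioo 0 t, ENNReal.ofReal (y ^ (-(1 / 2) : ℝ)) = ENNReal.ofReal (2 * t ^ (1 / 2 : ℝ)) := by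
  have hi : IntegrableOn (fun y : ℝ => y ^ (-(1 / 2) : ℝ)) (Ioo 0 t) := by
    have := (intervalIntegral.intervalIntegrable_rpow' (a := 0) (b := t)
      (r := -(1 / 2)) (by norm_num))
    exact ((intervalIntegrable_iff_integrableOn_Ioc_of_le ht.le).1 this).mono_set
      Ioo_subset_Ioc_self
  rw [← ofReal_integral_eq_lintegral_ofReal hi, ← integral_Ioc_eq_integral_Ioo,
    ← intervalIntegral.integral_of_le ht.le, integral_rpow (Or.inl (by norm_num))]
  · congr 1
    norm_num
    ring
  · filter_upwards [ae_restrict_mem measurableSet_Ioo] with y hy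
    exact Real.rpow_nonneg hy.1.le _

theorem lintegral_rpow_neg_three_halves {y : ℝ} (hy : 0 < y) :
    ∫⁻ t in Ioi y, ENNReal.ofReal (t ^ (-(3 / 2) : ℝ)) =
      ENNReal.ofReal (2 * y ^ (-(1 / 2) : ℝ)) := by
  have hi := integrableOn_Ioi_rpow_of_lt (a := -(3 / 2)) (by norm_num) hy
  rw [← ofReal_integral_eq_lintegral_ofReal hi, integral_Ioi_rpow_of_lt (by norm_num) hy]
  · congr 1
    norm_num
    ring
  · filter_upwards [ae_restrict_mem measurableSet_Ioi] with t ht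
    exact Real.rpow_nonneg (hy.trans ht).le _

/-- Hardy's inequality. -/
theorem hardy_inequality {g : ℝ → ℝ≥0∞} (hg : Measurable g) (ρ : ℝ) :
    ∫⁻ t in Ioo 0 ρ, ((∫⁻ y in Ioo 0 t, g y) / ENNReal.ofReal t) ^ 2 ≤
      4 * ∫⁻ y in Ioo 0 ρ, g y ^ 2 := by
  have hm : ∀ r : ℝ, Measurable fun y : ℝ => ENNReal.ofReal (y ^ r) := fun r => by fun_prop
  -- Cauchy–Schwarz with g = y^(−1/4) · (y^(1/4) g). Since ∫₀ᵗ y^(−1/2) dy = 2t^(1/2), division by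
  -- t² leaves the factor 2t^(−3/2).
  have key : ∀ t ∈ Ioo 0 ρ, ((∫⁻ y in Ioo 0 t, g y) / ENNReal.ofReal t) ^ 2 ≤
      2 * ENNReal.ofReal (t ^ (-(3 / 2) : ℝ)) *
        ∫⁻ y in Ioo 0 t, ENNReal.ofReal (y ^ (1 / 2 : ℝ)) * g y ^ 2 := by
    intro t ht
    have ht0 : 0 < t := ht.1
    have h1 : (∫⁻ y in Ioo 0 t, g y) ^ 2 ≤ ENNReal.ofReal (2 * t ^ (1 / 2 : ℝ)) *
        ∫⁻ y in Ioo 0 t, ENNReal.ofReal (y ^ (1 / 2 : ℝ)) * g y ^ 2 := by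
      have h2 := sq_lintegral_mul_le (volume.restrict (Ioo 0 t))
        (hm (-(1 / 4))).aemeasurable (((hm (1 / 4)).mul hg).aemeasurable)
      have h3 : ∫⁻ y in Ioo 0 t, ENNReal.ofReal (y ^ (-(1 / 4) : ℝ)) *
          ((fun y => ENNReal.ofReal (y ^ (1 / 4 : ℝ))) * g) y = ∫⁻ y in Ioo 0 t, g y := by
        refine setLIntegral_congr_fun measurableSet_Ioo fun y hy => ?_
        simp only [Pi.mul_apply]
        rw [← mul_assoc, ← ENNReal.ofReal_mul (Real.rpow_nonneg hy.1.le _),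
          ← Real.rpow_add hy.1]
        norm_num
      have h4 : ∫⁻ y in Ioo 0 t, ENNReal.ofReal (y ^ (-(1 / 4) : ℝ)) ^ 2 =
          ENNReal.ofReal (2 * t ^ (1 / 2 : ℝ)) := by
        rw [← lintegral_rpow_neg_half_le ht0]
        refine setLIntegral_congr_fun measurableSet_Ioo fun y hy => ?_
        rw [← ENNReal.ofReal_pow (Real.rpow_nonneg hy.1.le _), ← Real.rpow_natCast,
          ← Real.rpow_mul hy.1.le]
        norm_num
      have h5 : ∫⁻ y in Ioo 0 t, ((fun y => ENNReal.ofReal (y ^ (1 / 4 : ℝ))) * g) y ^ 2 =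
          ∫⁻ y in Ioo 0 t, ENNReal.ofReal (y ^ (1 / 2 : ℝ)) * g y ^ 2 := by
        refine setLIntegral_congr_fun measurableSet_Ioo fun y hy => ?_
        simp only [Pi.mul_apply]
        rw [mul_pow, ← ENNReal.ofReal_pow (Real.rpow_nonneg hy.1.le _), ← Real.rpow_natCast,
          ← Real.rpow_mul hy.1.le]
        norm_num
      rwa [h3, h4, h5] at h2
    rw [ENNReal.div_eq_inv_mul, mul_pow]
    calc (ENNReal.ofReal t)⁻¹ ^ 2 * (∫⁻ y in Ioo 0 t, g y) ^ 2
        ≤ (ENNReal.ofReal t)⁻¹ ^ 2 * (ENNReal.ofReal (2 * t ^ (1 / 2 : ℝ)) *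
          ∫⁻ y in Ioo 0 t, ENNReal.ofReal (y ^ (1 / 2 : ℝ)) * g y ^ 2) := by gcongr
      _ = _ := by
        rw [← mul_assoc]
        congr 1
        rw [← ENNReal.ofReal_inv_of_pos ht0, ← ENNReal.ofReal_pow (by positivity),
          ← ENNReal.ofReal_mul (by positivity), ← ENNReal.ofReal_ofNat 2,
          ← ENNReal.ofReal_mul (by norm_num)]
        congr 1
        have : t⁻¹ ^ 2 * t ^ (1 / 2 : ℝ) = t ^ (-(3 / 2) : ℝ) := by
          rw [← Real.rpow_neg_one, ← Real.rpow_natCast, ← Real.rpow_mul ht0.le,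
            ← Real.rpow_add ht0]
          norm_num
        rw [← this]; ring
  calc ∫⁻ t in Ioo 0 ρ, ((∫⁻ y in Ioo 0 t, g y) / ENNReal.ofReal t) ^ 2
      ≤ ∫⁻ t in Ioo 0 ρ, ∫⁻ y in Ioo 0 ρ, (Iio t).indicator (fun y =>
        2 * ENNReal.ofReal (t ^ (-(3 / 2) : ℝ)) *
          (ENNReal.ofReal (y ^ (1 / 2 : ℝ)) * g y ^ 2)) y := by
        refine setLIntegral_mono' measurableSet_Ioo fun t ht => (key t ht).trans ?_
        rw [lintegral_indicator measurableSet_Iio, Measure.restrict_restrict measurableSet_Iio,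
          lintegral_const_mul _ (by exact (hm _).mul (hg.pow_const 2))]
        gcongr
        exact fun y hy => ⟨hy.2, hy.1, hy.2.trans ht.2⟩
    -- Tonelli on the triangle y < t. The t-integral of t^(−3/2) over (y, ∞) is 2y^(−1/2) and
    -- cancels the weight y^(1/2), which leaves 2 · 2 = 4.
    _ = ∫⁻ y in Ioo 0 ρ, ∫⁻ t in Ioo 0 ρ, (Iio t).indicator (fun y =>
        2 * ENNReal.ofReal (t ^ (-(3 / 2) : ℝ)) *
          (ENNReal.ofReal (y ^ (1 / 2 : ℝ)) * g y ^ 2)) y := by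
        refine lintegral_lintegral_swap (Measurable.aemeasurable ?_)
        have : (Function.uncurry fun t y : ℝ => (Iio t).indicator (fun y =>
            2 * ENNReal.ofReal (t ^ (-(3 / 2) : ℝ)) *
              (ENNReal.ofReal (y ^ (1 / 2 : ℝ)) * g y ^ 2)) y) =
            {p : ℝ × ℝ | p.2 < p.1}.indicator (fun p =>
              2 * ENNReal.ofReal (p.1 ^ (-(3 / 2) : ℝ)) *
                (ENNReal.ofReal (p.2 ^ (1 / 2 : ℝ)) * g p.2 ^ 2)) := by
          ext ⟨t, y⟩
          simp [Function.uncurry, indicator]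
        rw [this]
        refine Measurable.indicator ?_ (measurableSet_lt measurable_snd measurable_fst)
        exact (((hm _).comp measurable_fst).const_mul 2).mul
          (((hm _).comp measurable_snd).mul ((hg.comp measurable_snd).pow_const 2))
    _ ≤ ∫⁻ y in Ioo 0 ρ, 4 * g y ^ 2 := by
        refine setLIntegral_mono' measurableSet_Ioo fun y hy => ?_
        calc ∫⁻ t in Ioo 0 ρ, (Iio t).indicator (fun y =>
              2 * ENNReal.ofReal (t ^ (-(3 / 2) : ℝ)) *
              (ENNReal.ofReal (y ^ (1 / 2 : ℝ)) * g y ^ 2)) y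
            ≤ ∫⁻ t, (Ioi y).indicator (fun t => ENNReal.ofReal (t ^ (-(3 / 2) : ℝ)) *
              (2 * (ENNReal.ofReal (y ^ (1 / 2 : ℝ)) * g y ^ 2))) t := by
              refine (setLIntegral_le_lintegral _ _).trans (lintegral_mono fun t => le_of_eq ?_)
              by_cases h : y < t
              · rw [indicator_of_mem (mem_Iio.2 h), indicator_of_mem (mem_Ioi.2 h)]
                ring
              · rw [indicator_of_notMem (by simpa using h), indicator_of_notMem (by simpa using h)]
          _ = 4 * g y ^ 2 := by
              rw [lintegral_indicator measurableSet_Ioi, lintegral_mul_const _ (hm _),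
                lintegral_rpow_neg_three_halves hy.1]
              have h1 : ENNReal.ofReal (2 * y ^ (-(1 / 2) : ℝ)) * ENNReal.ofReal (y ^ (1 / 2 : ℝ))
                  = 2 := by
                have : y ^ (-(1 / 2) : ℝ) * y ^ (1 / 2 : ℝ) = 1 := by
                  rw [← Real.rpow_add hy.1]; norm_num
                rw [← ENNReal.ofReal_mul (by have := Real.rpow_nonneg hy.1.le (-(1/2)); positivity),
                  mul_assoc, this]
                simp
              calc _ = ENNReal.ofReal (2 * y ^ (-(1 / 2) : ℝ)) * ENNReal.ofReal (y ^ (1 / 2 : ℝ))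
                    * 2 * g y ^ 2 := by ring
                _ = _ := by rw [h1]; norm_num
    _ = _ := lintegral_const_mul _ (hg.pow_const 2)

theorem hardy_enorm_sub {φ φ' : ℝ → ℂ} (hφ : ∀ t, HasDerivAt φ (φ' t) t)
    (hc : Continuous φ') (ρ : ℝ) :
    ∫⁻ t in Ioo 0 ρ, (‖φ t - φ 0‖ₑ / ENNReal.ofReal t) ^ 2 ≤
      4 * ∫⁻ y in Ioo 0 ρ, ‖φ' y‖ₑ ^ 2 := by
  refine le_trans (setLIntegral_mono' measurableSet_Ioo fun t ht => ?_)
    (hardy_inequality hc.enorm.measurable ρ)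
  gcongr
  exact enorm_sub_le_lintegral hφ hc ht.1.le

end Line

end

section

/-! ### Gagliardo seminorms along coordinate lines -/

section Gagliardo

open Set Function

variable {V V₁ V₂ : ℝ → ℝ → ℂ} {g : ℝ → ℝ → ℝ≥0∞}

theorem lintegral_lintegral_const_mul {μ ν : Measure ℝ} [SFinite ν] {f : ℝ → ℝ → ℝ≥0∞}
    (hf : Measurable (uncurry f)) (c : ℝ≥0∞) :
    ∫⁻ s, ∫⁻ t, c * f s t ∂ν ∂μ = c * ∫⁻ s, ∫⁻ t, f s t ∂ν ∂μ := by
  have h : Measurable fun s => ∫⁻ t, f s t ∂ν := hf.lintegral_prod_right'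
  rw [← lintegral_const_mul _ h]
  exact lintegral_congr fun s => lintegral_const_mul _ (hf.comp measurable_prodMk_left)

theorem lintegral_lintegral_const_mul_add {μ ν : Measure ℝ} [SFinite ν] {f : ℝ → ℝ → ℝ≥0∞}
    (hf : Measurable (uncurry f)) (c : ℝ≥0∞) (k : ℝ → ℝ → ℝ≥0∞) :
    ∫⁻ s, ∫⁻ t, (c * f s t + k s t) ∂ν ∂μ =
      c * (∫⁻ s, ∫⁻ t, f s t ∂ν ∂μ) + ∫⁻ s, ∫⁻ t, k s t ∂ν ∂μ := by
  have h : Measurable fun s => ∫⁻ t, c * f s t ∂ν := (hf.const_mul c).lintegral_prod_right'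
  rw [← lintegral_lintegral_const_mul hf, ← lintegral_add_left h]
  exact lintegral_congr fun s => lintegral_add_left ((hf.comp measurable_prodMk_left).const_mul c) _

theorem div_add_sq_le (x y d : ℝ≥0∞) :
    ((x + y) / d) ^ 2 ≤ 2 * (x / d) ^ 2 + 2 * (y / d) ^ 2 := by
  rw [ENNReal.add_div]
  exact add_sq_le_two_mul _ _

theorem enorm_sub_le_add (x y z : ℂ) : ‖x - z‖ₑ ≤ ‖x - y‖ₑ + ‖y - z‖ₑ := by
  calc ‖x - z‖ₑ = ‖(x - y) + (y - z)‖ₑ := by rw [sub_add_sub_cancel]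
    _ ≤ _ := enorm_add_le _ _

/-- Hardy's inequality on a single vertical line; g stands for a common bound of both partial
derivatives. -/
theorem gagliardo_vertical_le (hV₂ : ∀ s t, HasDerivAt (fun t => V s t) (V₂ s t) t)
    (cV₂ : ∀ s, Continuous (V₂ s)) (h₂ : ∀ s t, ‖V₂ s t‖ₑ ≤ g s t) (ρ s : ℝ) :
    ∫⁻ t in Ioo 0 ρ, (‖V s t - V s 0‖ₑ / ENNReal.ofReal t) ^ 2 ≤
      4 * ∫⁻ t in Ioo 0 ρ, g s t ^ 2 := by
  refine (hardy_enorm_sub (hV₂ s) (cV₂ s) ρ).trans ?_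
  gcongr with t
  exact h₂ s t

/-- Differences of the values on the two legs of a corner. -/
theorem gagliardo_corner_le (cV : Continuous (uncurry V))
    (hV₁ : ∀ s t, HasDerivAt (fun s => V s t) (V₁ s t) s)
    (hV₂ : ∀ s t, HasDerivAt (fun t => V s t) (V₂ s t) t)
    (cV₁ : ∀ t, Continuous fun s => V₁ s t) (cV₂ : ∀ s, Continuous (V₂ s))
    (hg : Measurable (uncurry g))
    (h₁ : ∀ s t, ‖V₁ s t‖ₑ ≤ g s t) (h₂ : ∀ s t, ‖V₂ s t‖ₑ ≤ g s t) {ρ : ℝ}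
    {D : ℝ → ℝ → ℝ≥0∞} (hD₁ : ∀ s t, ENNReal.ofReal s ≤ D s t)
    (hD₂ : ∀ s t, ENNReal.ofReal t ≤ D s t) :
    ∫⁻ s in Ioo 0 ρ, ∫⁻ t in Ioo 0 ρ, (‖V s 0 - V 0 t‖ₑ / D s t) ^ 2 ≤
      16 * ∫⁻ s in Ioo 0 ρ, ∫⁻ t in Ioo 0 ρ, g s t ^ 2 := by
  have m1 : Measurable (uncurry fun s t => (‖V s t - V s 0‖ₑ / ENNReal.ofReal t) ^ 2) := by
    have h1 : Continuous fun p : ℝ × ℝ => V p.1 p.2 := cV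
    have h2 : Continuous fun p : ℝ × ℝ => V p.1 0 := cV.comp (by fun_prop : Continuous
      fun p : ℝ × ℝ => (p.1, (0 : ℝ)))
    have h3 : Measurable fun p : ℝ × ℝ => ‖V p.1 p.2 - V p.1 0‖ₑ := (h1.sub h2).enorm.measurable
    exact (h3.div (by fun_prop)).pow_const 2
  have m2 : Measurable (uncurry fun s t => (‖V s t - V 0 t‖ₑ / ENNReal.ofReal s) ^ 2) := by
    have h1 : Continuous fun p : ℝ × ℝ => V p.1 p.2 := cV
    have h2 : Continuous fun p : ℝ × ℝ => V 0 p.2 := cV.comp (by fun_prop : Continuous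
      fun p : ℝ × ℝ => ((0 : ℝ), p.2))
    have h3 : Measurable fun p : ℝ × ℝ => ‖V p.1 p.2 - V 0 p.2‖ₑ := (h1.sub h2).enorm.measurable
    exact (h3.div (by fun_prop)).pow_const 2
  have mg : Measurable (uncurry fun s t => g s t ^ 2) := hg.pow_const 2
  -- The boundary points (s, 0) and (0, t) are joined through the interior point (s, t). Each leg
  -- has length t or s, at most D, so Hardy applies to it.
  have key : ∀ s t, (‖V s 0 - V 0 t‖ₑ / D s t) ^ 2 ≤
      2 * (‖V s t - V s 0‖ₑ / ENNReal.ofReal t) ^ 2 +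
        2 * (‖V s t - V 0 t‖ₑ / ENNReal.ofReal s) ^ 2 := by
    intro s t
    calc (‖V s 0 - V 0 t‖ₑ / D s t) ^ 2
        ≤ ((‖V s t - V s 0‖ₑ + ‖V s t - V 0 t‖ₑ) / D s t) ^ 2 := by
          gcongr
          rw [← enorm_neg (V s t - V s 0), neg_sub]
          exact enorm_sub_le_add _ _ _
      _ ≤ _ := div_add_sq_le _ _ _
      _ ≤ _ := by
          gcongr
          · exact hD₂ s t
          · exact hD₁ s t
  have e1 : ∫⁻ s in Ioo 0 ρ, ∫⁻ t in Ioo 0 ρ, (‖V s t - V s 0‖ₑ / ENNReal.ofReal t) ^ 2 ≤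
      4 * ∫⁻ s in Ioo 0 ρ, ∫⁻ t in Ioo 0 ρ, g s t ^ 2 := by
    rw [← lintegral_const_mul _ (by exact mg.lintegral_prod_right')]
    exact lintegral_mono fun s => gagliardo_vertical_le hV₂ cV₂ h₂ ρ s
  -- The same estimate with the two coordinates exchanged.
  have e2 : ∫⁻ s in Ioo 0 ρ, ∫⁻ t in Ioo 0 ρ, (‖V s t - V 0 t‖ₑ / ENNReal.ofReal s) ^ 2 ≤
      4 * ∫⁻ s in Ioo 0 ρ, ∫⁻ t in Ioo 0 ρ, g s t ^ 2 := by
    rw [lintegral_lintegral_swap m2.aemeasurable, lintegral_lintegral_swap mg.aemeasurable,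
      ← lintegral_const_mul _ (by exact mg.lintegral_prod_left')]
    exact lintegral_mono fun t => gagliardo_vertical_le (V := fun t s => V s t)
      (V₂ := fun t s => V₁ s t) (g := fun t s => g s t) (fun t s => hV₁ s t)
      cV₁ (fun t s => h₁ s t) ρ t
  calc ∫⁻ s in Ioo 0 ρ, ∫⁻ t in Ioo 0 ρ, (‖V s 0 - V 0 t‖ₑ / D s t) ^ 2
      ≤ ∫⁻ s in Ioo 0 ρ, ∫⁻ t in Ioo 0 ρ,
        (2 * (‖V s t - V s 0‖ₑ / ENNReal.ofReal t) ^ 2 +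
        2 * (‖V s t - V 0 t‖ₑ / ENNReal.ofReal s) ^ 2) :=
        lintegral_mono fun s => lintegral_mono fun t => key s t
    _ = 2 * (∫⁻ s in Ioo 0 ρ, ∫⁻ t in Ioo 0 ρ, (‖V s t - V s 0‖ₑ / ENNReal.ofReal t) ^ 2) +
        2 * ∫⁻ s in Ioo 0 ρ, ∫⁻ t in Ioo 0 ρ, (‖V s t - V 0 t‖ₑ / ENNReal.ofReal s) ^ 2 := by
        rw [lintegral_lintegral_const_mul_add m1, lintegral_lintegral_const_mul m2]
    _ ≤ 2 * (4 * ∫⁻ s in Ioo 0 ρ, ∫⁻ t in Ioo 0 ρ, g s t ^ 2) +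
        2 * (4 * ∫⁻ s in Ioo 0 ρ, ∫⁻ t in Ioo 0 ρ, g s t ^ 2) := by gcongr
    _ = _ := by ring

/-- A shift in the first variable. -/
theorem lintegral_shift_le {A : ℝ → ℝ → ℝ≥0∞} (hA : Measurable (uncurry A)) {L ρ : ℝ} :
    ∫⁻ s in Ioo 0 L, ∫⁻ h in Ioo 0 ρ, (Iio (L - s)).indicator (fun h => A (s + h) h) h ≤
      ∫⁻ s in Ioo 0 L, ∫⁻ h in Ioo 0 ρ, A s h := by
  have hm : Measurable (uncurry fun s h : ℝ =>
      (Iio (L - s)).indicator (fun h => A (s + h) h) h) := by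
    have : (uncurry fun s h : ℝ => (Iio (L - s)).indicator (fun h => A (s + h) h) h) =
        {p : ℝ × ℝ | p.2 < L - p.1}.indicator (fun p => uncurry A (p.1 + p.2, p.2)) := by
      ext ⟨s, h⟩
      simp [uncurry, indicator]
    rw [this]
    refine Measurable.indicator (hA.comp (by fun_prop)) ?_
    exact measurableSet_lt measurable_snd (by fun_prop)
  rw [lintegral_lintegral_swap hm.aemeasurable, lintegral_lintegral_swap hA.aemeasurable]
  refine setLIntegral_mono' measurableSet_Ioo fun h hh => ?_
  calc ∫⁻ s in Ioo 0 L, (Iio (L - s)).indicator (fun h => A (s + h) h) h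
      = ∫⁻ s, (Ioo 0 L).indicator (fun s => (Iio (L - s)).indicator (fun h => A (s + h) h) h) s :=
        (lintegral_indicator measurableSet_Ioo _).symm
    _ ≤ ∫⁻ s, (Ioo 0 L).indicator (fun σ => A σ h) (s + h) := by
        refine lintegral_mono fun s => ?_
        by_cases h1 : s ∈ Ioo 0 L
        · rw [indicator_of_mem h1]
          by_cases h2 : h ∈ Iio (L - s)
          · rw [indicator_of_mem h2, indicator_of_mem]
            have := mem_Iio.1 h2
            exact ⟨add_pos h1.1 hh.1, by linarith⟩
          · rw [indicator_of_notMem h2]; exact zero_le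
        · rw [indicator_of_notMem h1]; exact zero_le
    _ = ∫⁻ s, (Ioo 0 L).indicator (fun σ => A σ h) s :=
        lintegral_add_right_eq_self (fun s => (Ioo 0 L).indicator (fun σ => A σ h) s) h
    _ = _ := lintegral_indicator measurableSet_Ioo _

/-- Horizontal differences at height equal to the horizontal distance. -/
theorem gagliardo_horizontal_le
    (hV₁ : ∀ s t, HasDerivAt (fun s => V s t) (V₁ s t) s)
    (cV₁ : ∀ t, Continuous fun s => V₁ s t)
    (hg : Measurable (uncurry g)) (h₁ : ∀ s t, ‖V₁ s t‖ₑ ≤ g s t) {L ρ : ℝ}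
    (cV : Continuous (uncurry V)) :
    ∫⁻ s in Ioo 0 L, ∫⁻ h in Ioo 0 ρ, (Iio (L - s)).indicator
        (fun h => (‖V (s + h) h - V s h‖ₑ / ENNReal.ofReal h) ^ 2) h ≤
      ∫⁻ s in Ioo 0 L, ∫⁻ h in Ioo 0 ρ, g s h ^ 2 := by
  have mg : Measurable (uncurry fun s t => g s t ^ 2) := hg.pow_const 2
  have hm : Measurable (uncurry fun s h : ℝ => (Iio (L - s)).indicator
      (fun h => (‖V (s + h) h - V s h‖ₑ / ENNReal.ofReal h) ^ 2) h) := by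
    have : (uncurry fun s h : ℝ => (Iio (L - s)).indicator
        (fun h => (‖V (s + h) h - V s h‖ₑ / ENNReal.ofReal h) ^ 2) h) =
        {p : ℝ × ℝ | p.2 < L - p.1}.indicator
        (fun p => (‖V (p.1 + p.2) p.2 - V p.1 p.2‖ₑ / ENNReal.ofReal p.2) ^ 2) := by
      ext ⟨s, h⟩
      simp [uncurry, indicator]
    rw [this]
    refine Measurable.indicator ?_ (measurableSet_lt measurable_snd (by fun_prop))
    have h1 : Continuous fun p : ℝ × ℝ => V p.1 p.2 := cV
    have h2 : Continuous fun p : ℝ × ℝ => V (p.1 + p.2) p.2 := cV.comp (by fun_prop : Continuous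
      fun p : ℝ × ℝ => (p.1 + p.2, p.2))
    have h3 : Measurable fun p : ℝ × ℝ => ‖V (p.1 + p.2) p.2 - V p.1 p.2‖ₑ :=
      (h2.sub h1).enorm.measurable
    exact (h3.div (by fun_prop)).pow_const 2
  rw [lintegral_lintegral_swap hm.aemeasurable, lintegral_lintegral_swap mg.aemeasurable]
  refine setLIntegral_mono' measurableSet_Ioo fun h hh => ?_
  have hh0 : 0 < h := hh.1
  have mgh : Measurable fun σ => g σ h ^ 2 := mg.comp measurable_prodMk_right
  have hh1 : ENNReal.ofReal h ≠ 0 := by simpa using hh0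
  -- Cauchy–Schwarz on a horizontal segment of length h: one of the two factors 1/h is consumed, the
  -- other is cancelled after exchanging the integrals over s and y.
  have pt : ∀ s, (‖V (s + h) h - V s h‖ₑ / ENNReal.ofReal h) ^ 2 ≤
      (ENNReal.ofReal h)⁻¹ * ∫⁻ y in Ioo 0 h, g (s + y) h ^ 2 := by
    intro s
    have hd : ∀ y, HasDerivAt (fun y => V (s + y) h) (V₁ (s + y) h) y := fun y =>
      HasDerivAt.comp_const_add s y (hV₁ (s + y) h)
    have h2 := enorm_sub_le_lintegral hd ((cV₁ h).comp (by fun_prop)) hh0.le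
    simp only [add_zero] at h2
    have h3 : (∫⁻ y in Ioo 0 h, ‖V₁ (s + y) h‖ₑ) ^ 2 ≤
        ENNReal.ofReal h * ∫⁻ y in Ioo 0 h, g (s + y) h ^ 2 := by
      have h4 := sq_lintegral_le (volume.restrict (Ioo 0 h))
        (f := fun y => ‖V₁ (s + y) h‖ₑ) ((cV₁ h).comp (by fun_prop)).enorm.measurable.aemeasurable
      have h5 : (volume.restrict (Ioo (0 : ℝ) h)) univ = ENNReal.ofReal h := by simp
      rw [h5] at h4
      refine h4.trans ?_
      gcongr with y
      exact h₁ _ _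
    rw [ENNReal.div_eq_inv_mul, mul_pow]
    calc (ENNReal.ofReal h)⁻¹ ^ 2 * ‖V (s + h) h - V s h‖ₑ ^ 2
        ≤ (ENNReal.ofReal h)⁻¹ ^ 2 * (ENNReal.ofReal h * ∫⁻ y in Ioo 0 h, g (s + y) h ^ 2) := by
          gcongr
          exact (pow_le_pow_left' h2 2).trans h3
      _ = (ENNReal.ofReal h)⁻¹ * ((ENNReal.ofReal h)⁻¹ * ENNReal.ofReal h) *
          ∫⁻ y in Ioo 0 h, g (s + y) h ^ 2 := by ring
      _ = _ := by rw [ENNReal.inv_mul_cancel hh1 ENNReal.ofReal_ne_top, mul_one]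
  calc ∫⁻ s in Ioo 0 L, (Iio (L - s)).indicator
        (fun h => (‖V (s + h) h - V s h‖ₑ / ENNReal.ofReal h) ^ 2) h
      ≤ ∫⁻ s in Ioo 0 (L - h), (ENNReal.ofReal h)⁻¹ * ∫⁻ y in Ioo 0 h, g (s + y) h ^ 2 := by
        rw [← lintegral_indicator measurableSet_Ioo, ← lintegral_indicator measurableSet_Ioo]
        refine lintegral_mono fun s => ?_
        by_cases h1 : s ∈ Ioo 0 L
        · rw [indicator_of_mem h1]
          by_cases h2 : h ∈ Iio (L - s)
          · have h3 := mem_Iio.1 h2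
            have hmem : s ∈ Ioo 0 (L - h) := ⟨h1.1, by linarith⟩
            rw [indicator_of_mem h2, indicator_of_mem hmem]
            exact pt s
          · rw [indicator_of_notMem h2]; exact zero_le
        · rw [indicator_of_notMem h1]; exact zero_le
    _ = (ENNReal.ofReal h)⁻¹ *
        ∫⁻ y in Ioo 0 h, ∫⁻ s in Ioo 0 (L - h), g (s + y) h ^ 2 := by
        have m3 : Measurable (uncurry fun s y : ℝ => g (s + y) h ^ 2) :=
          mgh.comp (by fun_prop : Measurable fun p : ℝ × ℝ => p.1 + p.2)
        rw [lintegral_const_mul _ (by exact m3.lintegral_prod_right'),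
          lintegral_lintegral_swap m3.aemeasurable]
    _ ≤ (ENNReal.ofReal h)⁻¹ * ∫⁻ _y in Ioo 0 h, ∫⁻ s in Ioo 0 L, g s h ^ 2 := by
        refine mul_le_mul' le_rfl (setLIntegral_mono' measurableSet_Ioo fun y hy => ?_)
        rw [← lintegral_indicator measurableSet_Ioo, ← lintegral_indicator measurableSet_Ioo,
          ← lintegral_add_right_eq_self (fun s => (Ioo 0 L).indicator (fun σ => g σ h ^ 2) s) y]
        refine lintegral_mono fun s => ?_
        by_cases h1 : s ∈ Ioo 0 (L - h)
        · rw [indicator_of_mem h1, indicator_of_mem]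
          exact ⟨add_pos h1.1 hy.1, by linarith [h1.2, hy.2]⟩
        · rw [indicator_of_notMem h1]; exact zero_le
    _ = _ := by
        rw [setLIntegral_const, mul_comm, mul_assoc]
        simp only [Real.volume_Ioo, sub_zero]
        rw [ENNReal.mul_inv_cancel hh1 ENNReal.ofReal_ne_top, mul_one]

/-- Differences of the values on one side, at horizontal distance less than `ρ`. -/
theorem gagliardo_side_le (cV : Continuous (uncurry V))
    (hV₁ : ∀ s t, HasDerivAt (fun s => V s t) (V₁ s t) s)
    (hV₂ : ∀ s t, HasDerivAt (fun t => V s t) (V₂ s t) t)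
    (cV₁ : ∀ t, Continuous fun s => V₁ s t) (cV₂ : ∀ s, Continuous (V₂ s))
    (hg : Measurable (uncurry g))
    (h₁ : ∀ s t, ‖V₁ s t‖ₑ ≤ g s t) (h₂ : ∀ s t, ‖V₂ s t‖ₑ ≤ g s t) {L ρ : ℝ} :
    ∫⁻ s in Ioo 0 L, ∫⁻ h in Ioo 0 ρ, (Iio (L - s)).indicator
        (fun h => (‖V (s + h) 0 - V s 0‖ₑ / ENNReal.ofReal h) ^ 2) h ≤
      34 * ∫⁻ s in Ioo 0 L, ∫⁻ h in Ioo 0 ρ, g s h ^ 2 := by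
  have mg : Measurable (uncurry fun s t => g s t ^ 2) := hg.pow_const 2
  have c0 : Continuous fun p : ℝ × ℝ => V p.1 p.2 := cV
  have c1 : Continuous fun p : ℝ × ℝ => V p.1 0 :=
    cV.comp (by fun_prop : Continuous fun p : ℝ × ℝ => (p.1, (0 : ℝ)))
  have c2 : Continuous fun p : ℝ × ℝ => V (p.1 + p.2) p.2 :=
    cV.comp (by fun_prop : Continuous fun p : ℝ × ℝ => (p.1 + p.2, p.2))
  have c3 : Continuous fun p : ℝ × ℝ => V (p.1 + p.2) 0 :=
    cV.comp (by fun_prop : Continuous fun p : ℝ × ℝ => (p.1 + p.2, (0 : ℝ)))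
  have mA : Measurable (uncurry fun s h => (‖V s h - V s 0‖ₑ / ENNReal.ofReal h) ^ 2) :=
    ((c0.sub c1).enorm.measurable.div (by fun_prop)).pow_const 2
  have mI : MeasurableSet {p : ℝ × ℝ | p.2 < L - p.1} :=
    measurableSet_lt measurable_snd (by fun_prop)
  have mX : Measurable (uncurry fun s h : ℝ => (Iio (L - s)).indicator
      (fun h => (‖V (s + h) h - V s h‖ₑ / ENNReal.ofReal h) ^ 2) h) := by
    have : (uncurry fun s h : ℝ => (Iio (L - s)).indicator
        (fun h => (‖V (s + h) h - V s h‖ₑ / ENNReal.ofReal h) ^ 2) h) =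
        {p : ℝ × ℝ | p.2 < L - p.1}.indicator
        (fun p => (‖V (p.1 + p.2) p.2 - V p.1 p.2‖ₑ / ENNReal.ofReal p.2) ^ 2) := by
      ext ⟨s, h⟩
      simp [uncurry, indicator]
    rw [this]
    exact Measurable.indicator
      (((c2.sub c0).enorm.measurable.div (by fun_prop)).pow_const 2) mI
  have mZ : Measurable (uncurry fun s h : ℝ => (Iio (L - s)).indicator
      (fun h => (‖V (s + h) h - V (s + h) 0‖ₑ / ENNReal.ofReal h) ^ 2) h) := by
    have : (uncurry fun s h : ℝ => (Iio (L - s)).indicator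
        (fun h => (‖V (s + h) h - V (s + h) 0‖ₑ / ENNReal.ofReal h) ^ 2) h) =
        {p : ℝ × ℝ | p.2 < L - p.1}.indicator
        (fun p => (‖V (p.1 + p.2) p.2 - V (p.1 + p.2) 0‖ₑ / ENNReal.ofReal p.2) ^ 2) := by
      ext ⟨s, h⟩
      simp [uncurry, indicator]
    rw [this]
    exact Measurable.indicator
      (((c2.sub c3).enorm.measurable.div (by fun_prop)).pow_const 2) mI
  -- The path from (s, 0) to (s + h, 0) rises to height h, moves horizontally and descends. The
  -- three legs contribute 2·1 + 4·4 + 4·4 = 34.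
  have key : ∀ s h, (Iio (L - s)).indicator
        (fun h => (‖V (s + h) 0 - V s 0‖ₑ / ENNReal.ofReal h) ^ 2) h ≤
      2 * (Iio (L - s)).indicator
        (fun h => (‖V (s + h) h - V s h‖ₑ / ENNReal.ofReal h) ^ 2) h +
      (4 * (‖V s h - V s 0‖ₑ / ENNReal.ofReal h) ^ 2 +
      4 * (Iio (L - s)).indicator
        (fun h => (‖V (s + h) h - V (s + h) 0‖ₑ / ENNReal.ofReal h) ^ 2) h) := by
    intro s h
    by_cases hm : h ∈ Iio (L - s)
    · simp only [indicator_of_mem hm]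
      have e : ‖V (s + h) 0 - V s 0‖ₑ ≤ ‖V (s + h) h - V s h‖ₑ +
          (‖V s h - V s 0‖ₑ + ‖V (s + h) h - V (s + h) 0‖ₑ) := by
        calc ‖V (s + h) 0 - V s 0‖ₑ = ‖(V (s + h) h - V s h) + ((V s h - V s 0) -
              (V (s + h) h - V (s + h) 0))‖ₑ := by congr 1; ring
          _ ≤ _ := (enorm_add_le _ _).trans (by gcongr; exact enorm_sub_le)
      calc _ ≤ ((‖V (s + h) h - V s h‖ₑ +
          (‖V s h - V s 0‖ₑ + ‖V (s + h) h - V (s + h) 0‖ₑ)) / ENNReal.ofReal h) ^ 2 := by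
            gcongr
        _ ≤ _ := div_add_sq_le _ _ _
        _ ≤ 2 * (‖V (s + h) h - V s h‖ₑ / ENNReal.ofReal h) ^ 2 +
          2 * (2 * (‖V s h - V s 0‖ₑ / ENNReal.ofReal h) ^ 2 +
          2 * (‖V (s + h) h - V (s + h) 0‖ₑ / ENNReal.ofReal h) ^ 2) := by
            gcongr
            exact div_add_sq_le _ _ _
        _ = _ := by ring
    · rw [indicator_of_notMem hm]; exact zero_le
  have e1 := gagliardo_horizontal_le (L := L) (ρ := ρ) hV₁ cV₁ hg h₁ cV
  have e2 : ∫⁻ s in Ioo 0 L, ∫⁻ h in Ioo 0 ρ, (‖V s h - V s 0‖ₑ / ENNReal.ofReal h) ^ 2 ≤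
      4 * ∫⁻ s in Ioo 0 L, ∫⁻ h in Ioo 0 ρ, g s h ^ 2 := by
    rw [← lintegral_const_mul _ (by exact mg.lintegral_prod_right')]
    exact lintegral_mono fun s => gagliardo_vertical_le hV₂ cV₂ h₂ ρ s
  have e3 := (lintegral_shift_le (L := L) (ρ := ρ) mA).trans e2
  calc _ ≤ ∫⁻ s in Ioo 0 L, ∫⁻ h in Ioo 0 ρ, (2 * (Iio (L - s)).indicator
        (fun h => (‖V (s + h) h - V s h‖ₑ / ENNReal.ofReal h) ^ 2) h +
      (4 * (‖V s h - V s 0‖ₑ / ENNReal.ofReal h) ^ 2 +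
      4 * (Iio (L - s)).indicator
        (fun h => (‖V (s + h) h - V (s + h) 0‖ₑ / ENNReal.ofReal h) ^ 2) h)) :=
        lintegral_mono fun s => lintegral_mono fun h => key s h
    _ = 2 * (∫⁻ s in Ioo 0 L, ∫⁻ h in Ioo 0 ρ, (Iio (L - s)).indicator
        (fun h => (‖V (s + h) h - V s h‖ₑ / ENNReal.ofReal h) ^ 2) h) +
      (4 * (∫⁻ s in Ioo 0 L, ∫⁻ h in Ioo 0 ρ, (‖V s h - V s 0‖ₑ / ENNReal.ofReal h) ^ 2) +
      4 * (∫⁻ s in Ioo 0 L, ∫⁻ h in Ioo 0 ρ, (Iio (L - s)).indicator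
        (fun h => (‖V (s + h) h - V (s + h) 0‖ₑ / ENNReal.ofReal h) ^ 2) h)) := by
        rw [lintegral_lintegral_const_mul_add mX, lintegral_lintegral_const_mul_add mA,
          lintegral_lintegral_const_mul mZ]
    _ ≤ _ := by
        refine (add_le_add (mul_le_mul' le_rfl e1) (add_le_add (mul_le_mul' le_rfl e2)
          (mul_le_mul' le_rfl e3))).trans (le_of_eq ?_)
        ring

end Gagliardo

end

section

/-! ### Orthonormal frames and trace inequalities -/

section Frame

open Set Function

/-- The point with coordinates `(s, t)` in the frame with origin `c` and axes `e`, `f`. -/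
def frame (c e f : Plane) (s t : ℝ) : Plane := c + s • e + t • f

variable {c e f : Plane}

theorem continuous_frame : Continuous (uncurry (frame c e f)) := by
  unfold frame uncurry
  fun_prop

/-- Coordinates with respect to an orthonormal frame preserve Lebesgue measure; Tonelli does the
rest. -/
theorem lintegral_frame (h : Orthonormal ℝ ![e, f]) {F : Plane → ℝ≥0∞} (hF : Measurable F) :
    ∫⁻ x, F x = ∫⁻ s, ∫⁻ t, F (frame c e f s t) := by
  have hc : Fintype.card (Fin 2) = Module.finrank ℝ Plane := by simp
  let B : OrthonormalBasis (Fin 2) ℝ Plane :=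
    OrthonormalBasis.mk h (by
      have := (basisOfOrthonormalOfCardEqFinrank h hc).span_eq
      rw [coe_basisOfOrthonormalOfCardEqFinrank] at this
      rw [this])
  have hB : ∀ s t : ℝ, B.repr.symm (WithLp.toLp 2 ![s, t]) = s • e + t • f := by
    intro s t
    rw [← B.sum_repr_symm, Fin.sum_univ_two]
    simp [B]
  have hm : Measurable fun p : ℝ × ℝ => F (frame c e f p.1 p.2) :=
    hF.comp continuous_frame.measurable
  calc ∫⁻ x, F x = ∫⁻ x, F (c + x) := (lintegral_add_left_eq_self F c).symm
    _ = ∫⁻ y, F (c + B.repr.symm y) :=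
        (B.measurePreserving_repr_symm.lintegral_comp (hF.comp (measurable_const_add c))).symm
    _ = ∫⁻ z : Fin 2 → ℝ, F (c + B.repr.symm (WithLp.toLp 2 z)) :=
        ((PiLp.volume_preserving_toLp (Fin 2)).lintegral_comp (hF.comp
          ((measurable_const_add c).comp B.repr.symm.continuous.measurable))).symm
    _ = ∫⁻ p : ℝ × ℝ, F (c + B.repr.symm (WithLp.toLp 2 ![p.1, p.2])) :=
        ((volume_preserving_finTwoArrow ℝ).symm.lintegral_comp (hF.comp
          ((measurable_const_add c).comp (B.repr.symm.continuous.measurable.comp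
            (PiLp.volume_preserving_toLp (Fin 2)).measurable)))).symm
    _ = ∫⁻ p : ℝ × ℝ, F (frame c e f p.1 p.2) := by
        refine lintegral_congr fun p => ?_
        rw [hB, frame, add_assoc]
    _ = _ := by
        rw [Measure.volume_eq_prod, lintegral_prod _ hm.aemeasurable]

/-- On each column the shift by η s is a translation, so no regularity of η is needed. The images of
the columns lie in Ω. -/
theorem lintegral_columns_le (h : Orthonormal ℝ ![e, f]) {F : Plane → ℝ≥0∞} (hF : Measurable F)
    {Ω : Set Plane} (hΩ : MeasurableSet Ω) {I J : Set ℝ} (hI : MeasurableSet I)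
    (hJ : MeasurableSet J) {η : ℝ → ℝ}
    (hsub : ∀ s ∈ I, ∀ t ∈ J, frame c e f s (η s + t) ∈ Ω) :
    ∫⁻ s in I, ∫⁻ t in J, F (frame c e f s (η s + t)) ≤ ∫⁻ x in Ω, F x := by
  rw [← lintegral_indicator hΩ, lintegral_frame (c := c) h (hF.indicator hΩ),
    ← lintegral_indicator hI]
  refine lintegral_mono fun s => ?_
  by_cases hs : s ∈ I
  · rw [indicator_of_mem hs, ← lintegral_indicator hJ,
      ← lintegral_add_left_eq_self (fun t => Ω.indicator F (frame c e f s t)) (η s)]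
    refine lintegral_mono fun t => ?_
    by_cases ht : t ∈ J
    · rw [indicator_of_mem ht, indicator_of_mem (hsub s hs t ht)]
    · rw [indicator_of_notMem ht]; exact zero_le
  · rw [indicator_of_notMem hs]; exact zero_le

/-- The opposite comparison, for sets covered by the columns. -/
theorem le_lintegral_columns (h : Orthonormal ℝ ![e, f]) {F : Plane → ℝ≥0∞} (hF : Measurable F)
    {N : Set Plane} (hN : MeasurableSet N) {I J : Set ℝ} (hI : MeasurableSet I)
    (hJ : MeasurableSet J) {η : ℝ → ℝ}
    (hsub : ∀ s t, frame c e f s (η s + t) ∈ N → s ∈ I ∧ t ∈ J) :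
    ∫⁻ x in N, F x ≤ ∫⁻ s in I, ∫⁻ t in J, F (frame c e f s (η s + t)) := by
  rw [← lintegral_indicator hN, lintegral_frame (c := c) h (hF.indicator hN),
    ← lintegral_indicator hI]
  refine lintegral_mono fun s => ?_
  rw [← lintegral_add_left_eq_self (fun t => N.indicator F (frame c e f s t)) (η s)]
  by_cases hs : s ∈ I
  · rw [indicator_of_mem hs, ← lintegral_indicator hJ]
    refine lintegral_mono fun t => ?_
    by_cases ht : frame c e f s (η s + t) ∈ N
    · rw [indicator_of_mem ht, indicator_of_mem (hsub s t ht).2]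
    · rw [indicator_of_notMem ht]; exact zero_le
  · rw [indicator_of_notMem hs]
    refine le_of_eq ?_
    rw [lintegral_eq_zero_of_ae_eq_zero]
    refine .of_forall fun t => indicator_of_notMem (fun ht => hs (hsub s t ht).1) _

/-- The squared `H¹(Ω)` norm of a smooth function. -/
def sobolevSq (Ω : Set Plane) (v : Plane → ℂ) : ℝ≥0∞ :=
  ∫⁻ x in Ω, (‖v x‖ₑ ^ 2 + ‖fderiv ℝ v x‖ₑ ^ 2)

variable {v : Plane → ℂ}

theorem measurable_sobolevSq (hv : ContDiff ℝ ∞ v) :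
    Measurable fun x => ‖v x‖ₑ ^ 2 + ‖fderiv ℝ v x‖ₑ ^ 2 :=
  (hv.continuous.enorm.measurable.pow_const 2).add
    ((hv.continuous_fderiv (by simp)).enorm.measurable.pow_const 2)

theorem lintegral_fderiv_le_sobolevSq (Ω : Set Plane) (v : Plane → ℂ) :
    ∫⁻ x in Ω, ‖fderiv ℝ v x‖ₑ ^ 2 ≤ sobolevSq Ω v :=
  lintegral_mono fun _ => le_add_self

theorem hasDerivAt_frame_left (hv : ContDiff ℝ ∞ v) (s t : ℝ) :
    HasDerivAt (fun s => v (frame c e f s t)) (fderiv ℝ v (frame c e f s t) e) s := by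
  have h1 : HasDerivAt (fun s => frame c e f s t) e s := by
    unfold frame
    simpa using (((hasDerivAt_id s).smul_const e).const_add c).add_const (t • f)
  exact ((hv.differentiable (by simp)) _).hasFDerivAt.comp_hasDerivAt s h1

theorem hasDerivAt_frame_right (hv : ContDiff ℝ ∞ v) (s t : ℝ) :
    HasDerivAt (fun t => v (frame c e f s t)) (fderiv ℝ v (frame c e f s t) f) t := by
  have h1 : HasDerivAt (fun t => frame c e f s t) f t := by
    unfold frame
    simpa using ((hasDerivAt_id t).smul_const f).const_add (c + s • e)
  exact ((hv.differentiable (by simp)) _).hasFDerivAt.comp_hasDerivAt t h1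

theorem enorm_apply_le {L : Plane →L[ℝ] ℂ} {e : Plane} (he : ‖e‖ = 1) : ‖L e‖ₑ ≤ ‖L‖ₑ := by
  rw [← ofReal_norm, ← ofReal_norm]
  exact ENNReal.ofReal_le_ofReal (by simpa [he] using L.le_opNorm e)

theorem enorm_fderiv_sq_le (v : Plane → ℂ) (x : Plane) :
    ‖fderiv ℝ v x‖ₑ ^ 2 ≤ 2 * ∑ i, ‖partialDeriv i v x‖ₑ ^ 2 := by
  have h : ‖fderiv ℝ v x‖ ≤ ‖partialDeriv 0 v x‖ + ‖partialDeriv 1 v x‖ := by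
    refine ContinuousLinearMap.opNorm_le_bound _ (by positivity) fun y => ?_
    have hy : y = y 0 • EuclideanSpace.single 0 1 + y 1 • EuclideanSpace.single 1 1 := by
      ext i; fin_cases i <;> simp
    calc ‖fderiv ℝ v x y‖ = ‖y 0 • partialDeriv 0 v x + y 1 • partialDeriv 1 v x‖ := by
          conv_lhs => rw [hy]
          simp only [map_add, map_smul, partialDeriv]
      _ ≤ ‖y 0‖ * ‖partialDeriv 0 v x‖ + ‖y 1‖ * ‖partialDeriv 1 v x‖ := by
          refine (norm_add_le _ _).trans ?_
          rw [norm_smul, norm_smul]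
      _ ≤ ‖y‖ * ‖partialDeriv 0 v x‖ + ‖y‖ * ‖partialDeriv 1 v x‖ := by
          gcongr <;> exact PiLp.norm_apply_le _ _
      _ = _ := by ring
  have h2 : ‖fderiv ℝ v x‖ₑ ≤ ‖partialDeriv 0 v x‖ₑ + ‖partialDeriv 1 v x‖ₑ := by
    rw [← ofReal_norm, ← ofReal_norm, ← ofReal_norm, ← ENNReal.ofReal_add (norm_nonneg _)
      (norm_nonneg _)]
    exact ENNReal.ofReal_le_ofReal h
  calc _ ≤ (‖partialDeriv 0 v x‖ₑ + ‖partialDeriv 1 v x‖ₑ) ^ 2 := by gcongr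
    _ ≤ _ := add_sq_le_two_mul _ _
    _ = _ := by rw [Fin.sum_univ_two]; ring

variable {Ω : Set Plane} {I : Set ℝ} {η : ℝ → ℝ} {ρ : ℝ}

/-- The one-dimensional Sobolev inequality on a column. -/
theorem enorm_sq_column_le (hf : ‖f‖ = 1) (hv : ContDiff ℝ ∞ v) (hρ : 0 < ρ) (s r : ℝ) {t : ℝ}
    (ht : t ∈ Icc 0 ρ) :
    ‖v (frame c e f s (r + t))‖ₑ ^ 2 ≤ ENNReal.ofReal (2 / ρ + 2 * ρ) *
      ∫⁻ y in Ioo 0 ρ, (‖v (frame c e f s (r + y))‖ₑ ^ 2 +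
        ‖fderiv ℝ v (frame c e f s (r + y))‖ₑ ^ 2) := by
  have cf : Continuous fun y => frame c e f s (r + y) := by unfold frame; fun_prop
  have cd : Continuous fun y => fderiv ℝ v (frame c e f s (r + y)) :=
    (hv.continuous_fderiv (by simp)).comp cf
  have hd : ∀ y, HasDerivAt (fun y => v (frame c e f s (r + y)))
      (fderiv ℝ v (frame c e f s (r + y)) f) y := fun y =>
    HasDerivAt.comp_const_add r y (hasDerivAt_frame_right hv s (r + y))
  refine (enorm_sq_le_lintegral hd (cd.clm_apply continuous_const) hρ ht).trans ?_
  rw [ENNReal.ofReal_add (by positivity) (by positivity), add_mul]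
  refine add_le_add (mul_le_mul' le_rfl (lintegral_mono fun y => le_self_add))
    (mul_le_mul' le_rfl (lintegral_mono fun y => ?_))
  refine le_trans ?_ le_add_self
  gcongr
  exact enorm_apply_le hf

/-- The Sobolev inequality on each column, evaluated at the foot t = 0 and integrated over the feet.
-/
theorem lintegral_trace_le (h : Orthonormal ℝ ![e, f]) (hv : ContDiff ℝ ∞ v)
    (hΩ : MeasurableSet Ω) (hI : MeasurableSet I) (hρ : 0 < ρ)
    (hsub : ∀ s ∈ I, ∀ t ∈ Ioo 0 ρ, frame c e f s (η s + t) ∈ Ω) :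
    ∫⁻ s in I, ‖v (frame c e f s (η s))‖ₑ ^ 2 ≤
      ENNReal.ofReal (2 / ρ + 2 * ρ) * sobolevSq Ω v := by
  have hf : ‖f‖ = 1 := h.norm_eq_one 1
  calc _ ≤ ∫⁻ s in I, ENNReal.ofReal (2 / ρ + 2 * ρ) *
      ∫⁻ y in Ioo 0 ρ, (‖v (frame c e f s (η s + y))‖ₑ ^ 2 +
        ‖fderiv ℝ v (frame c e f s (η s + y))‖ₑ ^ 2) := by
        refine lintegral_mono fun s => ?_
        simpa using enorm_sq_column_le (c := c) (e := e) hf hv hρ s (η s)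
          (left_mem_Icc.2 hρ.le)
    _ ≤ _ := by
        rw [lintegral_const_mul' _ _ ENNReal.ofReal_ne_top]
        gcongr
        exact lintegral_columns_le h (measurable_sobolevSq hv) hΩ hI measurableSet_Ioo hsub

/-- Each column bounds |v|² pointwise, so integration over heights up to δ gains a factor δ. This
gain is the source of all thinness statements. -/
theorem lintegral_strip_le (h : Orthonormal ℝ ![e, f]) (hv : ContDiff ℝ ∞ v)
    (hΩ : MeasurableSet Ω) (hI : MeasurableSet I) (hρ : 0 < ρ) {δ : ℝ} (hδρ : δ ≤ ρ)
    (hsub : ∀ s ∈ I, ∀ t ∈ Ioo 0 ρ, frame c e f s (η s + t) ∈ Ω) :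
    ∫⁻ s in I, ∫⁻ t in Icc 0 δ, ‖v (frame c e f s (η s + t))‖ₑ ^ 2 ≤
      ENNReal.ofReal δ * ENNReal.ofReal (2 / ρ + 2 * ρ) * sobolevSq Ω v := by
  have hf : ‖f‖ = 1 := h.norm_eq_one 1
  calc _ ≤ ∫⁻ s in I, ENNReal.ofReal δ * ENNReal.ofReal (2 / ρ + 2 * ρ) *
      ∫⁻ y in Ioo 0 ρ, (‖v (frame c e f s (η s + y))‖ₑ ^ 2 +
        ‖fderiv ℝ v (frame c e f s (η s + y))‖ₑ ^ 2) := by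
        refine lintegral_mono fun s => ?_
        refine (setLIntegral_mono' measurableSet_Icc fun t ht =>
          enorm_sq_column_le (c := c) (e := e) hf hv hρ s (η s) ⟨ht.1, ht.2.trans hδρ⟩).trans ?_
        rw [setLIntegral_const, Real.volume_Icc, sub_zero]
        exact le_of_eq (by ring)
    _ ≤ _ := by
        rw [lintegral_const_mul' _ _ (ENNReal.mul_ne_top ENNReal.ofReal_ne_top
          ENNReal.ofReal_ne_top)]
        gcongr
        exact lintegral_columns_le h (measurable_sobolevSq hv) hΩ hI measurableSet_Ioo hsub

theorem norm_frame_sub_sq (h : Orthonormal ℝ ![e, f]) (s t s' t' : ℝ) :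
    ‖frame c e f s t - frame c e f s' t'‖ ^ 2 = (s - s') ^ 2 + (t - t') ^ 2 := by
  have h1 : frame c e f s t - frame c e f s' t' = (s - s') • e + (t - t') • f := by
    unfold frame; module
  have he : ‖e‖ = 1 := h.norm_eq_one 0
  have hf : ‖f‖ = 1 := h.norm_eq_one 1
  have hef : inner ℝ e f = 0 := h.inner_eq_zero (i := 0) (j := 1) (by decide)
  rw [h1, norm_add_sq_real, norm_smul, norm_smul, he, hf, inner_smul_left, inner_smul_right, hef]
  simp

theorem abs_sub_left_le_norm_frame (h : Orthonormal ℝ ![e, f]) (s t s' t' : ℝ) :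
    |s - s'| ≤ ‖frame c e f s t - frame c e f s' t'‖ := by
  refine abs_le_of_sq_le_sq ?_ (norm_nonneg _)
  rw [norm_frame_sub_sq h]
  nlinarith [sq_nonneg (t - t')]

theorem abs_sub_right_le_norm_frame (h : Orthonormal ℝ ![e, f]) (s t s' t' : ℝ) :
    |t - t'| ≤ ‖frame c e f s t - frame c e f s' t'‖ := by
  refine abs_le_of_sq_le_sq ?_ (norm_nonneg _)
  rw [norm_frame_sub_sq h]
  nlinarith [sq_nonneg (s - s')]

end Frame

end

section

/-! ### The sides of the box -/

section Sides

open Set Function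

/-- The corners of the box, in cyclic order. -/
def corner (a b : Plane) : Fin 4 → Plane :=
  ![!₂[a 0, a 1], !₂[b 0, a 1], !₂[b 0, b 1], !₂[a 0, b 1]]

/-- The directions of the sides of the box, in cyclic order. -/
def sideDir : Fin 4 → Plane := ![!₂[1, 0], !₂[0, 1], !₂[-1, 0], !₂[0, -1]]

/-- The lengths of the sides of the box, in cyclic order. -/
def sideLen (a b : Plane) : Fin 4 → ℝ := ![b 0 - a 0, b 1 - a 1, b 0 - a 0, b 1 - a 1]

/-- Coordinates at a corner: the first axis is along the side, the second points inward. -/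
def sideFrame (a b : Plane) (k : Fin 4) : ℝ → ℝ → Plane :=
  frame (corner a b k) (sideDir k) (sideDir (k + 1))

variable {a b : Plane}

theorem orthonormal_sideDir (k : Fin 4) : Orthonormal ℝ ![sideDir k, sideDir (k + 1)] := by
  rw [orthonormal_iff_ite]
  intro i j
  fin_cases k <;> fin_cases i <;> fin_cases j <;>
    simp [sideDir, EuclideanSpace.inner_eq_star_dotProduct, Matrix.vecHead, Matrix.vecTail,
      EuclideanSpace.norm_eq]

theorem sideLen_pos (hab : ∀ i, a i < b i) (k : Fin 4) : 0 < sideLen a b k := by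
  fin_cases k <;> simp [sideLen, hab]

theorem sideFrame_mem_box {k : Fin 4} {s t : ℝ} : sideFrame a b k s t ∈ box a b ↔
    s ∈ Ioo 0 (sideLen a b k) ∧ t ∈ Ioo 0 (sideLen a b (k + 1)) := by
  simp only [box, Set.mem_ofPred_eq, Fin.forall_fin_two]
  fin_cases k <;> simp [sideFrame, frame, corner, sideDir, sideLen] <;>
    constructor <;> rintro ⟨⟨h1, h2⟩, h3, h4⟩ <;> refine ⟨⟨?_, ?_⟩, ?_, ?_⟩ <;> linarith

/-- Passing to the next corner is a quarter turn. This reduces relations between different sides to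
coordinates in one frame. -/
theorem sideFrame_succ (k : Fin 4) (s t : ℝ) :
    sideFrame a b (k + 1) s t = sideFrame a b k (sideLen a b k - t) s := by
  ext i
  fin_cases k <;> fin_cases i <;> simp [sideFrame, frame, corner, sideDir, sideLen] <;> ring

theorem sideLen_add_two (k : Fin 4) : sideLen a b (k + 2) = sideLen a b k := by
  fin_cases k <;> simp [sideLen]

theorem frontier_box_subset_sides :
    frontier (box a b) ⊆ ⋃ k, (fun s => sideFrame a b k s 0) '' Icc 0 (sideLen a b k) := by
  intro x hx
  rw [(isOpen_box a b).frontier_eq] at hx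
  have h := closure_box_subset a b hx.1
  have hx2 : ¬ ∀ i, a i < x i ∧ x i < b i := hx.2
  rw [Fin.forall_fin_two] at hx2
  have h0 := h 0
  have h1 := h 1
  have hor : x 1 = a 1 ∨ x 0 = b 0 ∨ x 1 = b 1 ∨ x 0 = a 0 := by
    by_contra hne
    push Not at hne
    exact hx2 ⟨⟨lt_of_le_of_ne h0.1 hne.2.2.2.symm, lt_of_le_of_ne h0.2 hne.2.1⟩,
      ⟨lt_of_le_of_ne h1.1 hne.1.symm, lt_of_le_of_ne h1.2 hne.2.2.1⟩⟩
  rw [mem_iUnion]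
  rcases hor with h' | h' | h' | h'
  · refine ⟨0, x 0 - a 0, ⟨by linarith, by simp [sideLen, h0.2]⟩, ?_⟩
    ext i; fin_cases i <;> simp [sideFrame, frame, corner, sideDir, h']
  · refine ⟨1, x 1 - a 1, ⟨by linarith, by simp [sideLen, h1.2]⟩, ?_⟩
    ext i; fin_cases i <;> simp [sideFrame, frame, corner, sideDir, h']
  · refine ⟨2, b 0 - x 0, ⟨by linarith, by simp only [sideLen, Matrix.cons_val]; linarith⟩, ?_⟩
    ext i; fin_cases i <;> simp [sideFrame, frame, corner, sideDir, h']
  · refine ⟨3, b 1 - x 1, ⟨by linarith, by simp only [sideLen, Matrix.cons_val]; linarith⟩, ?_⟩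
    ext i; fin_cases i <;> simp [sideFrame, frame, corner, sideDir, h']

theorem isometry_sideFrame (k : Fin 4) : Isometry fun s => sideFrame a b k s 0 := by
  refine Isometry.of_dist_eq fun s s' => ?_
  rw [dist_eq_norm, Real.dist_eq, ← abs_of_nonneg (norm_nonneg (_ - _)), ← sq_eq_sq_iff_abs_eq_abs,
    sideFrame, norm_frame_sub_sq (orthonormal_sideDir k)]
  ring

/-- An isometric parametrisation transports one-dimensional Hausdorff measure, which on the line is
Lebesgue measure. -/
theorem restrict_hausdorffMeasure_side (k : Fin 4) {A : Set ℝ} (hA : MeasurableSet A) :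
    (μH[1] : Measure Plane).restrict ((fun s => sideFrame a b k s 0) '' A) =
      (volume.restrict A).map fun s => sideFrame a b k s 0 := by
  have hiso := isometry_sideFrame (a := a) (b := b) k
  have hms : MeasurableSet ((fun s => sideFrame a b k s 0) '' A) :=
    hiso.isClosedEmbedding.measurableEmbedding.measurableSet_image.2 hA
  have h1 := hiso.map_hausdorffMeasure (d := 1) (Or.inl zero_le_one)
  rw [hausdorffMeasure_real] at h1
  calc _ = ((μH[1] : Measure Plane).restrict (range fun s => sideFrame a b k s 0)).restrict
        ((fun s => sideFrame a b k s 0) '' A) := by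
        rw [Measure.restrict_restrict hms, inter_eq_left.2 (image_subset_range _ _)]
    _ = _ := by
        rw [← h1, Measure.restrict_map hiso.continuous.measurable hms,
          preimage_image_eq _ hiso.injective]

/-- The arc length on the boundary of the box is bounded by the sum of those of the sides. -/
theorem lintegral_arcLength_le {F : Plane → ℝ≥0∞} (hF : Measurable F) :
    ∫⁻ x, F x ∂(arcLength (frontier (box a b))) ≤
      ∑ k, ∫⁻ s in Ioo 0 (sideLen a b k), F (sideFrame a b k s 0) := by
  calc ∫⁻ x, F x ∂(arcLength (frontier (box a b)))
      ≤ ∫⁻ x, F x ∂(Measure.sum fun k => (μH[1] : Measure Plane).restrict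
        ((fun s => sideFrame a b k s 0) '' Icc 0 (sideLen a b k))) := by
        refine lintegral_mono' ?_ le_rfl
        exact (Measure.restrict_mono frontier_box_subset_sides le_rfl).trans
          (Measure.restrict_iUnion_le)
    _ = ∑ k, ∫⁻ s in Ioo 0 (sideLen a b k), F (sideFrame a b k s 0) := by
        rw [lintegral_sum_measure, tsum_fintype]
        refine Finset.sum_congr rfl fun k _ => ?_
        rw [restrict_hausdorffMeasure_side k measurableSet_Icc, lintegral_map hF (isometry_sideFrame k).continuous.measurable,
          Measure.restrict_congr_set Ioo_ae_eq_Icc.symm]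

theorem sideFrame_mem_frontier (hab : ∀ i, a i < b i) {k : Fin 4} {s : ℝ}
    (hs : s ∈ Ioo 0 (sideLen a b k)) : sideFrame a b k s 0 ∈ frontier (box a b) := by
  rw [(isOpen_box a b).frontier_eq]
  refine ⟨?_, fun h => lt_irrefl _ (sideFrame_mem_box.1 h).2.1⟩
  have hc : Continuous fun t => sideFrame a b k s t :=
    continuous_frame.comp (by fun_prop : Continuous fun t : ℝ => (s, t))
  have ht : Tendsto (fun t => sideFrame a b k s t) (𝓝[>] (0 : ℝ)) (𝓝 (sideFrame a b k s 0)) :=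
    (hc.tendsto 0).mono_left nhdsWithin_le_nhds
  refine mem_closure_of_tendsto ht ?_
  filter_upwards [Ioo_mem_nhdsGT (sideLen_pos hab (k + 1))] with t ht
  exact sideFrame_mem_box.2 ⟨hs, ht⟩

theorem lintegral_side_le (hab : ∀ i, a i < b i) (k : Fin 4) {F : Plane → ℝ≥0∞}
    (hF : Measurable F) : ∫⁻ s in Ioo 0 (sideLen a b k), F (sideFrame a b k s 0) ≤
      ∫⁻ x, F x ∂(arcLength (frontier (box a b))) := by
  rw [← lintegral_map hF (isometry_sideFrame k).continuous.measurable,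
    ← restrict_hausdorffMeasure_side k measurableSet_Ioo]
  refine lintegral_mono' (Measure.restrict_mono ?_ le_rfl) le_rfl
  rintro _ ⟨s, hs, rfl⟩
  exact sideFrame_mem_frontier hab hs

/-- A compact subset of the open box keeps a positive distance from its boundary, so a strip along
every side avoids S. -/
theorem exists_collar {S : Set Plane} (hab : ∀ i, a i < b i) (hS : IsCompact S)
    (hSB : S ⊆ box a b) : ∃ ρ > 0, (∀ k, ρ < sideLen a b k) ∧ ∀ k, ∀ s ∈ Ioo 0 (sideLen a b k),
      ∀ t ∈ Ioo 0 ρ, sideFrame a b k s t ∈ box a b \ S := by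
  obtain ⟨δ, hδ, hsub⟩ := hS.exists_thickening_subset_open (isOpen_box a b) hSB
  obtain ⟨k₀, -, hk₀⟩ := Finset.exists_min_image Finset.univ (sideLen a b) ⟨0, Finset.mem_univ 0⟩
  have hk0 := sideLen_pos hab k₀
  refine ⟨min δ (sideLen a b k₀ / 2), by positivity, fun k => ?_, fun k s hs t ht => ?_⟩
  · have := hk₀ k (Finset.mem_univ k)
    exact (min_le_right _ _).trans_lt (by linarith)
  · have h1 := hk₀ (k + 1) (Finset.mem_univ _)
    have h2 := ht.2.trans_le (min_le_right _ _)
    have h3 := ht.2.trans_le (min_le_left _ _)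
    refine ⟨sideFrame_mem_box.2 ⟨hs, ht.1, by linarith⟩, fun hmem => ?_⟩
    -- A point of S at height below δ would put its foot on the side into the δ-thickening of S,
    -- hence into the open box.
    have h4 : sideFrame a b k s 0 ∈ box a b := by
      refine hsub (Metric.mem_thickening_iff.2 ⟨_, hmem, ?_⟩)
      rw [dist_eq_norm]
      refine lt_of_pow_lt_pow_left₀ 2 hδ.le ?_
      rw [sideFrame, norm_frame_sub_sq (orthonormal_sideDir k)]
      nlinarith [ht.1]
    exact lt_irrefl _ (sideFrame_mem_box.1 h4).2.1

end Sides

/-! ### Double integrals near the diagonal -/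

section NearDiagonal

open Set Function

/-- By symmetry only t > s matters, at the price of a factor 2; the substitution t = s + h then
matches the form of `gagliardo_side_le`. -/
theorem lintegral_near_diagonal_le {Φ : ℝ → ℝ → ℝ≥0∞} (hΦ : Measurable (uncurry Φ))
    (hsymm : ∀ s t, Φ s t = Φ t s) (hdiag : ∀ s, Φ s s = 0) {L ρ : ℝ} :
    ∫⁻ s in Ioo 0 L, ∫⁻ t in Ioo 0 L, {t | |s - t| < ρ}.indicator (Φ s) t ≤
      2 * ∫⁻ s in Ioo 0 L, ∫⁻ h in Ioo 0 ρ, (Iio (L - s)).indicator (fun h => Φ (s + h) s) h := by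
  have hup : ∫⁻ s in Ioo 0 L, ∫⁻ t in Ioo 0 L, (Ioo s (s + ρ)).indicator (fun t => Φ t s) t ≤
      ∫⁻ s in Ioo 0 L, ∫⁻ h in Ioo 0 ρ, (Iio (L - s)).indicator (fun h => Φ (s + h) s) h := by
    refine lintegral_mono fun s => ?_
    rw [← lintegral_indicator measurableSet_Ioo, ← lintegral_indicator measurableSet_Ioo,
      ← lintegral_add_left_eq_self _ s]
    refine lintegral_mono fun h => ?_
    by_cases h1 : s + h ∈ Ioo 0 L ∧ s + h ∈ Ioo s (s + ρ)
    · have h2 : h ∈ Ioo 0 ρ := ⟨by linarith [h1.2.1], by linarith [h1.2.2]⟩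
      have h3 : h ∈ Iio (L - s) := mem_Iio.2 (by linarith [h1.1.2])
      rw [indicator_of_mem h1.1, indicator_of_mem h1.2, indicator_of_mem h2, indicator_of_mem h3]
    · by_cases h2 : s + h ∈ Ioo 0 L
      · rw [indicator_of_mem h2, indicator_of_notMem fun h3 => h1 ⟨h2, h3⟩]; exact zero_le
      · rw [indicator_of_notMem h2]; exact zero_le
  have hmup : Measurable (uncurry fun s t => (Ioo s (s + ρ)).indicator (fun t => Φ t s) t) := by
    have : (uncurry fun s t => (Ioo s (s + ρ)).indicator (fun t => Φ t s) t) =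
        {p : ℝ × ℝ | p.1 < p.2 ∧ p.2 < p.1 + ρ}.indicator (fun p => uncurry Φ (p.2, p.1)) := by
      ext ⟨s, h⟩
      simp [uncurry, indicator]
    rw [this]
    exact Measurable.indicator (hΦ.comp measurable_swap)
      ((measurableSet_lt measurable_fst measurable_snd).inter
        (measurableSet_lt measurable_snd (by fun_prop)))
  have hmlo : Measurable (uncurry fun s t => (Ioo t (t + ρ)).indicator (fun s => Φ s t) s) :=
    hmup.comp measurable_swap
  calc _ ≤ ∫⁻ s in Ioo 0 L, ∫⁻ t in Ioo 0 L,
        (1 * (Ioo s (s + ρ)).indicator (fun t => Φ t s) t +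
          (Ioo t (t + ρ)).indicator (fun s => Φ s t) s) := by
        refine lintegral_mono fun s => lintegral_mono fun t => ?_
        by_cases h : t ∈ {t | |s - t| < ρ}
        · rw [indicator_of_mem h, one_mul]
          have h' : |s - t| < ρ := h
          rw [abs_lt] at h'
          rcases lt_trichotomy s t with h1 | h1 | h1
          · have h2 : t ∈ Ioo s (s + ρ) := ⟨h1, by linarith⟩
            rw [indicator_of_mem h2, hsymm]
            exact le_self_add
          · subst h1; rw [hdiag]; exact zero_le
          · have h2 : s ∈ Ioo t (t + ρ) := ⟨h1, by linarith⟩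
            rw [indicator_of_mem h2]
            exact le_add_self
        · rw [indicator_of_notMem h]; exact zero_le
    _ = (∫⁻ s in Ioo 0 L, ∫⁻ t in Ioo 0 L, (Ioo s (s + ρ)).indicator (fun t => Φ t s) t) +
        ∫⁻ s in Ioo 0 L, ∫⁻ t in Ioo 0 L, (Ioo s (s + ρ)).indicator (fun t => Φ t s) t := by
        rw [lintegral_lintegral_const_mul_add hmup, one_mul,
          lintegral_lintegral_swap hmlo.aemeasurable]
    _ ≤ _ := by
        rw [two_mul]
        exact add_le_add hup hup

end NearDiagonal

end

section

/-! ### The trace inequality on the boundary of the box -/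

section BoxTrace

open Set Function

variable {a b : Plane} {v : Plane → ℂ} {Ω : Set Plane} {ρ : ℝ}

/-- The integrand of the Gagliardo seminorm. -/
def gagliardo (v : Plane → ℂ) (x y : Plane) : ℝ≥0∞ := (‖v x - v y‖ₑ / ‖x - y‖ₑ) ^ 2

/-- The integrand of the Gagliardo seminorm, cut off at distance `ρ`. -/
def gagliardoNear (ρ : ℝ) (v : Plane → ℂ) (x y : Plane) : ℝ≥0∞ :=
  {p : Plane × Plane | ‖p.1 - p.2‖ < ρ}.indicator (uncurry (gagliardo v)) (x, y)

theorem measurable_gagliardo (hv : Continuous v) : Measurable (uncurry (gagliardo v)) := by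
  have h1 : Continuous fun p : Plane × Plane => v p.1 - v p.2 := by fun_prop
  have h2 : Continuous fun p : Plane × Plane => p.1 - p.2 := by fun_prop
  exact (h1.enorm.measurable.div h2.enorm.measurable).pow_const 2

theorem measurable_gagliardoNear (hv : Continuous v) :
    Measurable (uncurry (gagliardoNear ρ v)) :=
  (measurable_gagliardo hv).indicator
    (measurableSet_lt (by fun_prop : Continuous fun p : Plane × Plane => ‖p.1 - p.2‖).measurable
      measurable_const)

theorem gagliardo_symm (v : Plane → ℂ) (x y : Plane) : gagliardo v x y = gagliardo v y x := by
  rw [gagliardo, gagliardo, ← enorm_neg (v x - v y), ← enorm_neg (x - y), neg_sub, neg_sub]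

theorem gagliardo_self (v : Plane → ℂ) (x : Plane) : gagliardo v x x = 0 := by
  simp [gagliardo]

theorem gagliardoNear_symm (v : Plane → ℂ) (x y : Plane) :
    gagliardoNear ρ v x y = gagliardoNear ρ v y x := by
  simp only [gagliardoNear, indicator, Set.mem_ofPred_eq, uncurry, gagliardo_symm v x y,
    norm_sub_rev x y]

theorem gagliardoNear_le (v : Plane → ℂ) (x y : Plane) :
    gagliardoNear ρ v x y ≤ gagliardo v x y :=
  indicator_le_self _ _ _

theorem gagliardoNear_eq_zero {x y : Plane} (h : ρ ≤ ‖x - y‖) : gagliardoNear ρ v x y = 0 :=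
  indicator_of_notMem (by simpa using h) _

/-- At distance at least ρ the quotient is at most (|v x| + |v y|)/ρ, so the far part needs only the
L² trace inequality. -/
theorem gagliardo_le_near_add (hρ : 0 < ρ) (v : Plane → ℂ) (x y : Plane) :
    gagliardo v x y ≤ gagliardoNear ρ v x y +
      ENNReal.ofReal (2 / ρ ^ 2) * (‖v x‖ₑ ^ 2 + ‖v y‖ₑ ^ 2) := by
  by_cases h : ‖x - y‖ < ρ
  · rw [gagliardoNear, indicator_of_mem (by exact h)]
    exact le_self_add
  · push Not at h
    refine le_trans ?_ le_add_self
    have h1 : ENNReal.ofReal ρ ≤ ‖x - y‖ₑ := by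
      rw [← ofReal_norm]; exact ENNReal.ofReal_le_ofReal h
    calc gagliardo v x y ≤ ((‖v x‖ₑ + ‖v y‖ₑ) / ENNReal.ofReal ρ) ^ 2 := by
          unfold gagliardo
          gcongr
          exact enorm_sub_le
      _ = (‖v x‖ₑ + ‖v y‖ₑ) ^ 2 * ENNReal.ofReal (1 / ρ ^ 2) := by
          rw [div_eq_mul_inv, mul_pow, ← ENNReal.ofReal_inv_of_pos hρ,
            ← ENNReal.ofReal_pow (by positivity)]
          congr 2
          simp
      _ ≤ (2 * ‖v x‖ₑ ^ 2 + 2 * ‖v y‖ₑ ^ 2) * ENNReal.ofReal (1 / ρ ^ 2) := by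
          gcongr
          exact add_sq_le_two_mul _ _
      _ = ENNReal.ofReal 2 * ENNReal.ofReal (1 / ρ ^ 2) * (‖v x‖ₑ ^ 2 + ‖v y‖ₑ ^ 2) := by
          rw [ENNReal.ofReal_ofNat]; ring
      _ = _ := by
          rw [← ENNReal.ofReal_mul (by norm_num), mul_one_div]

variable {c e f : Plane} {L L' : ℝ}

theorem lintegral_fderiv_frame_le (ho : Orthonormal ℝ ![e, f]) (hv : ContDiff ℝ ∞ v)
    (hΩ : MeasurableSet Ω) (hsub : ∀ s ∈ Ioo 0 L, ∀ t ∈ Ioo 0 ρ, frame c e f s t ∈ Ω) :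
    ∫⁻ s in Ioo 0 L, ∫⁻ t in Ioo 0 ρ, ‖fderiv ℝ v (frame c e f s t)‖ₑ ^ 2 ≤ sobolevSq Ω v := by
  have := lintegral_columns_le (c := c) (η := 0) ho
    (F := fun x => ‖fderiv ℝ v x‖ₑ ^ 2)
    ((hv.continuous_fderiv (by simp)).enorm.measurable.pow_const 2) hΩ measurableSet_Ioo
    measurableSet_Ioo (fun s hs t ht => by simpa using hsub s hs t ht)
  simp only [Pi.zero_apply, zero_add] at this
  exact this.trans (lintegral_fderiv_le_sobolevSq Ω v)

theorem continuous_fderiv_frame (hv : ContDiff ℝ ∞ v) :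
    Continuous (uncurry fun s t => fderiv ℝ v (frame c e f s t)) :=
  (hv.continuous_fderiv (by simp)).comp continuous_frame

theorem continuous_fderiv_frame_left (hv : ContDiff ℝ ∞ v) (y : Plane) (t : ℝ) :
    Continuous fun s => fderiv ℝ v (frame c e f s t) y :=
  ((continuous_fderiv_frame hv).comp (by fun_prop : Continuous fun s => (s, t))).clm_apply
    continuous_const

theorem continuous_fderiv_frame_right (hv : ContDiff ℝ ∞ v) (y : Plane) (s : ℝ) :
    Continuous fun t => fderiv ℝ v (frame c e f s t) y :=
  ((continuous_fderiv_frame hv).comp (by fun_prop : Continuous fun t => (s, t))).clm_apply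
    continuous_const

/-- Pairs on one side: the near-diagonal reduction gives a factor 2 and `gagliardo_side_le` a factor
34. -/
theorem gagliardoNear_frame_side_le (ho : Orthonormal ℝ ![e, f]) (hv : ContDiff ℝ ∞ v)
    (hΩ : MeasurableSet Ω) (hsub : ∀ s ∈ Ioo 0 L, ∀ t ∈ Ioo 0 ρ, frame c e f s t ∈ Ω) :
    ∫⁻ s in Ioo 0 L, ∫⁻ t in Ioo 0 L, gagliardoNear ρ v (frame c e f s 0) (frame c e f t 0) ≤
      68 * sobolevSq Ω v := by
  have hn : ∀ s t, ‖frame c e f s 0 - frame c e f t 0‖ = |s - t| := fun s t => by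
    rw [← abs_of_nonneg (norm_nonneg (_ - _)), ← sq_eq_sq_iff_abs_eq_abs, norm_frame_sub_sq ho]
    ring
  have c1 : Continuous fun s => frame c e f s 0 := by unfold frame; fun_prop
  have mp : Measurable fun p : ℝ × ℝ => (frame c e f p.1 0, frame c e f p.2 0) :=
    ((c1.comp continuous_fst).prodMk (c1.comp continuous_snd)).measurable
  have mΦ : Measurable (uncurry fun s t => gagliardo v (frame c e f s 0) (frame c e f t 0)) := by
    have h := (measurable_gagliardo hv.continuous).comp mp
    exact h
  have h1 := lintegral_near_diagonal_le (L := L) (ρ := ρ)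
    (Φ := fun s t => gagliardo v (frame c e f s 0) (frame c e f t 0))
    mΦ (fun s t => gagliardo_symm _ _ _) (fun s => gagliardo_self _ _)
  have h2 := gagliardo_side_le (L := L) (ρ := ρ)
    (V := fun s t => v (frame c e f s t))
    (V₁ := fun s t => fderiv ℝ v (frame c e f s t) e)
    (V₂ := fun s t => fderiv ℝ v (frame c e f s t) f)
    (g := fun s t => ‖fderiv ℝ v (frame c e f s t)‖ₑ)
    (hv.continuous.comp continuous_frame) (hasDerivAt_frame_left hv) (hasDerivAt_frame_right hv)
    (continuous_fderiv_frame_left hv _) (continuous_fderiv_frame_right hv _)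
    (continuous_fderiv_frame hv).enorm.measurable
    (fun s t => enorm_apply_le (ho.norm_eq_one 0)) (fun s t => enorm_apply_le (ho.norm_eq_one 1))
  have h3 := lintegral_fderiv_frame_le ho hv hΩ hsub
  calc _ = ∫⁻ s in Ioo 0 L, ∫⁻ t in Ioo 0 L, {t | |s - t| < ρ}.indicator
          (fun t => gagliardo v (frame c e f s 0) (frame c e f t 0)) t := by
        refine lintegral_congr fun s => lintegral_congr fun t => ?_
        simp only [gagliardoNear, indicator, Set.mem_ofPred_eq, hn, uncurry]
    _ ≤ _ := h1
    _ ≤ 2 * (34 * ∫⁻ s in Ioo 0 L, ∫⁻ t in Ioo 0 ρ,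
        ‖fderiv ℝ v (frame c e f s t)‖ₑ ^ 2) := by
        refine mul_le_mul' le_rfl (le_trans ?_ h2)
        refine lintegral_mono fun s => lintegral_mono fun h => indicator_le_indicator ?_
        unfold gagliardo
        gcongr
        rw [← ofReal_norm, hn, add_sub_cancel_left]
        exact ENNReal.ofReal_le_ofReal (le_abs_self h)
    _ ≤ 2 * (34 * sobolevSq Ω v) := by gcongr
    _ = _ := by ring

/-- Pairs on the two legs of a corner: both |s| and |t| are at most the distance, so the cut-off
confines the integral to the square where `gagliardo_corner_le` applies. -/
theorem gagliardoNear_frame_corner_le (ho : Orthonormal ℝ ![e, f]) (hv : ContDiff ℝ ∞ v)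
    (hΩ : MeasurableSet Ω) (hsub : ∀ s ∈ Ioo 0 L, ∀ t ∈ Ioo 0 ρ, frame c e f s t ∈ Ω)
    (hL : ρ < L) :
    ∫⁻ s in Ioo 0 L, ∫⁻ t in Ioo 0 L', gagliardoNear ρ v (frame c e f s 0) (frame c e f 0 t) ≤
      16 * sobolevSq Ω v := by
  have hn1 : ∀ s t, |s| ≤ ‖frame c e f s 0 - frame c e f 0 t‖ := fun s t => by
    simpa using abs_sub_left_le_norm_frame (c := c) ho s 0 0 t
  have hn2 : ∀ s t, |t| ≤ ‖frame c e f s 0 - frame c e f 0 t‖ := fun s t => by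
    simpa using abs_sub_right_le_norm_frame (c := c) ho s 0 0 t
  have h2 := gagliardo_corner_le (ρ := ρ)
    (V := fun s t => v (frame c e f s t))
    (V₁ := fun s t => fderiv ℝ v (frame c e f s t) e)
    (V₂ := fun s t => fderiv ℝ v (frame c e f s t) f)
    (g := fun s t => ‖fderiv ℝ v (frame c e f s t)‖ₑ)
    (D := fun s t => ‖frame c e f s 0 - frame c e f 0 t‖ₑ)
    (hv.continuous.comp continuous_frame) (hasDerivAt_frame_left hv) (hasDerivAt_frame_right hv)
    (continuous_fderiv_frame_left hv _) (continuous_fderiv_frame_right hv _)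
    (continuous_fderiv_frame hv).enorm.measurable
    (fun s t => enorm_apply_le (ho.norm_eq_one 0)) (fun s t => enorm_apply_le (ho.norm_eq_one 1))
    (fun s t => by
      rw [← ofReal_norm]
      exact ENNReal.ofReal_le_ofReal ((le_abs_self s).trans (hn1 s t)))
    (fun s t => by
      rw [← ofReal_norm]
      exact ENNReal.ofReal_le_ofReal ((le_abs_self t).trans (hn2 s t)))
  have h3 := lintegral_fderiv_frame_le ho hv hΩ hsub
  calc _ ≤ ∫⁻ s in Ioo 0 ρ, ∫⁻ t in Ioo 0 ρ, gagliardo v (frame c e f s 0) (frame c e f 0 t) := by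
        rw [← lintegral_indicator measurableSet_Ioo, ← lintegral_indicator measurableSet_Ioo]
        refine lintegral_mono fun s => ?_
        by_cases h0 : s ∈ Ioo 0 L
        · rw [indicator_of_mem h0]
          by_cases hs : s ∈ Ioo 0 ρ
          · rw [indicator_of_mem hs, ← lintegral_indicator measurableSet_Ioo,
              ← lintegral_indicator measurableSet_Ioo]
            refine lintegral_mono fun t => ?_
            by_cases ht : t ∈ Ioo 0 L'
            · rw [indicator_of_mem ht]
              by_cases ht' : t ∈ Ioo 0 ρ
              · rw [indicator_of_mem ht']
                exact gagliardoNear_le _ _ _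
              · rw [gagliardoNear_eq_zero]
                · exact zero_le
                · refine le_trans ?_ (hn2 s t)
                  by_contra! hlt
                  exact ht' ⟨ht.1, (le_abs_self t).trans_lt hlt⟩
            · rw [indicator_of_notMem ht]; exact zero_le
          · refine le_of_eq_of_le ?_ zero_le
            refine lintegral_eq_zero_of_ae_eq_zero (.of_forall fun t => ?_)
            refine gagliardoNear_eq_zero (le_trans ?_ (hn1 s _))
            by_contra! hlt
            exact hs ⟨h0.1, (le_abs_self s).trans_lt hlt⟩
        · rw [indicator_of_notMem h0]; exact zero_le
    _ ≤ _ := h2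
    _ ≤ _ := by
        refine mul_le_mul' le_rfl (le_trans ?_ h3)
        exact lintegral_mono_set (Ioo_subset_Ioo le_rfl hL.le)

theorem lintegral_Ioo_reflect (F : ℝ → ℝ≥0∞) (L : ℝ) :
    ∫⁻ t in Ioo 0 L, F (L - t) = ∫⁻ t in Ioo 0 L, F t := by
  rw [← lintegral_indicator measurableSet_Ioo, ← lintegral_indicator measurableSet_Ioo,
    ← lintegral_sub_left_eq_self _ L]
  refine lintegral_congr fun t => ?_
  simp only [indicator, mem_Ioo, sub_pos, sub_lt_self_iff, sub_sub_cancel, and_comm]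

/-- Sides k and k + 1 meet at corner k + 1 and are the axes of its frame. Side k runs towards that
corner, hence the reflection of its parameter. -/
theorem gagliardoNear_corner_le (hv : ContDiff ℝ ∞ v) (hΩ : MeasurableSet Ω)
    (hcollar : ∀ k, ∀ s ∈ Ioo 0 (sideLen a b k), ∀ t ∈ Ioo 0 ρ, sideFrame a b k s t ∈ Ω)
    (hρ : ∀ k, ρ < sideLen a b k) (k : Fin 4) :
    ∫⁻ s in Ioo 0 (sideLen a b (k + 1)), ∫⁻ t in Ioo 0 (sideLen a b k),
      gagliardoNear ρ v (sideFrame a b (k + 1) s 0) (sideFrame a b k t 0) ≤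
        16 * sobolevSq Ω v := by
  refine le_of_eq_of_le (lintegral_congr fun s => ?_) (gagliardoNear_frame_corner_le
    (L' := sideLen a b k) (orthonormal_sideDir (k + 1)) hv hΩ (hcollar (k + 1)) (hρ (k + 1)))
  rw [← lintegral_Ioo_reflect]
  refine lintegral_congr fun t => ?_
  have hk : sideFrame a b k (sideLen a b k - t) 0 = sideFrame a b (k + 1) 0 t := by
    rw [sideFrame_succ]
  rw [hk]
  rfl

/-- Two sides of a rectangle are equal, adjacent or opposite; 68 is the worst of the three
constants. -/
theorem gagliardoNear_sides_le (hv : ContDiff ℝ ∞ v) (hΩ : MeasurableSet Ω)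
    (hcollar : ∀ k, ∀ s ∈ Ioo 0 (sideLen a b k), ∀ t ∈ Ioo 0 ρ, sideFrame a b k s t ∈ Ω)
    (hρ : ∀ k, ρ < sideLen a b k) (k l : Fin 4) :
    ∫⁻ s in Ioo 0 (sideLen a b k), ∫⁻ t in Ioo 0 (sideLen a b l),
      gagliardoNear ρ v (sideFrame a b k s 0) (sideFrame a b l t 0) ≤ 68 * sobolevSq Ω v := by
  have hcases : ∀ k l : Fin 4, l = k ∨ l = k + 1 ∨ k = l + 1 ∨ l = k + 2 := by decide
  have h16 : 16 * sobolevSq Ω v ≤ 68 * sobolevSq Ω v := by gcongr; norm_num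
  rcases hcases k l with rfl | rfl | rfl | rfl
  · exact gagliardoNear_frame_side_le (orthonormal_sideDir _) hv hΩ (hcollar _)
  · refine le_trans (le_of_eq ?_)
      ((gagliardoNear_corner_le hv hΩ hcollar hρ k).trans h16)
    rw [lintegral_lintegral_swap]
    · exact lintegral_congr fun s => lintegral_congr fun t => gagliardoNear_symm _ _ _
    · exact ((measurable_gagliardoNear hv.continuous).comp
        (((isometry_sideFrame k).continuous.comp continuous_fst).prodMk
          ((isometry_sideFrame (k + 1)).continuous.comp continuous_snd)).measurable).aemeasurable
  · exact (gagliardoNear_corner_le hv hΩ hcollar hρ l).trans h16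
  -- Opposite sides are a whole side length apart, which exceeds ρ, so the cut-off integrand
  -- vanishes.
  · refine le_of_eq_of_le ?_ zero_le
    refine lintegral_eq_zero_of_ae_eq_zero (.of_forall fun s =>
      lintegral_eq_zero_of_ae_eq_zero (.of_forall fun t => gagliardoNear_eq_zero ?_))
    have h2 : sideFrame a b (k + 2) t 0 =
        sideFrame a b k (sideLen a b k - t) (sideLen a b (k + 1)) := by
      have : k + 2 = k + 1 + 1 := by rw [add_assoc]; rfl
      rw [this, sideFrame_succ, sideFrame_succ, sub_zero]
    rw [h2]
    refine (hρ (k + 1)).le.trans ?_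
    have := abs_sub_right_le_norm_frame (c := corner a b k) (orthonormal_sideDir k) s 0
      (sideLen a b k - t) (sideLen a b (k + 1))
    rw [zero_sub, abs_neg] at this
    exact (le_abs_self _).trans this

theorem lintegral_arcLength_sq_le (hv : ContDiff ℝ ∞ v) (hΩ : MeasurableSet Ω)
    (hcollar : ∀ k, ∀ s ∈ Ioo 0 (sideLen a b k), ∀ t ∈ Ioo 0 ρ, sideFrame a b k s t ∈ Ω)
    (hρ0 : 0 < ρ) :
    ∫⁻ x, ‖v x‖ₑ ^ 2 ∂(arcLength (frontier (box a b))) ≤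
      4 * (ENNReal.ofReal (2 / ρ + 2 * ρ) * sobolevSq Ω v) := by
  refine (lintegral_arcLength_le (hv.continuous.enorm.measurable.pow_const 2)).trans ?_
  calc _ ≤ ∑ _k : Fin 4, ENNReal.ofReal (2 / ρ + 2 * ρ) * sobolevSq Ω v := by
        refine Finset.sum_le_sum fun k _ => ?_
        exact lintegral_trace_le (c := corner a b k) (η := fun _ => 0) (orthonormal_sideDir k) hv hΩ
          measurableSet_Ioo hρ0 (fun s hs t ht => by
            simpa [sideFrame] using hcollar k s hs t ht)
    _ = _ := by simp

theorem lintegral_lintegral_arcLength_le {F : Plane → Plane → ℝ≥0∞}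
    (hF : Measurable (uncurry F)) :
    ∫⁻ x, ∫⁻ y, F x y ∂(arcLength (frontier (box a b))) ∂(arcLength (frontier (box a b))) ≤
      ∑ k, ∑ l, ∫⁻ s in Ioo 0 (sideLen a b k), ∫⁻ t in Ioo 0 (sideLen a b l),
        F (sideFrame a b k s 0) (sideFrame a b l t 0) := by
  have mi : Measurable fun x => ∫⁻ y, F x y ∂(arcLength (frontier (box a b))) :=
    hF.lintegral_prod_right'
  have cs : ∀ k : Fin 4, Continuous fun s => sideFrame a b k s 0 := fun k =>
    (isometry_sideFrame k).continuous
  have ml : ∀ l : Fin 4, Measurable (uncurry fun (x : Plane) (t : ℝ) =>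
      F x (sideFrame a b l t 0)) := fun l =>
    hF.comp (continuous_fst.prodMk ((cs l).comp continuous_snd)).measurable
  have ml' : ∀ l : Fin 4, Measurable fun x : Plane => ∫⁻ t in Ioo 0 (sideLen a b l),
      F x (sideFrame a b l t 0) := fun l => (ml l).lintegral_prod_right'
  refine (lintegral_arcLength_le mi).trans (Finset.sum_le_sum fun k _ => ?_)
  rw [← lintegral_finsetSum _ fun l _ => (by exact (ml' l).comp (cs k).measurable)]
  refine lintegral_mono fun s => ?_
  exact lintegral_arcLength_le (F := F (sideFrame a b k s 0)) (hF.comp measurable_prodMk_left)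

theorem gagliardoNear_box_le (hv : ContDiff ℝ ∞ v) (hΩ : MeasurableSet Ω)
    (hcollar : ∀ k, ∀ s ∈ Ioo 0 (sideLen a b k), ∀ t ∈ Ioo 0 ρ, sideFrame a b k s t ∈ Ω)
    (hρ : ∀ k, ρ < sideLen a b k) :
    ∫⁻ x, ∫⁻ y, gagliardoNear ρ v x y ∂(arcLength (frontier (box a b)))
        ∂(arcLength (frontier (box a b))) ≤ 1088 * sobolevSq Ω v := by
  refine (lintegral_lintegral_arcLength_le (measurable_gagliardoNear hv.continuous)).trans ?_
  calc _ ≤ ∑ _k : Fin 4, ∑ _l : Fin 4, 68 * sobolevSq Ω v :=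
        Finset.sum_le_sum fun k _ => Finset.sum_le_sum fun l _ =>
          gagliardoNear_sides_le hv hΩ hcollar hρ k l
    _ = _ := by
        simp only [Finset.sum_const, Finset.card_univ, Fintype.card_fin, nsmul_eq_mul]
        push_cast
        rw [← mul_assoc, ← mul_assoc]
        norm_num

/-- The near part is summed over 16 pairs of sides, 1088 = 16 · 68. The far part gives the L² trace
bound once in each variable, 8 = 4 + 4. -/
theorem gagliardo_box_le (hv : ContDiff ℝ ∞ v) (hΩ : MeasurableSet Ω)
    (hcollar : ∀ k, ∀ s ∈ Ioo 0 (sideLen a b k), ∀ t ∈ Ioo 0 ρ, sideFrame a b k s t ∈ Ω)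
    (hρ0 : 0 < ρ) (hρ : ∀ k, ρ < sideLen a b k) :
    ∫⁻ x, ∫⁻ y, gagliardo v x y ∂(arcLength (frontier (box a b)))
        ∂(arcLength (frontier (box a b))) ≤
      (1088 + 8 * ENNReal.ofReal (2 / ρ ^ 2) * arcLength (frontier (box a b)) univ *
        ENNReal.ofReal (2 / ρ + 2 * ρ)) * sobolevSq Ω v := by
  have hnear := gagliardoNear_box_le hv hΩ hcollar hρ
  have htr := lintegral_arcLength_sq_le hv hΩ hcollar hρ0
  have hfin : IsFiniteMeasure (arcLength (frontier (box a b))) := inferInstance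
  generalize arcLength (frontier (box a b)) = μ at hnear htr hfin ⊢
  have mv : Measurable fun x => ‖v x‖ₑ ^ 2 := hv.continuous.enorm.measurable.pow_const 2
  have m0 : Measurable (uncurry (gagliardoNear ρ v)) := measurable_gagliardoNear hv.continuous
  have mi : Measurable fun x => ∫⁻ y, gagliardoNear ρ v x y ∂μ := m0.lintegral_prod_right'
  have ms : ∀ x, Measurable fun y => gagliardoNear ρ v x y := fun x => by
    have h := m0.comp (measurable_prodMk_left (x := x))
    exact h
  have e1 : ∀ x, ∫⁻ y, (gagliardoNear ρ v x y +
      ENNReal.ofReal (2 / ρ ^ 2) * (‖v x‖ₑ ^ 2 + ‖v y‖ₑ ^ 2)) ∂μ =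
      (∫⁻ y, gagliardoNear ρ v x y ∂μ) + ENNReal.ofReal (2 / ρ ^ 2) *
        (‖v x‖ₑ ^ 2 * μ univ + ∫⁻ y, ‖v y‖ₑ ^ 2 ∂μ) := fun x => by
    rw [lintegral_add_left (ms x), lintegral_const_mul' _ _ ENNReal.ofReal_ne_top,
      lintegral_add_left measurable_const, lintegral_const]
  have e2 : ∀ c : ℝ≥0∞, ∫⁻ x, (‖v x‖ₑ ^ 2 * μ univ + c) ∂μ =
      (∫⁻ x, ‖v x‖ₑ ^ 2 ∂μ) * μ univ + c * μ univ := fun c => by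
    rw [lintegral_add_right _ measurable_const, lintegral_const,
      lintegral_mul_const' _ _ (measure_ne_top μ univ)]
  calc _ ≤ ∫⁻ x, ∫⁻ y, (gagliardoNear ρ v x y +
        ENNReal.ofReal (2 / ρ ^ 2) * (‖v x‖ₑ ^ 2 + ‖v y‖ₑ ^ 2)) ∂μ ∂μ :=
        lintegral_mono fun x => lintegral_mono fun y => gagliardo_le_near_add hρ0 v x y
    _ = (∫⁻ x, ∫⁻ y, gagliardoNear ρ v x y ∂μ ∂μ) + ENNReal.ofReal (2 / ρ ^ 2) *
        ((∫⁻ x, ‖v x‖ₑ ^ 2 ∂μ) * μ univ + (∫⁻ x, ‖v x‖ₑ ^ 2 ∂μ) * μ univ) := by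
        rw [lintegral_congr e1, lintegral_add_left mi,
          lintegral_const_mul' _ _ ENNReal.ofReal_ne_top, e2]
    _ ≤ 1088 * sobolevSq Ω v + ENNReal.ofReal (2 / ρ ^ 2) *
        (4 * (ENNReal.ofReal (2 / ρ + 2 * ρ) * sobolevSq Ω v) * μ univ +
          4 * (ENNReal.ofReal (2 / ρ + 2 * ρ) * sobolevSq Ω v) * μ univ) := by gcongr
    _ = _ := by ring

end BoxTrace

end

section

/-! ### The trace inequality in terms of Hilbert space norms -/

section TraceBound

open Set Function

variable {a b : Plane} {S : Set Plane}

theorem enorm_sq_eq_lintegral {α : Type*} [MeasurableSpace α] {μ : Measure α} (f : Lp ℂ 2 μ) :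
    ‖f‖ₑ ^ 2 = ∫⁻ x, ‖f x‖ₑ ^ 2 ∂μ := by
  have := eLpNorm_nnreal_pow_eq_lintegral (f := f) (μ := μ) (p := 2) (by norm_num)
  rw [Lp.enorm_def]
  simpa using this

theorem enorm_toLp_sq {α : Type*} [MeasurableSpace α] {μ : Measure α} {f : α → ℂ}
    (hf : MemLp f 2 μ) : ‖hf.toLp f‖ₑ ^ 2 = ∫⁻ x, ‖f x‖ₑ ^ 2 ∂μ := by
  rw [enorm_sq_eq_lintegral]
  refine lintegral_congr_ae ?_
  filter_upwards [hf.coeFn_toLp] with x hx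
  rw [hx]

theorem enorm_smoothL2_sq (v : smoothFun) :
    ‖smoothL2 a b S v‖ₑ ^ 2 = ∫⁻ x in box a b \ S, ‖v.1 x‖ₑ ^ 2 :=
  enorm_toLp_sq (memLp_box_diff a b S (smoothFun.contDiff v).continuous)

theorem ofReal_norm_sq {E : Type*} [NormedAddCommGroup E] (x : E) :
    ENNReal.ofReal (‖x‖ ^ 2) = ‖x‖ₑ ^ 2 := by
  rw [ENNReal.ofReal_pow (norm_nonneg x), ofReal_norm]

/-- The factor 2 comes from bounding the operator norm of the differential by the two partial
derivatives. -/
theorem sobolevSq_le (v : smoothFun) : sobolevSq (box a b \ S) v.1 ≤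
    2 * ∑ o, ‖comp o (smoothTriple a b S v)‖ₑ ^ 2 := by
  have m1 : Measurable fun x => ‖v.1 x‖ₑ ^ 2 :=
    (smoothFun.contDiff v).continuous.enorm.measurable.pow_const 2
  have m2 : ∀ i, Measurable fun x => ‖partialDeriv i v.1 x‖ₑ ^ 2 := fun i =>
    ((smoothFun.contDiff v).partialDeriv i).continuous.enorm.measurable.pow_const 2
  have h2 : ∀ i, ∫⁻ x in box a b \ S, ‖partialDeriv i v.1 x‖ₑ ^ 2 =
      ‖comp (some i) (smoothTriple a b S v)‖ₑ ^ 2 := fun i =>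
    (enorm_smoothL2_sq (smoothDeriv i v)).symm
  calc sobolevSq (box a b \ S) v.1
      ≤ ∫⁻ x in box a b \ S, (‖v.1 x‖ₑ ^ 2 + 2 * ∑ i, ‖partialDeriv i v.1 x‖ₑ ^ 2) :=
        lintegral_mono fun x => by gcongr; exact enorm_fderiv_sq_le v.1 x
    _ = ‖comp none (smoothTriple a b S v)‖ₑ ^ 2 +
        2 * ∑ i, ‖comp (some i) (smoothTriple a b S v)‖ₑ ^ 2 := by
        rw [lintegral_add_left m1, lintegral_const_mul' _ _ (by simp),
          lintegral_finsetSum _ fun i _ => m2 i, comp_none_smoothTriple, enorm_smoothL2_sq]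
        congr 2
        exact Finset.sum_congr rfl fun i _ => h2 i
    _ ≤ _ := by
        rw [Fintype.sum_option, mul_add]
        gcongr
        exact le_mul_of_one_le_left' (by norm_num)

theorem enorm_smoothHHalf_sq (v : smoothFun) : ‖smoothHHalf a b v‖ₑ ^ 2 =
    (∫⁻ x, ‖v.1 x‖ₑ ^ 2 ∂(arcLength (frontier (box a b)))) +
      ∫⁻ x, ∫⁻ y, gagliardo v.1 x y ∂(arcLength (frontier (box a b)))
        ∂(arcLength (frontier (box a b))) := by
  have hv := (smoothFun.contDiff v).continuous
  have h1 : ‖smoothHHalf a b v‖ ^ 2 =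
      ‖(memLp_arcLength_box a b hv).toLp v.1‖ ^ 2 +
      ‖(memLp_diffQuot a b (smoothFun.contDiff v)).toLp (diffQuot v.1)‖ ^ 2 :=
    WithLp.prod_norm_sq_eq_of_L2 (smoothHHalf a b v).1
  rw [← ofReal_norm_sq, h1, ENNReal.ofReal_add (by positivity) (by positivity), ofReal_norm_sq,
    ofReal_norm_sq, enorm_toLp_sq, enorm_toLp_sq]
  congr 1
  have h2 : ∀ z : Plane × Plane, ‖diffQuot v.1 z‖ₑ ^ 2 = uncurry (gagliardo v.1) z := by
    rintro ⟨x, y⟩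
    rw [uncurry, gagliardo, diffQuot]
    -- On the diagonal both numerators vanish, so division by zero is harmless in either convention.
    by_cases hxy : x = y
    · subst hxy; simp
    · have h3 : (‖x - y‖ : ℂ) ≠ 0 := by simpa [sub_eq_zero] using hxy
      rw [div_eq_mul_inv, enorm_mul, enorm_inv h3, ENNReal.div_eq_inv_mul, mul_comm]
      congr 3
      rw [← ofReal_norm, ← ofReal_norm]
      simp
  rw [lintegral_congr h2, lintegral_prod _ (measurable_gagliardo hv).aemeasurable]
  rfl

/-- The trace theorem for smooth functions. -/
theorem exists_traceBound (hab : ∀ i, a i < b i) (hS : IsCompact S) (hSB : S ⊆ box a b) :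
    ∃ C, TraceBound a b S C := by
  obtain ⟨ρ, hρ0, hρ, hcollar⟩ := exists_collar hab hS hSB
  have hΩ : MeasurableSet (box a b \ S) :=
    (isOpen_box a b).measurableSet.diff hS.measurableSet
  obtain ⟨M, hM⟩ : ∃ M : ℝ≥0∞, M = 4 * ENNReal.ofReal (2 / ρ + 2 * ρ) +
    (1088 + 8 * ENNReal.ofReal (2 / ρ ^ 2) * arcLength (frontier (box a b)) univ *
        ENNReal.ofReal (2 / ρ + 2 * ρ)) := ⟨_, rfl⟩
  have hMt : M ≠ ⊤ := by
    rw [hM]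
    have := measure_ne_top (arcLength (frontier (box a b))) univ
    finiteness
  refine ⟨M.toReal * 2, fun v => ?_⟩
  have h1 := lintegral_arcLength_sq_le (smoothFun.contDiff v) hΩ hcollar hρ0
  have h2 := gagliardo_box_le (smoothFun.contDiff v) hΩ hcollar hρ0 hρ
  have h3 : ‖smoothHHalf a b v‖ₑ ^ 2 ≤ M * (2 * ∑ o, ‖comp o (smoothTriple a b S v)‖ₑ ^ 2) := by
    calc _ ≤ M * sobolevSq (box a b \ S) v.1 := by
          rw [enorm_smoothHHalf_sq, hM, add_mul]
          refine add_le_add (h1.trans_eq (by ring)) h2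
      _ ≤ _ := by gcongr; exact sobolevSq_le v
  have h4 : M * (2 * ∑ o, ‖comp o (smoothTriple a b S v)‖ₑ ^ 2) =
      ENNReal.ofReal (M.toReal * 2 * ∑ o, ‖comp o (smoothTriple a b S v)‖ ^ 2) := by
    rw [ENNReal.ofReal_mul (by positivity), ENNReal.ofReal_mul (by positivity),
      ENNReal.ofReal_toReal hMt, ENNReal.ofReal_sum_of_nonneg fun _ _ => by positivity, mul_assoc]
    simp only [ofReal_norm_sq, ENNReal.ofReal_ofNat]
  rw [h4, ← ofReal_norm_sq] at h3
  exact (ENNReal.ofReal_le_ofReal_iff (by positivity)).1 h3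

end TraceBound

end

section

/-! ### Thin boundary layers -/

section Thin

open Set Function

variable {a b : Plane} {S Ω : Set Plane}

/-- The sets `N r` are thin in `Ω`: the `L²(N r)` norm is small compared to the `H¹(Ω)` norm. -/
def IsThin (Ω : Set Plane) (N : ℝ → Set Plane) : Prop :=
  ∃ C : ℝ≥0∞, C ≠ ⊤ ∧ ∃ r₀ > 0, ∀ r, 0 < r → r ≤ r₀ → ∀ v : Plane → ℂ, ContDiff ℝ ∞ v →
    ∫⁻ x in N r, ‖v x‖ₑ ^ 2 ≤ ENNReal.ofReal r * C * sobolevSq Ω v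

theorem IsThin.union {N N' : ℝ → Set Plane} (h : IsThin Ω N) (h' : IsThin Ω N') :
    IsThin Ω fun r => N r ∪ N' r := by
  obtain ⟨C, hC, r₀, hr₀, H⟩ := h
  obtain ⟨C', hC', r₀', hr₀', H'⟩ := h'
  refine ⟨C + C', ENNReal.add_ne_top.2 ⟨hC, hC'⟩, min r₀ r₀', lt_min hr₀ hr₀', fun r h0 hr v hv => ?_⟩
  refine (lintegral_union_le _ _ _).trans ?_
  rw [mul_add, add_mul]
  exact add_le_add (H r h0 (hr.trans (min_le_left _ _)) v hv)
    (H' r h0 (hr.trans (min_le_right _ _)) v hv)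

theorem isThin_empty : IsThin Ω fun _ => ∅ :=
  ⟨0, by simp, 1, one_pos, fun r _ _ v _ => by simp⟩

theorem IsThin.biUnion {ι : Type*} {N : ι → ℝ → Set Plane} (t : Finset ι)
    (h : ∀ i ∈ t, IsThin Ω (N i)) : IsThin Ω fun r => ⋃ i ∈ t, N i r := by
  classical
  induction t using Finset.induction_on with
  | empty => simpa using isThin_empty
  | insert i t _ ih =>
    simp only [Finset.set_biUnion_insert]
    exact (h i (Finset.mem_insert_self i t)).union
      (ih fun j hj => h j (Finset.mem_insert_of_mem hj))

theorem IsThin.mono {N N' : ℝ → Set Plane} (h : IsThin Ω N) {r₁ : ℝ} (hr₁ : 0 < r₁)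
    (hsub : ∀ r, 0 < r → r ≤ r₁ → N' r ⊆ N r) : IsThin Ω N' := by
  obtain ⟨C, hC, r₀, hr₀, H⟩ := h
  refine ⟨C, hC, min r₀ r₁, lt_min hr₀ hr₁, fun r h0 hr v hv => ?_⟩
  exact (lintegral_mono_set (hsub r h0 (hr.trans (min_le_right _ _)))).trans
    (H r h0 (hr.trans (min_le_left _ _)) v hv)

/-- If Ω contains columns of fixed length ρ above the graph of η, and N r lies in the part of these
columns of height at most M r, then `lintegral_strip_le` gives a factor proportional to r. -/
theorem isThin_columns {c e f : Plane} (ho : Orthonormal ℝ ![e, f]) (hΩ : MeasurableSet Ω)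
    {I : Set ℝ} (hI : MeasurableSet I) {η : ℝ → ℝ} {ρ : ℝ} (hρ : 0 < ρ)
    (hsub : ∀ s ∈ I, ∀ t ∈ Ioo 0 ρ, frame c e f s (η s + t) ∈ Ω) {M : ℝ} (hM : 0 < M)
    {N : ℝ → Set Plane} (hN : ∀ r, MeasurableSet (N r)) {r₁ : ℝ} (hr₁ : 0 < r₁)
    (hcol : ∀ r, 0 < r → r ≤ r₁ → ∀ s t, frame c e f s (η s + t) ∈ N r →
      s ∈ I ∧ t ∈ Icc 0 (M * r)) : IsThin Ω N := by
  refine ⟨ENNReal.ofReal M * ENNReal.ofReal (2 / ρ + 2 * ρ), by finiteness, min r₁ (ρ / M),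
    lt_min hr₁ (by positivity), fun r h0 hr v hv => ?_⟩
  have hr1 := hr.trans (min_le_left _ _)
  have hr2 : M * r ≤ ρ := by
    rw [mul_comm, ← le_div_iff₀ hM]; exact hr.trans (min_le_right _ _)
  have h1 := le_lintegral_columns ho (F := fun x => ‖v x‖ₑ ^ 2)
    (hv.continuous.enorm.measurable.pow_const 2) (hN r) hI measurableSet_Icc (hcol r h0 hr1)
  refine h1.trans ((lintegral_strip_le ho hv hΩ hI hρ hr2 hsub).trans (le_of_eq ?_))
  rw [ENNReal.ofReal_mul hM.le]
  ring

theorem inner_frame {c e f : Plane} (ho : Orthonormal ℝ ![e, f]) (s t : ℝ) :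
    inner ℝ f (frame c e f s t - c) = t := by
  have hf : ‖f‖ = 1 := ho.norm_eq_one 1
  have hef : inner ℝ f e = 0 := ho.inner_eq_zero (i := 1) (j := 0) (by decide)
  have h1 : frame c e f s t - c = s • e + t • f := by unfold frame; module
  rw [h1, inner_add_right, inner_smul_right, inner_smul_right, hef, real_inner_self_eq_norm_sq, hf]
  simp

/-- The inner product with the inward normal is the height above the side, and `exists_collar`
provides the columns. -/
theorem isThin_side (hab : ∀ i, a i < b i) (hS : IsCompact S) (hSB : S ⊆ box a b) (k : Fin 4) :
    IsThin (box a b \ S) fun r =>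
      (box a b \ S) ∩ {x | inner ℝ (sideDir (k + 1)) (x - corner a b k) < r} := by
  obtain ⟨ρ, hρ0, hρ, hcollar⟩ := exists_collar hab hS hSB
  have hΩ : MeasurableSet (box a b \ S) := (isOpen_box a b).measurableSet.diff hS.measurableSet
  refine isThin_columns (c := corner a b k) (I := Ioo 0 (sideLen a b k)) (η := fun _ => 0) (orthonormal_sideDir k) hΩ
    measurableSet_Ioo hρ0 (fun s hs t ht => ?_) one_pos (fun r => hΩ.inter ?_) one_pos
    fun r h0 hr s t hst => ?_
  · rw [zero_add]; exact hcollar k s hs t ht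
  · refine measurableSet_lt (Continuous.measurable ?_) measurable_const
    fun_prop
  · rw [zero_add] at hst
    have h1 := sideFrame_mem_box.1 hst.1.1
    have h2 := hst.2
    rw [Set.mem_ofPred_eq, inner_frame (orthonormal_sideDir k)] at h2
    exact ⟨h1.1, h1.2.1.le, by rw [one_mul]; exact h2.le⟩

/-- A point whose heights above all four sides are at least r cannot leave the box by a displacement
shorter than r. -/
theorem exists_side_of_notMem_box {x y : Plane} {r : ℝ} (hy : y ∉ box a b)
    (hxy : ‖x - y‖ < r) : ∃ k, inner ℝ (sideDir (k + 1)) (x - corner a b k) < r := by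
  have h0 : |x 0 - y 0| < r := (PiLp.norm_apply_le (x - y) 0).trans_lt hxy
  have h1 : |x 1 - y 1| < r := (PiLp.norm_apply_le (x - y) 1).trans_lt hxy
  rw [abs_lt] at h0 h1
  have hy2 : ¬ ∀ i, a i < y i ∧ y i < b i := hy
  rw [Fin.forall_fin_two] at hy2
  by_contra! hne
  have e0 := hne 0
  have e1 := hne 1
  have e2 := hne 2
  have e3 := hne 3
  simp [sideDir, corner, EuclideanSpace.inner_eq_star_dotProduct, Matrix.vecHead,
    Matrix.vecTail] at e0 e1 e2 e3
  exact hy2 ⟨⟨by linarith, by linarith⟩, by linarith, by linarith⟩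

/-- Near a boundary point of the obstacle. -/
theorem isThin_chart (hS : IsCompactLipschitz S) (hSB : S ⊆ box a b) {p : Plane}
    (hp : p ∈ frontier S) : ∃ ρ > 0, IsThin (box a b \ S) fun r =>
      (box a b \ S) ∩ (Metric.ball p (2 * ρ) ∩ Metric.thickening r S) := by
  obtain ⟨hSc, hL⟩ := hS
  have hΩ : MeasurableSet (box a b \ S) := (isOpen_box a b).measurableSet.diff hSc.measurableSet
  have hpS : p ∈ S := hSc.isClosed.frontier_subset hp
  obtain ⟨R, K, h, r₀, hLip, hr₀, hR⟩ := hL p hp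
  obtain ⟨r₂, hr₂, hball⟩ := Metric.isOpen_iff.1 (isOpen_box a b) p (hSB hpS)
  obtain ⟨r₁, hr₁, h10, h12⟩ : ∃ r₁ > 0, r₁ ≤ r₀ ∧ r₁ ≤ r₂ :=
    ⟨min r₀ r₂, lt_min hr₀ hr₂, min_le_left _ _, min_le_right _ _⟩
  obtain ⟨e, he⟩ : ∃ e, e = R.symm (EuclideanSpace.single 0 1) := ⟨_, rfl⟩
  obtain ⟨f, hf⟩ : ∃ f, f = R.symm (EuclideanSpace.single 1 1) := ⟨_, rfl⟩
  have ho : Orthonormal ℝ ![e, f] := by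
    have h1 := (EuclideanSpace.orthonormal_single (𝕜 := ℝ) (ι := Fin 2)).comp_linearIsometryEquiv
      R.symm
    convert h1 using 1
    ext i : 1
    fin_cases i <;> simp [he, hf]
  have hRf : ∀ s t, R (frame 0 e f s t) = s • EuclideanSpace.single 0 1 +
      t • EuclideanSpace.single 1 1 := by
    intro s t
    simp [frame, he, hf]
  have hR0 : ∀ s t, R (frame 0 e f s t) 0 = s := fun s t => by rw [hRf]; simp
  have hR1 : ∀ s t, R (frame 0 e f s t) 1 = t := fun s t => by rw [hRf]; simp
  have hfr : ∀ x, frame 0 e f (R x 0) (R x 1) = x := fun x => by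
    apply R.injective
    rw [hRf]
    ext i; fin_cases i <;> simp
  have habs : ∀ x y : Plane, ∀ i, |R x i - R y i| ≤ ‖x - y‖ := fun x y i => by
    have := PiLp.norm_apply_le (R (x - y)) i
    rwa [R.norm_map, map_sub] at this
  have hnorm : ∀ x y : Plane, ‖x - y‖ ≤ |R x 0 - R y 0| + |R x 1 - R y 1| := fun x y => by
    have h1 := norm_frame_sub_sq (c := 0) ho (R x 0) (R x 1) (R y 0) (R y 1)
    rw [hfr, hfr] at h1
    refine abs_le_of_sq_le_sq' ?_ (by positivity) |>.2
    rw [h1, ← sq_abs (R x 0 - R y 0), ← sq_abs (R x 1 - R y 1)]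
    nlinarith [mul_nonneg (abs_nonneg (R x 0 - R y 0)) (abs_nonneg (R x 1 - R y 1))]
  have hLip' : ∀ s t, |h s - h t| ≤ K * |s - t| := fun s t => by
    have := hLip.dist_le_mul s t
    rwa [Real.dist_eq, Real.dist_eq] at this
  -- A boundary point lies on the graph: it belongs to S, and it is a limit of points outside S,
  -- which lie above the graph.
  have hp1 : R p 1 = h (R p 0) := by
    refine le_antisymm ((hR p (Metric.mem_ball_self hr₀)).1 hpS) ?_
    have hpc : p ∈ closure (Metric.ball p r₀ ∩ Sᶜ) := by
      have h1 : p ∈ closure Sᶜ := by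
        rw [← frontier_compl] at hp
        exact frontier_subset_closure hp
      exact Metric.isOpen_ball.inter_closure ⟨Metric.mem_ball_self hr₀, h1⟩
    have hcl : IsClosed {x : Plane | h (R x 0) ≤ R x 1} := by
      refine isClosed_le (hLip.continuous.comp ?_) ?_ <;> fun_prop
    refine (closure_minimal (fun x hx => ?_) hcl) hpc
    by_contra hlt
    exact hx.2 ((hR x hx.1).2 (not_le.1 hlt).le)
  have hK : 0 ≤ (K : ℝ) := K.2
  -- This small ρ keeps every column over |s − (R p) 0| < 2ρ of length r₁/4 inside the disc of
  -- radius r₁: the graph varies by at most 2Kρ there, and 2ρ + 2Kρ + r₁/4 < r₁.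
  obtain ⟨ρ, hρ⟩ : ∃ ρ : ℝ, ρ = r₁ / (4 * (K + 2)) := ⟨_, rfl⟩
  have hρ0 : 0 < ρ := by rw [hρ]; positivity
  have hρr : 4 * (K + 2) * ρ = r₁ := by rw [hρ]; field_simp
  have hKρ : 0 ≤ K * ρ := by positivity
  refine ⟨ρ, hρ0, isThin_columns (c := 0) (e := e) (f := f) (η := h)
    (I := Ioo (R p 0 - 2 * ρ) (R p 0 + 2 * ρ)) (ρ := r₁ / 4) (M := K + 1) (r₁ := ρ) ho hΩ
    measurableSet_Ioo (by positivity) (fun s hs t ht => ?_) (by positivity)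
    (fun r => hΩ.inter (Metric.isOpen_ball.inter Metric.isOpen_thickening).measurableSet) hρ0
    fun r hr0 hr s t hst => ?_⟩
  · have hs' : |s - R p 0| < 2 * ρ := by rw [abs_lt]; constructor <;> linarith [hs.1, hs.2]
    have hd : ‖frame 0 e f s (h s + t) - p‖ < r₁ := by
      refine (hnorm _ _).trans_lt ?_
      rw [hR0, hR1, hp1]
      have h1 : |h s + t - h (R p 0)| ≤ |h s - h (R p 0)| + t := by
        have : h s + t - h (R p 0) = (h s - h (R p 0)) + t := by ring
        rw [this]
        refine (abs_add_le _ _).trans ?_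
        rw [abs_of_pos ht.1]
      have h2 := hLip' s (R p 0)
      have h3 : K * |s - R p 0| ≤ K * (2 * ρ) := by gcongr
      nlinarith [ht.2]
    have hd' : frame 0 e f s (h s + t) ∈ Metric.ball p r₁ := by
      rwa [Metric.mem_ball, dist_eq_norm]
    refine ⟨hball (Metric.ball_subset_ball h12 hd'), fun hmem => ?_⟩
    have := (hR _ (Metric.ball_subset_ball h10 hd')).1 hmem
    rw [hR0, hR1] at this
    linarith [ht.1]
  · obtain ⟨hxΩ, hxb, hxt⟩ := hst
    obtain ⟨z, hzS, hz⟩ := Metric.mem_thickening_iff.1 hxt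
    rw [Metric.mem_ball, dist_eq_norm] at hxb
    rw [dist_eq_norm] at hz
    have hx0 := habs (frame 0 e f s (h s + t)) p 0
    rw [hR0] at hx0
    have hs' := abs_lt.1 (hx0.trans_lt hxb)
    have hzb : z ∈ Metric.ball p r₀ := by
      rw [Metric.mem_ball, dist_eq_norm]
      calc ‖z - p‖ ≤ ‖frame 0 e f s (h s + t) - p‖ + ‖frame 0 e f s (h s + t) - z‖ := by
            rw [add_comm, norm_sub_rev _ z]
            exact norm_sub_le_norm_sub_add_norm_sub _ _ _
        _ < r₀ := by nlinarith
    have hz1 := (hR z hzb).1 hzS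
    have hxball : frame 0 e f s (h s + t) ∈ Metric.ball p r₀ := by
      rw [Metric.mem_ball, dist_eq_norm]; nlinarith
    have hx1 : ¬ R (frame 0 e f s (h s + t)) 1 ≤ h (R (frame 0 e f s (h s + t)) 0) :=
      fun hh => hxΩ.2 ((hR _ hxball).2 hh)
    rw [hR0, hR1, not_le] at hx1
    have hz0' := habs (frame 0 e f s (h s + t)) z 0
    have hz1' := habs (frame 0 e f s (h s + t)) z 1
    rw [hR0] at hz0'
    rw [hR1] at hz1'
    have h3 := hLip' s (R z 0)
    have h4 : K * |s - R z 0| ≤ K * r := by gcongr; exact (hz0'.trans_lt hz).le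
    have h5 := (abs_lt.1 (hz1'.trans_lt hz)).2
    have h6 := (abs_le.1 h3).1
    -- The slope K + 1: the nearby point z of S lies below the graph, whose height changes by at
    -- most K r between z and x, and x is at most r higher than z.
    exact ⟨⟨by linarith, by linarith⟩, by linarith, by linarith⟩

/-- Otherwise the interior and the exterior of T would separate the connected set A. -/
theorem exists_mem_frontier_of_mem_of_notMem {A T : Set Plane} (hA : IsPreconnected A)
    {x y : Plane} (hx : x ∈ A) (hy : y ∈ A) (hxT : x ∉ T) (hyT : y ∈ T) :
    ∃ z ∈ A, z ∈ frontier T := by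
  by_contra! hne
  have hi : y ∈ interior T := by
    by_contra h
    exact hne y hy ⟨subset_closure hyT, h⟩
  have hc : x ∈ (closure T)ᶜ := fun h => hne x hx ⟨h, fun h' => hxT (interior_subset h')⟩
  obtain ⟨z, -, hz1, hz2⟩ := hA _ _ isOpen_interior isClosed_closure.isOpen_compl
    (fun z hz => by
      by_contra h
      rw [mem_union, not_or, notMem_compl_iff] at h
      exact hne z hz ⟨h.2, h.1⟩) ⟨y, hy, hi⟩ ⟨x, hx, hc⟩
  exact hz2 (subset_closure (interior_subset hz1))

/-- The boundary layer of `Ω = B \ S` is thin. -/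
theorem isThin_boundary_layer (hab : ∀ i, a i < b i) (hS : IsCompactLipschitz S)
    (hSB : S ⊆ box a b) : IsThin (box a b \ S) fun r =>
      (box a b \ S) ∩ Metric.thickening r (box a b \ S)ᶜ := by
  choose! ρ hρ hthin using fun p (hp : p ∈ frontier S) => isThin_chart hS hSB hp
  have hfc : IsCompact (frontier S) := hS.1.of_isClosed_subset isClosed_frontier
    hS.1.isClosed.frontier_subset
  obtain ⟨t, htS, hcov⟩ := hfc.elim_nhds_subcover (fun p => Metric.ball p (ρ p))
    fun p hp => Metric.ball_mem_nhds p (hρ p hp)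
  -- The layer must be thinner than every chart radius of the finite cover, so that points near the
  -- frontier stay in the doubled discs.
  obtain ⟨r₁, hr₁, hr₁t⟩ : ∃ r₁ > 0, ∀ p ∈ t, r₁ ≤ ρ p := by
    rcases t.eq_empty_or_nonempty with rfl | hne
    · exact ⟨1, one_pos, by simp⟩
    · obtain ⟨q, hq, hmin⟩ := t.exists_min_image ρ hne
      exact ⟨ρ q, hρ q (htS q hq), hmin⟩
  have h1 := IsThin.biUnion Finset.univ fun k _ => isThin_side hab hS.1 hSB k
  have h2 := IsThin.biUnion t fun p hp => hthin p (htS p hp)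
  refine (h1.union h2).mono hr₁ fun r hr0 hr x hx => ?_
  obtain ⟨hxΩ, hxt⟩ := hx
  obtain ⟨y, hy, hxy⟩ := Metric.mem_thickening_iff.1 hxt
  by_cases hyB : y ∈ box a b
  · right
    have hyS : y ∈ S := by
      by_contra hyS
      exact hy ⟨hyB, hyS⟩
    -- The segment from x outside S to y in S crosses the frontier at a point z closer to x than r.
    -- The chart disc containing z, when doubled, contains x.
    obtain ⟨z, hz, hzf⟩ := exists_mem_frontier_of_mem_of_notMem
      (convex_segment (𝕜 := ℝ) x y).isPreconnected (left_mem_segment ℝ x y)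
      (right_mem_segment ℝ x y) hxΩ.2 hyS
    obtain ⟨p, hpt, hzp⟩ := mem_iUnion₂.1 (hcov hzf)
    have hxz : dist x z < r := by
      have h3 : dist x z ≤ dist x y := by
        have := norm_sub_le_of_mem_segment hz
        rw [dist_comm, dist_eq_norm, dist_comm, dist_eq_norm]
        exact this
      exact h3.trans_lt hxy
    refine mem_iUnion₂.2 ⟨p, hpt, hxΩ, ?_, Metric.mem_thickening_iff.2 ⟨y, hyS, hxy⟩⟩
    rw [Metric.mem_ball] at hzp ⊢
    have := dist_triangle x z p
    linarith [hr₁t p hpt]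
  · left
    rw [dist_eq_norm] at hxy
    obtain ⟨k, hk⟩ := exists_side_of_notMem_box hyB hxy
    exact mem_iUnion₂.2 ⟨k, Finset.mem_univ k, hxΩ, hk⟩

end Thin

end

section

/-! ### The Poincaré inequality on small squares -/

section Poincare

open Set Function

/-- Integrating the identity f(x) = (f(x) − f(y)) + f(y) over y separates oscillation from the mean.
-/
theorem lintegral_sq_le_of_mean {α : Type*} [MeasurableSpace α] {μ : Measure α}
    [IsFiniteMeasure μ] {f : α → ℂ} (hf : Integrable f μ) :
    μ univ ^ 2 * ∫⁻ x, ‖f x‖ₑ ^ 2 ∂μ ≤ 2 * μ univ *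
      (∫⁻ x, ∫⁻ y, ‖f x - f y‖ₑ ^ 2 ∂μ ∂μ) + 2 * μ univ * ‖∫ x, f x ∂μ‖ₑ ^ 2 := by
  have hμ : μ univ ≠ ⊤ := measure_ne_top μ univ
  have pt : ∀ x, μ univ ^ 2 * ‖f x‖ₑ ^ 2 ≤
      2 * μ univ * (∫⁻ y, ‖f x - f y‖ₑ ^ 2 ∂μ) + 2 * ‖∫ x, f x ∂μ‖ₑ ^ 2 := by
    intro x
    have h1 : (μ.real univ : ℂ) * f x = ∫ y, (f x - f y) ∂μ + ∫ y, f y ∂μ := by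
      rw [integral_sub (integrable_const _) hf, integral_const, sub_add_cancel]
      exact (Complex.real_smul).symm
    have h2 : μ univ * ‖f x‖ₑ ≤ (∫⁻ y, ‖f x - f y‖ₑ ∂μ) + ‖∫ y, f y ∂μ‖ₑ := by
      calc μ univ * ‖f x‖ₑ = ‖(μ.real univ : ℂ) * f x‖ₑ := by
            rw [enorm_mul, ← ofReal_norm (μ.real univ : ℂ), Complex.norm_real, Real.norm_eq_abs,
              abs_of_nonneg measureReal_nonneg, ofReal_measureReal]
        _ ≤ ‖∫ y, (f x - f y) ∂μ‖ₑ + ‖∫ y, f y ∂μ‖ₑ := by rw [h1]; exact enorm_add_le _ _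
        _ ≤ _ := by gcongr; exact enorm_integral_le_lintegral_enorm _
    have h3 : AEMeasurable (fun y => ‖f x - f y‖ₑ) μ :=
      ((integrable_const _).sub hf).aestronglyMeasurable.enorm
    calc μ univ ^ 2 * ‖f x‖ₑ ^ 2 = (μ univ * ‖f x‖ₑ) ^ 2 := by ring
      _ ≤ ((∫⁻ y, ‖f x - f y‖ₑ ∂μ) + ‖∫ y, f y ∂μ‖ₑ) ^ 2 := by gcongr
      _ ≤ 2 * (∫⁻ y, ‖f x - f y‖ₑ ∂μ) ^ 2 + 2 * ‖∫ y, f y ∂μ‖ₑ ^ 2 := add_sq_le_two_mul _ _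
      _ ≤ 2 * (μ univ * ∫⁻ y, ‖f x - f y‖ₑ ^ 2 ∂μ) + 2 * ‖∫ y, f y ∂μ‖ₑ ^ 2 := by
          gcongr
          exact sq_lintegral_le μ h3
      _ = _ := by ring
  calc μ univ ^ 2 * ∫⁻ x, ‖f x‖ₑ ^ 2 ∂μ = ∫⁻ x, μ univ ^ 2 * ‖f x‖ₑ ^ 2 ∂μ :=
        (lintegral_const_mul' _ _ (by finiteness)).symm
    _ ≤ ∫⁻ x, (2 * μ univ * (∫⁻ y, ‖f x - f y‖ₑ ^ 2 ∂μ) + 2 * ‖∫ x, f x ∂μ‖ₑ ^ 2) ∂μ :=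
        lintegral_mono pt
    _ = _ := by
        rw [lintegral_add_right _ measurable_const, lintegral_const,
          lintegral_const_mul' _ _ (by finiteness)]
        ring

variable {c e f : Plane} {v : Plane → ℂ} {Q : Set Plane} {δ : ℝ}

theorem lintegral_square (ho : Orthonormal ℝ ![e, f]) (hQ : MeasurableSet Q)
    (hmem : ∀ s t, frame c e f s t ∈ Q ↔ s ∈ Ico 0 δ ∧ t ∈ Ico 0 δ) {F : Plane → ℝ≥0∞}
    (hF : Measurable F) :
    ∫⁻ x in Q, F x = ∫⁻ s in Ioo 0 δ, ∫⁻ t in Ioo 0 δ, F (frame c e f s t) := by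
  rw [Measure.restrict_congr_set (Ioo_ae_eq_Ico (a := (0 : ℝ)) (b := δ))]
  refine le_antisymm ?_ ?_
  · have := le_lintegral_columns (c := c) (η := fun _ => 0) ho hF hQ
      (measurableSet_Ico (a := (0 : ℝ)) (b := δ)) (measurableSet_Ico (a := (0 : ℝ)) (b := δ))
      (fun s t h => (hmem s t).1 (by rwa [zero_add] at h))
    simpa using this
  · have := lintegral_columns_le (c := c) (η := fun _ => 0) ho hF hQ
      (measurableSet_Ico (a := (0 : ℝ)) (b := δ)) (measurableSet_Ico (a := (0 : ℝ)) (b := δ))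
      (fun s hs t ht => by rw [zero_add]; exact (hmem s t).2 ⟨hs, ht⟩)
    simpa using this

/-- Two points of the square are joined by a vertical and a horizontal segment. Each increment is
bounded by Cauchy–Schwarz on a whole line of the square, and integration over the remaining
variables produces δ⁴. -/
theorem lintegral_square_diff_le (ho : Orthonormal ℝ ![e, f]) (hv : ContDiff ℝ ∞ v)
    (hQ : MeasurableSet Q)
    (hmem : ∀ s t, frame c e f s t ∈ Q ↔ s ∈ Ico 0 δ ∧ t ∈ Ico 0 δ) :
    ∫⁻ x in Q, ∫⁻ y in Q, ‖v x - v y‖ₑ ^ 2 ≤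
      4 * ENNReal.ofReal δ ^ 4 * ∫⁻ x in Q, ‖fderiv ℝ v x‖ₑ ^ 2 := by
  obtain ⟨d, hd⟩ : ∃ d, d = ENNReal.ofReal δ := ⟨_, rfl⟩
  have hdt : d ≠ ⊤ := by rw [hd]; exact ENNReal.ofReal_ne_top
  have hvol : (volume.restrict (Ioo (0 : ℝ) δ)) univ = d := by simp [hd]
  have mG : Measurable fun x => ‖fderiv ℝ v x‖ₑ ^ 2 :=
    (hv.continuous_fderiv (by simp)).enorm.measurable.pow_const 2
  have mg : Measurable (uncurry fun s t => ‖fderiv ℝ v (frame c e f s t)‖ₑ ^ 2) :=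
    (continuous_fderiv_frame hv).enorm.measurable.pow_const 2
  have mv : Measurable (uncurry fun x y => ‖v x - v y‖ₑ ^ 2) := by
    have h1 : Continuous fun p : Plane × Plane => v p.1 - v p.2 :=
      (hv.continuous.comp continuous_fst).sub (hv.continuous.comp continuous_snd)
    exact h1.enorm.measurable.pow_const 2
  have mvx : ∀ x, Measurable fun y => ‖v x - v y‖ₑ ^ 2 := fun x =>
    (continuous_const.sub hv.continuous).enorm.measurable.pow_const 2
  have mi : Measurable fun x => ∫⁻ y in Q, ‖v x - v y‖ₑ ^ 2 := mv.lintegral_prod_right'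
  -- A bounds the vertical increment and depends only on the abscissa of the first point; B bounds
  -- the horizontal one and depends only on the ordinate of the second.
  obtain ⟨A, hA⟩ : ∃ A : ℝ → ℝ≥0∞, A = fun s =>
    2 * (d * ∫⁻ y in Ioo 0 δ, ‖fderiv ℝ v (frame c e f s y)‖ₑ ^ 2) := ⟨_, rfl⟩
  obtain ⟨B, hB⟩ : ∃ B : ℝ → ℝ≥0∞, B = fun t =>
    2 * (d * ∫⁻ x in Ioo 0 δ, ‖fderiv ℝ v (frame c e f x t)‖ₑ ^ 2) := ⟨_, rfl⟩
  obtain ⟨E, hE⟩ : ∃ E, E = ∫⁻ x in Q, ‖fderiv ℝ v x‖ₑ ^ 2 := ⟨_, rfl⟩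
  have hA' : ∫⁻ s in Ioo 0 δ, A s = 2 * (d * E) := by
    rw [hA, hE, lintegral_square ho hQ hmem mG, lintegral_const_mul' _ _ (by simp),
      lintegral_const_mul' _ _ hdt]
  have hB' : ∫⁻ t in Ioo 0 δ, B t = 2 * (d * E) := by
    rw [hB, hE, lintegral_square ho hQ hmem mG, lintegral_const_mul' _ _ (by simp),
      lintegral_const_mul' _ _ hdt, lintegral_lintegral_swap mg.aemeasurable]
  have key : ∀ s ∈ Ioo 0 δ, ∀ t ∈ Ioo 0 δ, ∀ s' ∈ Ioo 0 δ, ∀ t' ∈ Ioo 0 δ,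
      ‖v (frame c e f s t) - v (frame c e f s' t')‖ₑ ^ 2 ≤ A s + B t' := by
    intro s hs t ht s' hs' t' ht'
    have h1 := enorm_sub_le_lintegral_of_mem
      (fun t => hasDerivAt_frame_right (c := c) (e := e) (f := f) hv s t)
      (continuous_fderiv_frame_right hv f s) (Ioo_subset_Icc_self ht) (Ioo_subset_Icc_self ht')
    have h2 := enorm_sub_le_lintegral_of_mem
      (fun s => hasDerivAt_frame_left (c := c) (e := e) (f := f) hv s t')
      (continuous_fderiv_frame_left hv e t') (Ioo_subset_Icc_self hs) (Ioo_subset_Icc_self hs')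
    have h3 := sq_lintegral_le (volume.restrict (Ioo 0 δ))
      (continuous_fderiv_frame_right (c := c) (e := e) (f := f) hv f s).enorm.measurable.aemeasurable
    have h4 := sq_lintegral_le (volume.restrict (Ioo 0 δ))
      (continuous_fderiv_frame_left (c := c) (e := e) (f := f) hv e t').enorm.measurable.aemeasurable
    rw [hvol] at h3 h4
    calc _ ≤ (‖v (frame c e f s t) - v (frame c e f s t')‖ₑ +
          ‖v (frame c e f s t') - v (frame c e f s' t')‖ₑ) ^ 2 := by
          gcongr; exact enorm_sub_le_add _ _ _
      _ ≤ _ := add_sq_le_two_mul _ _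
      _ ≤ _ := by
          rw [hA, hB]
          dsimp only
          gcongr
          · refine (pow_le_pow_left' h1 2).trans (h3.trans ?_)
            gcongr with y
            exact enorm_apply_le (ho.norm_eq_one 1)
          · refine (pow_le_pow_left' h2 2).trans (h4.trans ?_)
            gcongr with y
            exact enorm_apply_le (ho.norm_eq_one 0)
  calc ∫⁻ x in Q, ∫⁻ y in Q, ‖v x - v y‖ₑ ^ 2
      = ∫⁻ s in Ioo 0 δ, ∫⁻ t in Ioo 0 δ, ∫⁻ s' in Ioo 0 δ, ∫⁻ t' in Ioo 0 δ,
          ‖v (frame c e f s t) - v (frame c e f s' t')‖ₑ ^ 2 := by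
        rw [lintegral_square ho hQ hmem mi]
        exact lintegral_congr fun s => lintegral_congr fun t =>
          lintegral_square ho hQ hmem (mvx _)
    _ ≤ ∫⁻ s in Ioo 0 δ, ∫⁻ _t in Ioo 0 δ, ∫⁻ _s' in Ioo 0 δ, ∫⁻ t' in Ioo 0 δ, (A s + B t') :=
        setLIntegral_mono' measurableSet_Ioo fun s hs =>
          setLIntegral_mono' measurableSet_Ioo fun t ht =>
            setLIntegral_mono' measurableSet_Ioo fun s' hs' =>
              setLIntegral_mono' measurableSet_Ioo fun t' ht' => key s hs t ht s' hs' t' ht'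
    _ = ∫⁻ s in Ioo 0 δ, d ^ 2 * (d * A s + 2 * (d * E)) := by
        refine lintegral_congr fun s => ?_
        rw [lintegral_const, lintegral_const, lintegral_add_left measurable_const, lintegral_const,
          hvol, hB']
        ring
    _ = d ^ 2 * (d * (2 * (d * E)) + 2 * (d * E) * d) := by
        rw [lintegral_const_mul' _ _ (by finiteness), lintegral_add_right _ measurable_const,
          lintegral_const_mul' _ _ hdt, lintegral_const, hvol, hA']
    _ = _ := by rw [← hd, ← hE]; ring

/-- The square has measure δ², so the oscillation term δ⁴ becomes δ² after division, and the mean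
term keeps the factor δ⁻². -/
theorem poincare_square (ho : Orthonormal ℝ ![e, f]) (hv : ContDiff ℝ ∞ v)
    (hQ : MeasurableSet Q) (hδ : 0 < δ)
    (hmem : ∀ s t, frame c e f s t ∈ Q ↔ s ∈ Ico 0 δ ∧ t ∈ Ico 0 δ)
    (hi : IntegrableOn v Q) :
    ∫⁻ x in Q, ‖v x‖ₑ ^ 2 ≤ 8 * ENNReal.ofReal δ ^ 2 * (∫⁻ x in Q, ‖fderiv ℝ v x‖ₑ ^ 2) +
      2 * (ENNReal.ofReal δ ^ 2)⁻¹ * ‖∫ x in Q, v x‖ₑ ^ 2 := by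
  obtain ⟨d, hd⟩ : ∃ d, d = ENNReal.ofReal δ := ⟨_, rfl⟩
  have hd0 : d ≠ 0 := by simpa [hd] using hδ
  have hdt : d ≠ ⊤ := by rw [hd]; exact ENNReal.ofReal_ne_top
  have hvol : (volume.restrict Q) univ = d ^ 2 := by
    have := lintegral_square (F := fun _ => 1) ho hQ hmem measurable_const
    simp only [lintegral_const, one_mul, Measure.restrict_apply_univ, Real.volume_Ioo, sub_zero,
      ← hd] at this
    rw [Measure.restrict_apply_univ, this, sq]
  have hfin : IsFiniteMeasure (volume.restrict Q) := ⟨by rw [hvol]; finiteness⟩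
  have h1 := lintegral_sq_le_of_mean hi
  have h2 := lintegral_square_diff_le ho hv hQ hmem
  rw [hvol] at h1
  rw [← hd] at h2 ⊢
  generalize ∫⁻ x in Q, ‖v x‖ₑ ^ 2 = X at *
  generalize ∫⁻ x in Q, ∫⁻ y in Q, ‖v x - v y‖ₑ ^ 2 = Y at *
  generalize ∫⁻ x in Q, ‖fderiv ℝ v x‖ₑ ^ 2 = E at *
  generalize ‖∫ x in Q, v x‖ₑ = m at *
  have hc : (d ^ 2)⁻¹ * d ^ 2 = 1 := ENNReal.inv_mul_cancel (by positivity) (by finiteness)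
  calc X = ((d ^ 2)⁻¹ * d ^ 2) ^ 2 * X := by rw [hc]; simp
    _ = (d ^ 2)⁻¹ ^ 2 * ((d ^ 2) ^ 2 * X) := by ring
    _ ≤ (d ^ 2)⁻¹ ^ 2 * (2 * d ^ 2 * (4 * d ^ 4 * E) + 2 * d ^ 2 * m ^ 2) := by
        gcongr
        exact h1.trans (by gcongr)
    _ = ((d ^ 2)⁻¹ * d ^ 2) ^ 2 * (8 * d ^ 2 * E) +
        ((d ^ 2)⁻¹ * d ^ 2) * (2 * (d ^ 2)⁻¹ * m ^ 2) := by ring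
    _ = _ := by rw [hc]; ring

/-- The half-open squares of a grid. -/
def cell (δ : ℝ) (m : ℤ × ℤ) : Set Plane := {x | ⌊x 0 / δ⌋ = m.1 ∧ ⌊x 1 / δ⌋ = m.2}

theorem frame_mem_cell (hδ : 0 < δ) (m : ℤ × ℤ) (s t : ℝ) :
    frame !₂[m.1 * δ, m.2 * δ] (sideDir 0) (sideDir 1) s t ∈ cell δ m ↔
      s ∈ Ico 0 δ ∧ t ∈ Ico 0 δ := by
  have h : ∀ (n : ℤ) (r : ℝ), ⌊(n * δ + r) / δ⌋ = n ↔ r ∈ Ico 0 δ := fun n r => by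
    rw [Int.floor_eq_iff, le_div_iff₀ hδ, div_lt_iff₀ hδ, mem_Ico]
    constructor <;> rintro ⟨h1, h2⟩ <;> constructor <;> nlinarith
  rw [cell, Set.mem_ofPred_eq, ← h m.1, ← h m.2]
  simp [frame, sideDir]

theorem measurableSet_cell (δ : ℝ) (m : ℤ × ℤ) : MeasurableSet (cell δ m) := by
  have h : ∀ i : Fin 2, Measurable fun x : Plane => ⌊x i / δ⌋ := fun i => by
    refine Int.measurable_floor.comp (Measurable.div_const ?_ δ)
    exact (by fun_prop : Continuous fun x : Plane => x i).measurable
  exact (h 0 (measurableSet_singleton m.1)).inter (h 1 (measurableSet_singleton m.2))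

theorem norm_sub_lt_of_mem_cell (hδ : 0 < δ) {m : ℤ × ℤ} {x y : Plane} (hx : x ∈ cell δ m)
    (hy : y ∈ cell δ m) : ‖x - y‖ < 2 * δ := by
  have h : ∀ i, ⌊x i / δ⌋ = ⌊y i / δ⌋ → (x i - y i) ^ 2 < δ ^ 2 := fun i hi => by
    have h1 := Int.abs_sub_lt_one_of_floor_eq_floor hi
    rw [← sub_div, abs_div, abs_of_pos hδ, div_lt_one hδ] at h1
    exact sq_lt_sq.2 (by rwa [abs_of_pos hδ])
  have h0 := h 0 (hx.1.trans hy.1.symm)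
  have h1 := h 1 (hx.2.trans hy.2.symm)
  refine lt_of_pow_lt_pow_left₀ 2 (by positivity) ?_
  rw [EuclideanSpace.norm_sq_eq, Fin.sum_univ_two]
  simp only [PiLp.sub_apply, Real.norm_eq_abs, sq_abs]
  nlinarith

end Poincare

end

section

/-! ### Compactness of the embedding into `L²` -/

section SubHilbert

variable {E : Type*} [NormedAddCommGroup E] [InnerProductSpace ℂ E]

/-- A subspace of an inner product space, as an inner product space of its own. -/
def SubHilbert (p : Submodule ℂ E) : Type _ := p

variable {p : Submodule ℂ E}

instance : NormedAddCommGroup (SubHilbert p) := inferInstanceAs (NormedAddCommGroup p)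

instance : InnerProductSpace ℂ (SubHilbert p) := inferInstanceAs (InnerProductSpace ℂ p)

variable (p) in
/-- The inclusion of a subspace. -/
def SubHilbert.incl : SubHilbert p →ₗᵢ[ℂ] E := p.subtypeₗᵢ

theorem SubHilbert.incl_mem (w : SubHilbert p) : SubHilbert.incl p w ∈ p := w.2

theorem SubHilbert.completeSpace [CompleteSpace E] (hp : IsClosed (p : Set E)) :
    CompleteSpace (SubHilbert p) :=
  hp.completeSpace_coe

end SubHilbert

section Compactness

open Set Function

variable {a b : Plane} {S : Set Plane}

theorem finite_cells_subset (S : Set Plane) {δ : ℝ} (hδ : 0 < δ) :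
    {m : ℤ × ℤ | cell δ m ⊆ box a b \ S}.Finite := by
  refine (finite_Icc (⌊a 0 / δ⌋, ⌊a 1 / δ⌋) (⌊b 0 / δ⌋, ⌊b 1 / δ⌋)).subset fun m hm => ?_
  have hx := (frame_mem_cell hδ m 0 0).2 ⟨⟨le_rfl, hδ⟩, le_rfl, hδ⟩
  obtain ⟨x, hx'⟩ : ∃ x, x ∈ cell δ m := ⟨_, hx⟩
  have hB := (hm hx').1
  refine ⟨⟨?_, ?_⟩, ⟨?_, ?_⟩⟩
  · exact hx'.1 ▸ Int.floor_le_floor (by gcongr; exact (hB 0).1.le)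
  · exact hx'.2 ▸ Int.floor_le_floor (by gcongr; exact (hB 1).1.le)
  · exact hx'.1 ▸ Int.floor_le_floor (by gcongr; exact (hB 0).2.le)
  · exact hx'.2 ▸ Int.floor_le_floor (by gcongr; exact (hB 1).2.le)

/-- The `L²` norm is controlled by finitely many means, up to a small multiple of the `H¹` norm. -/
theorem exists_cells_bound (hab : ∀ i, a i < b i) (hS : IsCompactLipschitz S)
    (hSB : S ⊆ box a b) {ε : ℝ} (hε : 0 < ε) :
    ∃ (δ : ℝ) (s : Finset (ℤ × ℤ)) (M : ℝ≥0∞), M ≠ ⊤ ∧ (∀ m ∈ s, cell δ m ⊆ box a b \ S) ∧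
      ∀ v : smoothFun, ∫⁻ x in box a b \ S, ‖v.1 x‖ₑ ^ 2 ≤
        ENNReal.ofReal ε * sobolevSq (box a b \ S) v.1 +
          M * ∑ m ∈ s, ‖∫ x in cell δ m, v.1 x‖ₑ ^ 2 := by
  obtain ⟨C, hC, r₀, hr₀, H⟩ := isThin_boundary_layer hab hS hSB
  have hΩ : MeasurableSet (box a b \ S) := (isOpen_box a b).measurableSet.diff hS.1.measurableSet
  -- The layer of width 2δ costs 2δC and the cells cost 8δ² ≤ 8δ because δ ≤ 1; D δ bounds the sum.
  obtain ⟨D, hD0, hD⟩ : ∃ D : ℝ, 0 < D ∧ D = 2 * C.toReal + 8 := ⟨_, by positivity, rfl⟩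
  obtain ⟨δ, hδ, h1, h2, h3⟩ : ∃ δ > 0, δ ≤ 1 ∧ 2 * δ ≤ r₀ ∧ D * δ ≤ ε := by
    refine ⟨min 1 (min (r₀ / 2) (ε / D)), by positivity, min_le_left _ _, ?_, ?_⟩
    · have := (min_le_right 1 (min (r₀ / 2) (ε / D))).trans (min_le_left _ _)
      linarith
    · have := (min_le_right 1 (min (r₀ / 2) (ε / D))).trans (min_le_right _ _)
      rwa [mul_comm, ← le_div_iff₀ hD0]
  obtain ⟨s, hs⟩ : ∃ s : Finset (ℤ × ℤ), ∀ m, m ∈ s ↔ cell δ m ⊆ box a b \ S :=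
    ⟨(finite_cells_subset (a := a) (b := b) S hδ).toFinset, fun m => by simp⟩
  have hd0 : ENNReal.ofReal δ ≠ 0 := by simpa using hδ
  refine ⟨δ, s, 2 * (ENNReal.ofReal δ ^ 2)⁻¹, by finiteness, fun m hm => (hs m).1 hm,
    fun v => ?_⟩
  have hv := smoothFun.contDiff v
  -- A point whose cell leaves Ω is within the diameter of the cell, less than 2δ, of the complement
  -- of Ω, hence in the thin layer.
  have hcov : box a b \ S ⊆
      ((box a b \ S) ∩ Metric.thickening (2 * δ) (box a b \ S)ᶜ) ∪ ⋃ m ∈ s, cell δ m := by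
    intro x hx
    by_cases hsub : cell δ (⌊x 0 / δ⌋, ⌊x 1 / δ⌋) ⊆ box a b \ S
    · exact Or.inr (mem_iUnion₂.2 ⟨_, (hs _).2 hsub, rfl, rfl⟩)
    · left
      obtain ⟨y, hy, hyΩ⟩ := not_subset.1 hsub
      refine ⟨hx, Metric.mem_thickening_iff.2 ⟨y, hyΩ, ?_⟩⟩
      rw [dist_eq_norm]
      exact norm_sub_lt_of_mem_cell hδ ⟨rfl, rfl⟩ hy
  have hdisj : Set.PairwiseDisjoint (s : Set (ℤ × ℤ)) (cell δ) := by
    intro m _ m' _ hne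
    refine disjoint_left.2 fun x hx hx' => hne (Prod.ext ?_ ?_)
    · exact hx.1.symm.trans hx'.1
    · exact hx.2.symm.trans hx'.2
  have hmeas : ∀ m ∈ s, MeasurableSet (cell δ m) := fun m _ => measurableSet_cell δ m
  have hcell : ∀ m ∈ s, ∫⁻ x in cell δ m, ‖v.1 x‖ₑ ^ 2 ≤
      8 * ENNReal.ofReal δ ^ 2 * (∫⁻ x in cell δ m, ‖fderiv ℝ v.1 x‖ₑ ^ 2) +
        2 * (ENNReal.ofReal δ ^ 2)⁻¹ * ‖∫ x in cell δ m, v.1 x‖ₑ ^ 2 := fun m hm => by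
    have hint : IntegrableOn v.1 (box a b \ S) :=
      (memLp_box_diff a b S hv.continuous).integrable (by norm_num)
    exact poincare_square (orthonormal_sideDir 0) hv (measurableSet_cell δ m) hδ
      (frame_mem_cell hδ m) (hint.mono_set ((hs m).1 hm))
  have hsum : ∫⁻ x in ⋃ m ∈ s, cell δ m, ‖v.1 x‖ₑ ^ 2 ≤
      8 * ENNReal.ofReal δ ^ 2 * sobolevSq (box a b \ S) v.1 +
        2 * (ENNReal.ofReal δ ^ 2)⁻¹ * ∑ m ∈ s, ‖∫ x in cell δ m, v.1 x‖ₑ ^ 2 := by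
    rw [lintegral_biUnion_finset hdisj hmeas]
    refine (Finset.sum_le_sum hcell).trans ?_
    rw [Finset.sum_add_distrib, ← Finset.mul_sum, ← Finset.mul_sum,
      ← lintegral_biUnion_finset hdisj hmeas]
    gcongr
    exact (lintegral_mono_set (iUnion₂_subset fun m hm => (hs m).1 hm)).trans
      (lintegral_fderiv_le_sobolevSq _ _)
  calc ∫⁻ x in box a b \ S, ‖v.1 x‖ₑ ^ 2
      ≤ _ := (lintegral_mono_set hcov).trans (lintegral_union_le _ _ _)
    _ ≤ ENNReal.ofReal (2 * δ) * C * sobolevSq (box a b \ S) v.1 +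
        (8 * ENNReal.ofReal δ ^ 2 * sobolevSq (box a b \ S) v.1 +
          2 * (ENNReal.ofReal δ ^ 2)⁻¹ * ∑ m ∈ s, ‖∫ x in cell δ m, v.1 x‖ₑ ^ 2) :=
        add_le_add (H (2 * δ) (by positivity) h2 v.1 hv) hsum
    _ = (ENNReal.ofReal (2 * δ) * C + 8 * ENNReal.ofReal δ ^ 2) * sobolevSq (box a b \ S) v.1 +
          2 * (ENNReal.ofReal δ ^ 2)⁻¹ * ∑ m ∈ s, ‖∫ x in cell δ m, v.1 x‖ₑ ^ 2 := by ring
    _ ≤ _ := by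
        gcongr
        rw [← ENNReal.ofReal_toReal hC, ← ENNReal.ofReal_mul (by positivity),
          ← ENNReal.ofReal_pow hδ.le, ← ENNReal.ofReal_ofNat 8, ← ENNReal.ofReal_mul (by norm_num),
          ← ENNReal.ofReal_add (by positivity) (by positivity)]
        refine ENNReal.ofReal_le_ofReal ?_
        rw [hD] at h3
        nlinarith

/-- The integral over a cell, as a functional on `L²(Ω)`. -/
def cellMean (a b : Plane) (S : Set Plane) (δ : ℝ) (m : ℤ × ℤ) : L2 (box a b \ S) →L[ℂ] ℂ :=
  innerSL ℂ (indicatorConstLp 2 (measurableSet_cell δ m) (measure_ne_top _ _) (1 : ℂ))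

theorem cellMean_smoothL2 {δ : ℝ} {m : ℤ × ℤ} (h : cell δ m ⊆ box a b \ S) (v : smoothFun) :
    cellMean a b S δ m (smoothL2 a b S v) = ∫ x in cell δ m, v.1 x := by
  rw [cellMean, innerSL_apply_apply, L2.inner_indicatorConstLp_one]
  rw [integral_congr_ae (ae_restrict_of_ae (coeFn_smoothL2 v)),
    Measure.restrict_restrict (measurableSet_cell δ m), inter_eq_left.2 h]

/-- The inequality for smooth functions is a closed condition on the triple, hence it holds on the
energy space. -/
theorem energy_norm_sq_le (hab : ∀ i, a i < b i) (hS : IsCompactLipschitz S)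
    (hSB : S ⊆ box a b) {ε : ℝ} (hε : 0 < ε) :
    ∃ (δ : ℝ) (s : Finset (ℤ × ℤ)) (M : ℝ), ∀ w ∈ energy a b S,
      ‖comp none w‖ ^ 2 ≤ ε * (2 * ∑ o, ‖comp o w‖ ^ 2) +
        M * ∑ m ∈ s, ‖cellMean a b S δ m (comp none w)‖ ^ 2 := by
  obtain ⟨δ, s, M, hM, hs, H⟩ := exists_cells_bound hab hS hSB hε
  refine ⟨δ, s, M.toReal, fun w hw => ?_⟩
  have hsm : ∀ v : smoothFun, ‖comp none (smoothTriple a b S v)‖ ^ 2 ≤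
      ε * (2 * ∑ o, ‖comp o (smoothTriple a b S v)‖ ^ 2) +
        M.toReal * ∑ m ∈ s, ‖cellMean a b S δ m (comp none (smoothTriple a b S v))‖ ^ 2 := by
    intro v
    have h1 : ‖comp none (smoothTriple a b S v)‖ₑ ^ 2 ≤
        ENNReal.ofReal ε * (2 * ∑ o, ‖comp o (smoothTriple a b S v)‖ₑ ^ 2) +
        M * ∑ m ∈ s, ‖cellMean a b S δ m (comp none (smoothTriple a b S v))‖ₑ ^ 2 := by
      rw [comp_none_smoothTriple, enorm_smoothL2_sq]
      refine (H v).trans (add_le_add (mul_le_mul' le_rfl (sobolevSq_le v)) (le_of_eq ?_))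
      congr 1
      exact Finset.sum_congr rfl fun m hm => by rw [cellMean_smoothL2 (hs m hm)]
    refine (ENNReal.ofReal_le_ofReal_iff (by positivity)).1 ?_
    rw [ENNReal.ofReal_add (by positivity) (by positivity), ENNReal.ofReal_mul hε.le,
      ENNReal.ofReal_mul (by norm_num), ENNReal.ofReal_mul (by positivity),
      ENNReal.ofReal_toReal hM, ENNReal.ofReal_sum_of_nonneg fun _ _ => by positivity,
      ENNReal.ofReal_sum_of_nonneg fun _ _ => by positivity]
    simp only [ofReal_norm_sq, ENNReal.ofReal_ofNat]
    exact h1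
  obtain ⟨v, hv, -⟩ := mem_energy.1 hw
  have hcl : IsClosed {w : Ambient a b S | ‖comp none w‖ ^ 2 ≤ ε * (2 * ∑ o, ‖comp o w‖ ^ 2) +
        M.toReal * ∑ m ∈ s, ‖cellMean a b S δ m (comp none w)‖ ^ 2} := by
    refine isClosed_le (by fun_prop) (Continuous.add ?_ ?_)
    · refine continuous_const.mul (continuous_const.mul (continuous_finsetSum _ fun o _ => ?_))
      fun_prop
    · refine continuous_const.mul (continuous_finsetSum _ fun m _ => ?_)
      fun_prop
  exact hcl.mem_of_tendsto hv (.of_forall fun n => hsm (v n))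

/-! ### The energy space and its compact embedding -/

variable (a b S) in
/-- The energy space as a Hilbert space. -/
def Energy : Type := SubHilbert (energy a b S)

instance : NormedAddCommGroup (Energy a b S) :=
  inferInstanceAs (NormedAddCommGroup (SubHilbert (energy a b S)))

instance : InnerProductSpace ℂ (Energy a b S) :=
  inferInstanceAs (InnerProductSpace ℂ (SubHilbert (energy a b S)))

instance : CompleteSpace (Energy a b S) :=
  SubHilbert.completeSpace isClosed_energy

variable (a b S) in
/-- The inclusion of the energy space. -/
def Energy.incl : Energy a b S →ₗᵢ[ℂ] Ambient a b S := SubHilbert.incl (energy a b S)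

theorem Energy.incl_mem (w : Energy a b S) : Energy.incl a b S w ∈ energy a b S :=
  SubHilbert.incl_mem w

theorem Energy.exists_incl_eq {x : Ambient a b S} (hx : x ∈ energy a b S) :
    ∃ w : Energy a b S, Energy.incl a b S w = x := ⟨⟨x, hx⟩, rfl⟩

variable (a b S) in
/-- The components of an element of the energy space. -/
def Energy.comp (o : Option (Fin 2)) : Energy a b S →L[ℂ] L2 (box a b \ S) :=
  (HelmholtzBox.comp o).comp (Energy.incl a b S).toContinuousLinearMap

theorem Energy.comp_apply (o : Option (Fin 2)) (w : Energy a b S) :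
    Energy.comp a b S o w = HelmholtzBox.comp o (Energy.incl a b S w) := rfl

/-- The embedding of the energy space into `L²(Ω)` is compact. -/
theorem isCompactOperator_energy_comp_none (hab : ∀ i, a i < b i) (hS : IsCompactLipschitz S)
    (hSB : S ⊆ box a b) : IsCompactOperator (Energy.comp a b S none) := by
  refine isCompactOperator_of_forall_le _ fun ε hε => ?_
  -- On the common kernel of the cell means only the first term survives; ε²/2 compensates the
  -- factor 2 there and the square of the norm.
  obtain ⟨δ, s, M, H⟩ := energy_norm_sq_le hab hS hSB (ε := ε ^ 2 / 2) (by positivity)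
  refine ⟨{m // m ∈ s}, inferInstance, ContinuousLinearMap.pi fun m =>
    (cellMean a b S δ m.1).comp (Energy.comp a b S none), fun w hw => ?_⟩
  have h1 : ∀ m ∈ s, cellMean a b S δ m (comp none (Energy.incl a b S w)) = 0 := fun m hm =>
    congrFun hw ⟨m, hm⟩
  have h2 := H _ (Energy.incl_mem w)
  have h5 : ∑ m ∈ s, ‖cellMean a b S δ m (comp none (Energy.incl a b S w))‖ ^ 2 = 0 :=
    Finset.sum_eq_zero fun m hm => by rw [h1 m hm]; simp
  rw [h5, mul_zero, add_zero] at h2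
  have h3 := ambient_norm_sq (Energy.incl a b S w)
  have h4 : ‖comp none (Energy.incl a b S w)‖ ^ 2 ≤ (ε * ‖w‖) ^ 2 := by
    rw [mul_pow, ← (Energy.incl a b S).norm_map w, h3]
    nlinarith [mul_nonneg (sq_nonneg ε) (sq_nonneg ‖bdry (Energy.incl a b S w)‖)]
  exact abs_le_of_sq_le_sq' h4 (by positivity) |>.2

end Compactness

end

section

/-! ### Integration by parts up to the boundary of the box -/

section Green

open Set Function
open scoped InnerProductSpace

variable {a b : Plane} {S : Set Plane}

theorem measurePreserving_frame {c e f : Plane} (h : Orthonormal ℝ ![e, f]) :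
    MeasurePreserving (fun p : ℝ × ℝ => frame c e f p.1 p.2) := by
  have hm : Measurable fun p : ℝ × ℝ => frame c e f p.1 p.2 := continuous_frame.measurable
  refine ⟨hm, Measure.ext fun A hA => ?_⟩
  rw [Measure.map_apply hm hA, ← lintegral_indicator_one hA,
    lintegral_frame (c := c) h (measurable_one.indicator hA), ← lintegral_indicator_one (hm hA),
    Measure.volume_eq_prod, lintegral_prod _ (measurable_one.indicator (hm hA)).aemeasurable]
  rfl

/-- The integral of a derivative normal to a side is bounded by the boundary integral. -/
theorem enorm_integral_box_fderiv_le (hab : ∀ i, a i < b i) (k : Fin 4) {F : Plane → ℂ}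
    (hF : ContDiff ℝ ∞ F) : ‖∫ x in box a b, fderiv ℝ F x (sideDir (k + 1))‖ₑ ≤
      2 * ∫⁻ x, ‖F x‖ₑ ∂(arcLength (frontier (box a b))) := by
  have hFm : Measurable fun x => ‖F x‖ₑ := hF.continuous.enorm.measurable
  have hF' : Continuous fun x => fderiv ℝ F x (sideDir (k + 1)) :=
    (hF.continuous_fderiv (by simp)).clm_apply continuous_const
  have hmp := measurePreserving_frame (c := corner a b k) (orthonormal_sideDir k)
  have hpre : (fun p : ℝ × ℝ => frame (corner a b k) (sideDir k) (sideDir (k + 1)) p.1 p.2) ⁻¹'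
      box a b = Ioo 0 (sideLen a b k) ×ˢ Ioo 0 (sideLen a b (k + 1)) := by
    ext p
    exact sideFrame_mem_box
  have hcont : Continuous fun p : ℝ × ℝ =>
      fderiv ℝ F (sideFrame a b k p.1 p.2) (sideDir (k + 1)) := hF'.comp continuous_frame
  have h1 : ∫ x in box a b, fderiv ℝ F x (sideDir (k + 1)) =
      ∫ s in Ioo 0 (sideLen a b k), (F (sideFrame a b k s (sideLen a b (k + 1))) -
        F (sideFrame a b k s 0)) := by
    rw [← hmp.map_eq, setIntegral_map (isOpen_box a b).measurableSet
      hF'.aestronglyMeasurable hmp.measurable.aemeasurable, hpre, Measure.volume_eq_prod,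
      setIntegral_prod]
    · refine setIntegral_congr_fun measurableSet_Ioo fun s _ => ?_
      simp only []
      rw [← integral_Ioc_eq_integral_Ioo, ← intervalIntegral.integral_of_le (sideLen_pos hab _).le]
      refine intervalIntegral.integral_eq_sub_of_hasDerivAt
        (fun t _ => hasDerivAt_frame_right hF s t) ?_
      exact (continuous_fderiv_frame_right hF _ s).intervalIntegrable _ _
    · rw [← Measure.volume_eq_prod]
      exact (hcont.continuousOn.integrableOn_compact
        (isCompact_Icc.prod isCompact_Icc)).mono_set (prod_mono Ioo_subset_Icc_self
          Ioo_subset_Icc_self)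
  -- The upper ends of the columns form the opposite side, traversed backwards.
  have htop : ∀ s, sideFrame a b k s (sideLen a b (k + 1)) =
      sideFrame a b (k + 2) (sideLen a b k - s) 0 := fun s => by
    rw [show k + 2 = k + 1 + 1 by rw [add_assoc]; rfl, sideFrame_succ, sideFrame_succ]
    simp
  rw [h1]
  calc _ ≤ ∫⁻ s in Ioo 0 (sideLen a b k), ‖F (sideFrame a b k s (sideLen a b (k + 1))) -
        F (sideFrame a b k s 0)‖ₑ := enorm_integral_le_lintegral_enorm _
    _ ≤ ∫⁻ s in Ioo 0 (sideLen a b k), (‖F (sideFrame a b k s (sideLen a b (k + 1)))‖ₑ +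
        ‖F (sideFrame a b k s 0)‖ₑ) := lintegral_mono fun s => enorm_sub_le
    _ = (∫⁻ s in Ioo 0 (sideLen a b k), ‖F (sideFrame a b k s (sideLen a b (k + 1)))‖ₑ) +
        ∫⁻ s in Ioo 0 (sideLen a b k), ‖F (sideFrame a b k s 0)‖ₑ := by
        refine lintegral_add_right _ ?_
        have h := hFm.comp (isometry_sideFrame (a := a) (b := b) k).continuous.measurable
        exact h
    _ ≤ _ := by
        rw [two_mul]
        refine add_le_add ?_ (lintegral_side_le hab k hFm)
        simp_rw [htop]
        rw [lintegral_Ioo_reflect fun s => ‖F (sideFrame a b (k + 2) s 0)‖ₑ,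
          ← sideLen_add_two (a := a) (b := b) k]
        exact lintegral_side_le hab (k + 2) hFm

theorem enorm_integral_box_partialDeriv_le (hab : ∀ i, a i < b i) (i : Fin 2) {F : Plane → ℂ}
    (hF : ContDiff ℝ ∞ F) : ‖∫ x in box a b, partialDeriv i F x‖ₑ ≤
      2 * ∫⁻ x, ‖F x‖ₑ ∂(arcLength (frontier (box a b))) := by
  fin_cases i
  -- The coordinate directions are the inward normals of side 3 and of side 0.
  · have he : sideDir (3 + 1) = EuclideanSpace.single 0 1 := by
      ext j; fin_cases j <;> simp [sideDir]
    have h := enorm_integral_box_fderiv_le hab 3 hF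
    rw [he] at h
    exact h
  · have he : sideDir (0 + 1) = EuclideanSpace.single 1 1 := by
      ext j; fin_cases j <;> simp [sideDir]
    have h := enorm_integral_box_fderiv_le hab 0 hF
    rw [he] at h
    exact h

/-- Product rule. Since ψ vanishes near S, the obstacle can be filled in, and the divergence is
integrated over the whole box. -/
theorem integral_smul_add_smul_eq {v : smoothFun} {ψ : Plane → ℝ} (hψ : ContDiff ℝ ∞ ψ)
    (hψS : tsupport ψ ⊆ Sᶜ) (i : Fin 2) :
    (∫ x in box a b \ S, partialDeriv i ψ x • smoothL2 a b S v x) +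
      ∫ x in box a b \ S, ψ x • smoothL2 a b S (smoothDeriv i v) x =
      ∫ x in box a b, partialDeriv i (fun y => ψ y • v.1 y) x := by
  have cv := smoothFun.contDiff v
  have hint : ∀ {w : Plane → ℂ}, Continuous w → IntegrableOn w (box a b \ S) := fun hw =>
    (memLp_box_diff a b S hw).integrable (by norm_num)
  have e1 : ∫ x in box a b \ S, partialDeriv i ψ x • smoothL2 a b S v x =
      ∫ x in box a b \ S, partialDeriv i ψ x • v.1 x := by
    refine integral_congr_ae ?_
    filter_upwards [coeFn_smoothL2 (a := a) (b := b) (S := S) v] with x hx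
    rw [hx]
  have e2 : ∫ x in box a b \ S, ψ x • smoothL2 a b S (smoothDeriv i v) x =
      ∫ x in box a b \ S, ψ x • partialDeriv i v.1 x := by
    refine integral_congr_ae ?_
    filter_upwards [coeFn_smoothL2 (a := a) (b := b) (S := S) (smoothDeriv i v)] with x hx
    rw [hx]; rfl
  have i1 : IntegrableOn (fun x => partialDeriv i ψ x • v.1 x) (box a b \ S) :=
    hint ((hψ.partialDeriv i).continuous.smul cv.continuous)
  have i2 : IntegrableOn (fun x => ψ x • partialDeriv i v.1 x) (box a b \ S) :=
    hint (hψ.continuous.smul (cv.partialDeriv i).continuous)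
  rw [e1, e2, ← integral_add i1 i2]
  have h1 : ∀ x, partialDeriv i (fun y => ψ y • v.1 y) x =
      ψ x • partialDeriv i v.1 x + partialDeriv i ψ x • v.1 x := fun x =>
    partialDeriv_smul ((hψ.differentiable (by simp)) x) ((cv.differentiable (by simp)) x)
  simp_rw [h1]
  refine Eq.trans (integral_congr_ae (.of_forall fun x => add_comm _ _)) ?_
  refine (setIntegral_eq_of_subset_of_forall_sdiff_eq_zero (isOpen_box a b).measurableSet
    Set.sdiff_subset fun x hx => ?_).symm
  have hxS : x ∈ S := by
    by_contra h
    exact hx.2 ⟨hx.1, h⟩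
  have hx1 : x ∉ tsupport ψ := fun h => hψS h hxS
  have hx2 : x ∉ tsupport (partialDeriv i ψ) := fun h => hx1 (tsupport_partialDeriv_subset i h)
  rw [image_eq_zero_of_notMem_tsupport hx1, image_eq_zero_of_notMem_tsupport hx2]
  simp

/-- Functions of the energy space that vanish on the boundary of the box extend by zero. -/
theorem integral_by_parts_of_bdry_eq_zero (hab : ∀ i, a i < b i) {x : Ambient a b S}
    (hx : x ∈ energy a b S)
    (h0 : HHalfBox.toL2 a b (bdry x) = 0) {ψ : Plane → ℝ} (hψ : ContDiff ℝ ∞ ψ)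
    (hc : HasCompactSupport ψ) (hψS : tsupport ψ ⊆ Sᶜ) (i : Fin 2) :
    ∫ y in box a b \ S, partialDeriv i ψ y • comp none x y =
      -∫ y in box a b \ S, ψ y • comp (some i) x y := by
  obtain ⟨v, hv, -⟩ := mem_energy.1 hx
  obtain ⟨h1, h2⟩ := tendsto_ambient_iff.1 hv
  obtain ⟨M, hM⟩ := hc.exists_bound_of_continuous hψ.continuous
  rw [integral_smul_eq_inner hψ, integral_smul_eq_inner (hψ.partialDeriv i),
    eq_neg_iff_add_eq_zero]
  have hlim : Tendsto (fun n =>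
      ⟪smoothL2 a b S (realSmooth _ (hψ.partialDeriv i)), smoothL2 a b S (v n)⟫_ℂ +
      ⟪smoothL2 a b S (realSmooth ψ hψ), smoothL2 a b S (smoothDeriv i (v n))⟫_ℂ) atTop
      (𝓝 (⟪smoothL2 a b S (realSmooth _ (hψ.partialDeriv i)), comp none x⟫_ℂ +
      ⟪smoothL2 a b S (realSmooth ψ hψ), comp (some i) x⟫_ℂ)) :=
    (tendsto_const_nhds.inner (h1 none)).add (tendsto_const_nhds.inner (h1 (some i)))
  refine tendsto_nhds_unique hlim ?_
  have hb : Tendsto (fun n => HHalfBox.toL2 a b (smoothHHalf a b (v n))) atTop (𝓝 0) := by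
    rw [← h0]
    exact ((HHalfBox.toL2 a b).continuous.tendsto (bdry x)).comp h2
  have hb' := tendsto_eLpNorm_smoothHHalf.1 hb
  have hb2 : Tendsto (fun n => eLpNorm (v n).1 2 (arcLength (frontier (box a b)))) atTop
      (𝓝 0) := by
    refine hb'.congr fun n => eLpNorm_congr_ae ?_
    filter_upwards [Lp.coeFn_zero ℂ 2 (arcLength (frontier (box a b)))] with y hy
    rw [hy]; simp
  set μ := arcLength (frontier (box a b)) with hμ
  have hb1 : Tendsto (fun n => eLpNorm (v n).1 2 μ *
      μ univ ^ (1 / (1 : ℝ≥0∞).toReal - 1 / (2 : ℝ≥0∞).toReal)) atTop (𝓝 0) := by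
    have := ENNReal.Tendsto.mul_const (b := μ univ ^ (1 / (1 : ℝ≥0∞).toReal - 1 / (2 : ℝ≥0∞).toReal))
      hb2 (Or.inr (ENNReal.rpow_ne_top_of_nonneg (by norm_num) (measure_ne_top _ _)))
    rwa [zero_mul] at this
  have hb3 : Tendsto (fun n => 2 * (ENNReal.ofReal M * (eLpNorm (v n).1 2 μ *
      μ univ ^ (1 / (1 : ℝ≥0∞).toReal - 1 / (2 : ℝ≥0∞).toReal)))) atTop (𝓝 0) := by
    have := ENNReal.Tendsto.const_mul (a := 2) (ENNReal.Tendsto.const_mul (a := ENNReal.ofReal M)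
      hb1 (Or.inr ENNReal.ofReal_ne_top)) (Or.inr (by norm_num))
    simpa using this
  -- For the smooth approximations the sum of both sides is an integral of ∂ᵢ(ψ vₙ) over the box, at
  -- most 2 sup|ψ| times the L¹(∂B) norm of vₙ, which tends to zero with the L²(∂B) norm.
  rw [tendsto_zero_iff_enorm_tendsto_zero]
  refine tendsto_of_tendsto_of_tendsto_of_le_of_le tendsto_const_nhds hb3 (fun _ => zero_le)
    fun n => ?_
  have cv := smoothFun.contDiff (v n)
  simp only []
  rw [← integral_smul_eq_inner, ← integral_smul_eq_inner,
    integral_smul_add_smul_eq hψ hψS]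
  refine (enorm_integral_box_partialDeriv_le hab i (hψ.smul cv)).trans ?_
  gcongr
  refine le_trans ?_ (mul_le_mul' le_rfl (eLpNorm_le_eLpNorm_mul_rpow_measure_univ
    (one_le_two) cv.continuous.aestronglyMeasurable))
  rw [eLpNorm_one_eq_lintegral_enorm, ← lintegral_const_mul' _ _ ENNReal.ofReal_ne_top]
  refine lintegral_mono fun y => ?_
  refine (enorm_smul_le (r := ψ y) (x := (v n).1 y)).trans (mul_le_mul' ?_ le_rfl)
  rw [← ofReal_norm]
  exact ENNReal.ofReal_le_ofReal (hM y)

end Green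

end

section

/-! ### The variational problem -/

section Variational

open Set Function
open scoped InnerProductSpace

variable {a b : Plane} {S : Set Plane}

/-- A function vanishing near S is its own approximating sequence; no condition on ∂B is imposed. -/
theorem smoothTriple_mem_energy {φ : Plane → ℝ} (hφ : ContDiff ℝ ∞ φ) (hS : IsClosed S)
    (hφS : tsupport φ ⊆ Sᶜ) : smoothTriple a b S (realSmooth φ hφ) ∈ energy a b S := by
  refine mem_energy.2 ⟨fun _ => realSmooth φ hφ, tendsto_const_nhds, ?_⟩
  have h : eLpNorm (realSmooth φ hφ).1 2 (arcLength (frontier S)) = 0 := by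
    rw [eLpNorm_congr_ae (g := fun _ => (0 : ℂ)), eLpNorm_zero']
    rw [arcLength, EventuallyEq, ae_restrict_iff' isClosed_frontier.measurableSet]
    refine .of_forall fun x hx => ?_
    have : x ∉ tsupport φ := fun h => hφS h (hS.frontier_subset hx)
    simp [realSmooth, image_eq_zero_of_notMem_tsupport this]
  simp [h]

variable (a b S) in
/-- The boundary component of an element of the energy space. -/
def Energy.bdry : Energy a b S →L[ℂ] HHalfBox a b :=
  HelmholtzBox.bdry.comp (Energy.incl a b S).toContinuousLinearMap

theorem Energy.bdry_apply (w : Energy a b S) :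
    Energy.bdry a b S w = HelmholtzBox.bdry (Energy.incl a b S w) := rfl

variable (a b S) in
/-- The boundary component of an element of the energy space in `L²(∂B)`. -/
def Energy.trace : Energy a b S →L[ℂ] Lp ℂ 2 (arcLength (frontier (box a b))) :=
  (HHalfBox.toL2 a b).comp (Energy.bdry a b S)

theorem Energy.trace_apply (w : Energy a b S) :
    Energy.trace a b S w = HHalfBox.toL2 a b (Energy.bdry a b S w) := rfl

theorem Energy.ext {w w' : Energy a b S} (h : ∀ o, Energy.comp a b S o w = Energy.comp a b S o w')
    (hb : Energy.bdry a b S w = Energy.bdry a b S w') : w = w' :=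
  (Energy.incl a b S).injective (ambient_ext h hb)

theorem Energy.norm_sq (w : Energy a b S) :
    ‖w‖ ^ 2 = ∑ o, ‖Energy.comp a b S o w‖ ^ 2 + ‖Energy.bdry a b S w‖ ^ 2 := by
  rw [← (Energy.incl a b S).norm_map w, ambient_norm_sq]
  rfl

/-- The trace bound extends by density from smooth functions. -/
theorem Energy.norm_bdry_sq_le {C : ℝ} (hC : TraceBound a b S C) (w : Energy a b S) :
    ‖Energy.bdry a b S w‖ ^ 2 ≤ C * ∑ o, ‖Energy.comp a b S o w‖ ^ 2 := by
  obtain ⟨v, hv, -⟩ := mem_energy.1 (Energy.incl_mem w)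
  have hcl : IsClosed {x : Ambient a b S | ‖HelmholtzBox.bdry x‖ ^ 2 ≤
      C * ∑ o, ‖HelmholtzBox.comp o x‖ ^ 2} := by
    refine isClosed_le (by fun_prop) ?_
    exact continuous_const.mul (continuous_finsetSum _ fun o _ => by fun_prop)
  exact hcl.mem_of_tendsto hv (.of_forall fun n => hC (v n))

/-- The sesquilinear form of the boundary value problem. -/
def robinForm (k η : ℝ) (w v : Energy a b S) : ℂ :=
  ∑ i, ⟪Energy.comp a b S (some i) w, Energy.comp a b S (some i) v⟫_ℂ -
    (k : ℂ) ^ 2 * ⟪Energy.comp a b S none w, Energy.comp a b S none v⟫_ℂ -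
    Complex.I * η * ⟪Energy.trace a b S w, Energy.trace a b S v⟫_ℂ

theorem robinForm_sub (k η : ℝ) (w w' v : Energy a b S) :
    robinForm k η (w - w') v = robinForm k η w v - robinForm k η w' v := by
  simp only [robinForm, map_sub, inner_sub_left, Finset.sum_sub_distrib]
  ring

/-- The first two terms of the form are real on the diagonal, so the imaginary part is −η times the
squared boundary norm. -/
theorem trace_eq_zero_of_robinForm {k η : ℝ} (hη : η ≠ 0) {w : Energy a b S}
    (h : robinForm k η w w = 0) : Energy.trace a b S w = 0 := by
  have h1 := congrArg Complex.im h
  simp only [robinForm, inner_self_eq_norm_sq_to_K] at h1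
  simpa [← Complex.ofReal_pow, hη] using h1

/-- An element of the energy space without boundary values that solves the Helmholtz equation
solves it across the boundary of the box when extended by zero. -/
theorem integral_helmholtz_eq_zero (hab : ∀ i, a i < b i) (hS : IsClosed S) {k η : ℝ}
    {w : Energy a b S} (hw : Energy.trace a b S w = 0) (h : ∀ v, robinForm k η w v = 0)
    {φ : Plane → ℝ} (hφ : ContDiff ℝ ∞ φ) (hc : HasCompactSupport φ) (hφS : tsupport φ ⊆ Sᶜ) :
    ∫ x in box a b \ S, (Laplacian.laplacian φ x + k ^ 2 * φ x) • Energy.comp a b S none w x =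
      0 := by
  -- The test function φ need not vanish on ∂B; the absence of boundary values of w makes both the
  -- boundary term of the form and that of the integration by parts disappear.
  obtain ⟨v, hv⟩ := Energy.exists_incl_eq (smoothTriple_mem_energy (a := a) (b := b) hφ hS hφS)
  have hvD : ∀ i, Energy.comp a b S (some i) v =
      smoothL2 a b S (realSmooth _ (hφ.partialDeriv i)) := fun i => by
    rw [Energy.comp_apply, hv, comp_some_smoothTriple, smoothDeriv_realSmooth]
  have hvJ : Energy.comp a b S none v = smoothL2 a b S (realSmooth φ hφ) := by
    rw [Energy.comp_apply, hv, comp_none_smoothTriple]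
  have hint : ∀ {ψ : Plane → ℝ}, Continuous ψ → HasCompactSupport ψ → Integrable
      (fun x => ψ x • Energy.comp a b S none w x) (volume.restrict (box a b \ S)) := fun h1 h2 =>
    ((Lp.memLp (Energy.comp a b S none w)).locallyIntegrable
      (by norm_num)).integrable_smul_left_of_hasCompactSupport h1 h2
  have hD : ∀ i, ∫ x in box a b \ S,
      partialDeriv i (partialDeriv i φ) x • Energy.comp a b S none w x =
      -(starRingEnd ℂ) ⟪Energy.comp a b S (some i) w, Energy.comp a b S (some i) v⟫_ℂ := by
    intro i
    rw [inner_conj_symm, hvD, ← integral_smul_eq_inner]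
    exact integral_by_parts_of_bdry_eq_zero hab (Energy.incl_mem w) hw (hφ.partialDeriv i)
      (hc.partialDeriv i) ((tsupport_partialDeriv_subset i).trans hφS) i
  have hJ : ∫ x in box a b \ S, φ x • Energy.comp a b S none w x =
      (starRingEnd ℂ) ⟪Energy.comp a b S none w, Energy.comp a b S none v⟫_ℂ := by
    rw [inner_conj_symm, hvJ, ← integral_smul_eq_inner]
  have e : ∀ x, (Laplacian.laplacian φ x + k ^ 2 * φ x) • Energy.comp a b S none w x =
      (partialDeriv 0 (partialDeriv 0 φ) x • Energy.comp a b S none w x +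
      partialDeriv 1 (partialDeriv 1 φ) x • Energy.comp a b S none w x) +
      ((k : ℂ) ^ 2) * (φ x • Energy.comp a b S none w x) := fun x => by
    rw [laplacian_eq_partialDeriv hφ]
    simp only [Complex.real_smul]
    push_cast
    ring
  have i2 := fun i => hint ((hφ.partialDeriv i).partialDeriv i).continuous
    ((hc.partialDeriv i).partialDeriv i)
  simp_rw [e]
  rw [integral_add (by exact (i2 0).add (i2 1)) ((hint hφ.continuous hc).const_mul _),
    integral_add (i2 0) (i2 1), integral_const_mul, hD, hD, hJ]
  have h0 := congrArg (starRingEnd ℂ) (h v)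
  simp only [robinForm, hw, inner_zero_left, mul_zero, sub_zero, Fin.sum_univ_two, map_sub,
    map_add, map_mul, map_pow, Complex.conj_ofReal, map_zero] at h0
  linear_combination -h0

/-- The form at (w, w) kills the boundary values, so the zero extension of w solves the Helmholtz
equation in a connected open set that crosses ∂B. It vanishes outside the box, and unique
continuation carries this into Ω. -/
theorem Energy.eq_zero_of_robinForm (hab : ∀ i, a i < b i) (hS : IsCompact S)
    (hSB : S ⊆ box a b) (hconn : IsConnected (box a b \ S)) {k η : ℝ} (hη : η ≠ 0)
    {w : Energy a b S} (h : ∀ v, robinForm k η w v = 0) : w = 0 := by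
  have hw := trace_eq_zero_of_robinForm hη (h w)
  have hΩ : IsOpen (box a b \ S) := (isOpen_box a b).sdiff hS.isClosed
  obtain ⟨ρ, hρ, hρL, hcollar⟩ := exists_collar hab hS hSB
  have hL := sideLen_pos hab 0
  have hs : sideLen a b 0 / 2 ∈ Ioo 0 (sideLen a b 0) := ⟨by linarith, by linarith⟩
  have hmS : sideFrame a b 0 (sideLen a b 0 / 2) 0 ∈ Sᶜ := fun hm =>
    lt_irrefl _ (sideFrame_mem_box.1 (hSB hm)).2.1
  obtain ⟨r, hr, hball⟩ := Metric.isOpen_iff.1 hS.isClosed.isOpen_compl _ hmS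
  have hdist : ∀ t, dist (sideFrame a b 0 (sideLen a b 0 / 2) t)
      (sideFrame a b 0 (sideLen a b 0 / 2) 0) = |t| := fun t => by
    rw [dist_eq_norm, ← abs_of_nonneg (norm_nonneg (_ - _)), ← sq_eq_sq_iff_abs_eq_abs, sideFrame,
      norm_frame_sub_sq (orthonormal_sideDir 0)]
    ring
  obtain ⟨t, ht0, htρ, htr⟩ : ∃ t, 0 < t ∧ t < ρ ∧ t < r :=
    ⟨min ρ r / 2, by positivity, by linarith [min_le_left ρ r, lt_min hρ hr],
      by linarith [min_le_right ρ r, lt_min hρ hr]⟩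
  -- Ω and a disc about the midpoint of side 0 share the point at height t in the collar.
  have hpre : IsPreconnected ((box a b \ S) ∪
      Metric.ball (sideFrame a b 0 (sideLen a b 0 / 2) 0) r) := by
    refine IsPreconnected.union (sideFrame a b 0 (sideLen a b 0 / 2) t) ?_ ?_
      hconn.isPreconnected (convex_ball _ _).isPreconnected
    · exact hcollar 0 _ hs t ⟨ht0, htρ⟩
    · rw [Metric.mem_ball, hdist, abs_of_pos ht0]
      exact htr
  -- The mirror point at height −t lies outside the closed box; the zero extension vanishes near it,
  -- and unique continuation starts there.
  have hq : sideFrame a b 0 (sideLen a b 0 / 2) (-t) ∈ (closure (box a b))ᶜ := fun hq => by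
    have := (closure_box_subset a b hq 1).1
    simp [sideFrame, frame, corner, sideDir] at this
    linarith
  obtain ⟨ε, hε, hεball⟩ := Metric.isOpen_iff.1 isClosed_closure.isOpen_compl _ hq
  have hsub : (box a b \ S) ∪ Metric.ball (sideFrame a b 0 (sideLen a b 0 / 2) 0) r ⊆ Sᶜ :=
    union_subset (fun x hx => hx.2) hball
  have hJint : IntegrableOn (Energy.comp a b S none w) (box a b \ S) :=
    (Lp.memLp (Energy.comp a b S none w)).integrable (by norm_num)
  have key := weak_helmholtz_ae_eq_zero_of_isPreconnected
    (u := (box a b \ S).indicator (Energy.comp a b S none w))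
    ((integrable_indicator_iff hΩ.measurableSet).2 hJint).locallyIntegrable
    (hΩ.union Metric.isOpen_ball) hpre k (fun φ hφ => by
      have := integral_helmholtz_eq_zero hab hS.isClosed hw h hφ.1 hφ.2.1 (hφ.2.2.trans hsub)
      rw [← integral_indicator hΩ.measurableSet] at this
      rw [← this]
      refine integral_congr_ae (.of_forall fun x => ?_)
      by_cases hx : x ∈ box a b \ S <;> simp [hx])
    (p := sideFrame a b 0 (sideLen a b 0 / 2) (-t))
    (Or.inr (by rw [Metric.mem_ball, hdist, abs_neg, abs_of_pos ht0]; exact htr)) hε (by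
      rw [ae_restrict_iff' measurableSet_ball]
      refine .of_forall fun x hx => indicator_of_notMem (fun hx' => ?_) _
      exact hεball hx (subset_closure hx'.1))
  have hJ : Energy.comp a b S none w = 0 := by
    refine Lp.ext ?_
    filter_upwards [ae_restrict_of_ae_restrict_of_subset subset_union_left key,
      ae_restrict_mem hΩ.measurableSet, Lp.coeFn_zero ℂ 2 (volume.restrict (box a b \ S))]
      with x hx hxΩ hx0
    rw [indicator_of_mem hxΩ] at hx
    rw [hx, hx0]
    rfl
  -- With w and its boundary values zero, testing with w itself leaves only the gradient norm.
  have hD : ∀ i, Energy.comp a b S (some i) w = 0 := by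
    have h1 := h w
    simp only [robinForm, hJ, hw, inner_self_eq_norm_sq_to_K] at h1
    have h2 : ∑ i, ‖Energy.comp a b S (some i) w‖ ^ 2 = 0 := by
      have := congrArg Complex.re h1
      simpa [← Complex.ofReal_pow] using this
    intro i
    have := (Finset.sum_eq_zero_iff_of_nonneg fun i _ => by positivity).1 h2 i (Finset.mem_univ i)
    simpa using this
  refine Energy.ext (fun o => ?_) (HHalfBox.ext_toL2 ?_)
  · rw [map_zero]
    cases o
    · exact hJ
    · exact hD _
  · rw [map_zero, map_zero]
    exact hw

/-- The variational problem is solvable. -/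
theorem exists_forall_robinForm_eq (hab : ∀ i, a i < b i) (hS : IsCompactLipschitz S)
    (hSB : S ⊆ box a b) (hconn : IsConnected (box a b \ S)) {k η : ℝ} (hη : η ≠ 0)
    (f : HNegHalfBox a b) :
    ∃ w : Energy a b S, ∀ v, robinForm k η w v = f (Energy.bdry a b S v) := by
  obtain ⟨C, hC⟩ := exists_traceBound hab hS.1 hSB
  -- The L² term is added to the form to make it coercive and removed again by K. The sign of iη
  -- flips because A acts in the conjugate-linear slot of the form.
  obtain ⟨A, hA⟩ : ∃ A : Energy a b S →L[ℂ] Energy a b S, A =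
      ∑ o, (Energy.comp a b S o).adjoint.comp (Energy.comp a b S o) +
        (Complex.I * η) • (Energy.trace a b S).adjoint.comp (Energy.trace a b S) := ⟨_, rfl⟩
  obtain ⟨K, hK⟩ : ∃ K : Energy a b S →L[ℂ] Energy a b S, K =
      ((1 : ℂ) + k ^ 2) • (Energy.comp a b S none).adjoint.comp (Energy.comp a b S none) :=
    ⟨_, rfl⟩
  have hform : ∀ w v, ⟪(A - K) w, v⟫_ℂ = robinForm k η w v := by
    intro w v
    simp only [hA, hK, sub_apply, add_apply, sum_apply, smul_apply,
      ContinuousLinearMap.comp_apply, inner_sub_left, inner_add_left, sum_inner, inner_smul_left,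
      ContinuousLinearMap.adjoint_inner_left, Fintype.sum_option, robinForm, map_mul, map_add,
      map_one, map_pow, Complex.conj_I, Complex.conj_ofReal]
    ring
  -- The boundary term is purely imaginary, so the real part is the H¹ norm; the energy norm also
  -- contains the H^{1/2} norm, which the trace bound controls.
  have hcoer : ∀ w, (1 + |C|)⁻¹ * ‖w‖ ^ 2 ≤ (⟪w, A w⟫_ℂ).re := by
    intro w
    have h1 : (⟪w, A w⟫_ℂ).re = ∑ o, ‖Energy.comp a b S o w‖ ^ 2 := by
      simp only [hA, add_apply, sum_apply, smul_apply,
        ContinuousLinearMap.comp_apply, inner_add_right, inner_sum, inner_smul_right,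
        ContinuousLinearMap.adjoint_inner_right, inner_self_eq_norm_sq_to_K]
      simp [← Complex.ofReal_pow]
    have h2 := Energy.norm_bdry_sq_le hC w
    have h3 : 0 ≤ ∑ o, ‖Energy.comp a b S o w‖ ^ 2 := Finset.sum_nonneg fun o _ => by positivity
    rw [h1, inv_mul_le_iff₀ (by positivity), Energy.norm_sq]
    nlinarith [le_abs_self C]
  have hcomp : IsCompactOperator K := by
    have h1 := (isCompactOperator_energy_comp_none hab hS hSB).clm_comp
      (Energy.comp a b S none).adjoint
    have h2 := h1.smul ((1 : ℂ) + k ^ 2)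
    rw [hK]
    exact h2
  have hinj : Injective (A - K) := by
    rw [injective_iff_map_eq_zero]
    intro w hw
    refine Energy.eq_zero_of_robinForm hab hS.1 hSB hconn hη (k := k) fun v => ?_
    rw [← hform, hw, inner_zero_left]
  obtain ⟨w, hw⟩ := surjective_of_coercive_sub_compact A K (by positivity) hcoer hcomp hinj
    ((InnerProductSpace.toDual ℂ (Energy a b S)).symm (f.comp (Energy.bdry a b S)))
  refine ⟨w, fun v => ?_⟩
  rw [← hform, hw, InnerProductSpace.toDual_symm_apply]
  rfl

end Variational

end

section

/-! ### Complex conjugation and the weak formulation -/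

section Conjugation

open Set Function
open scoped InnerProductSpace ComplexConjugate

variable {a b : Plane} {S : Set Plane}

/-- The bridge between the bilinear pairings of the boundary value problem and the sesquilinear
inner product. -/
theorem integral_mul_eq_inner {α : Type*} [MeasurableSpace α] {μ : Measure α} (f g : Lp ℂ 2 μ) :
    ∫ x, f x * g x ∂μ = ⟪star f, g⟫_ℂ := by
  rw [L2.inner_def]
  refine integral_congr_ae ?_
  filter_upwards [Lp.coeFn_star f] with x hx
  rw [hx]
  simp [mul_comm]

/-- The pairing is bilinear and symmetric in f and g, so the scalar comes out without conjugation.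
-/
theorem inner_star_neg_smul {α : Type*} [MeasurableSpace α] {μ : Measure α} (c : ℂ)
    (f g : Lp ℂ 2 μ) : ⟪star (-(c • f)), g⟫_ℂ = -(c * ⟪star f, g⟫_ℂ) := by
  have hcomm : ∀ u v : Lp ℂ 2 μ, ⟪star u, v⟫_ℂ = ⟪star v, u⟫_ℂ := fun u v => by
    rw [← integral_mul_eq_inner, ← integral_mul_eq_inner]
    simp only [mul_comm]
  rw [hcomm, inner_neg_right, inner_smul_right, hcomm]

theorem integrable_mul_Lp {α : Type*} [MeasurableSpace α] {μ : Measure α} (f g : Lp ℂ 2 μ) :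
    Integrable (fun x => f x * g x) μ :=
  (Lp.memLp f).integrable_mul (Lp.memLp g)

theorem HasWeakGrad.star {Ω : Set Plane} {u : L2 Ω} {G : Fin 2 → L2 Ω} (h : HasWeakGrad Ω u G) :
    HasWeakGrad Ω (star u) fun i => star (G i) := by
  have key : ∀ (φ : Plane → ℝ) (f : L2 Ω),
      ∫ x in Ω, φ x • (Star.star f : L2 Ω) x = conj (∫ x in Ω, φ x • f x) := fun φ f => by
    rw [← integral_conj]
    refine integral_congr_ae ?_
    filter_upwards [Lp.coeFn_star f] with x hx
    rw [hx]
    simp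
  intro i φ hφ
  rw [key, key, h i φ hφ, map_neg]

/-- The conjugates of an approximating sequence approximate the conjugate, with the same norms. -/
theorem HasTrace.star {Ω Γ : Set Plane} {u : L2 Ω} {g g' : Plane → ℂ} (h : HasTrace Ω Γ u g)
    (hg : ∀ᵐ x ∂(arcLength Γ), g' x = conj (g x)) : HasTrace Ω Γ (star u) g' := by
  obtain ⟨G, hG, v, hv, h1, h2, h3⟩ := h
  refine ⟨_, hG.star, fun n x => conj (v n x), fun n => Complex.conjCLE.contDiff.comp (hv n), ?_,
    fun i => ?_, ?_⟩
  · refine h1.congr fun n => eLpNorm_congr_norm_ae ?_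
    filter_upwards [Lp.coeFn_star u] with x hx
    rw [hx, Pi.star_apply, Complex.star_def, ← map_sub, RCLike.norm_conj]
  · refine (h2 i).congr fun n => eLpNorm_congr_norm_ae ?_
    filter_upwards [Lp.coeFn_star (G i)] with x hx
    have : partialDeriv i (fun y => conj (v n y)) x = conj (partialDeriv i (v n) x) :=
      partialDeriv_clm_comp (Complex.conjCLE : ℂ →L[ℝ] ℂ) (((hv n).differentiable (by simp)) x)
    rw [hx, Pi.star_apply, Complex.star_def, this, ← map_sub, RCLike.norm_conj]
  · refine h3.congr fun n => eLpNorm_congr_norm_ae ?_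
    filter_upwards [hg] with x hx
    rw [hx, ← map_sub, RCLike.norm_conj]

theorem HHalfBox.integral_toFun_mul_toFun (t g : HHalfBox a b) :
    ∫ x, t.toFun x * g.toFun x ∂(arcLength (frontier (box a b))) =
      ⟪star (HHalfBox.toL2 a b t), HHalfBox.toL2 a b g⟫_ℂ :=
  integral_mul_eq_inner (HHalfBox.toL2 a b t) (HHalfBox.toL2 a b g)

theorem HHalfBox.exists_star (g : HHalfBox a b) :
    ∃ g' : HHalfBox a b, HHalfBox.toL2 a b g' = star (HHalfBox.toL2 a b g) := by
  refine ⟨⟨WithLp.toLp 2 (star g.1.fst, star g.1.snd), ?_⟩, rfl⟩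
  have hg : ∀ᵐ z ∂((arcLength (frontier (box a b))).prod (arcLength (frontier (box a b)))),
      g.1.snd z = (g.1.fst z.1 - g.1.fst z.2) / (‖z.1 - z.2‖ : ℂ) := g.2
  have h0 := Lp.coeFn_star g.1.fst
  have h1 := Measure.quasiMeasurePreserving_fst (μ := arcLength (frontier (box a b)))
    (ν := arcLength (frontier (box a b))) |>.ae h0
  have h2 := Measure.quasiMeasurePreserving_snd (μ := arcLength (frontier (box a b)))
    (ν := arcLength (frontier (box a b))) |>.ae h0
  filter_upwards [hg, h1, h2, Lp.coeFn_star g.1.snd] with z hz hz1 hz2 hz3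
  refine hz3.trans (Eq.trans ?_ (congrArg₂ (fun p q : ℂ => (p - q) / (‖z.1 - z.2‖ : ℂ)) hz1.symm
    hz2.symm))
  simp [hz]

/-- Weak gradient and both traces are compatible with conjugation, and `triple_mem_energy`
recognises the conjugate triple as an element of the energy space. -/
theorem Energy.exists_star (hS : IsClosed S) {C : ℝ} (hC : TraceBound a b S C)
    (w : Energy a b S) : ∃ w' : Energy a b S,
      (∀ o, Energy.comp a b S o w' = star (Energy.comp a b S o w)) ∧
      Energy.trace a b S w' = star (Energy.trace a b S w) := by
  obtain ⟨g', hg'⟩ := HHalfBox.exists_star (Energy.bdry a b S w)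
  have h : triple a b S (star (Energy.comp a b S none w))
      (fun i => star (Energy.comp a b S (some i) w)) g' ∈ energy a b S := by
    refine triple_mem_energy hS hC (hasWeakGrad_of_mem_energy (Energy.incl_mem w)).star
      ((hasTrace_obstacle_of_mem_energy (Energy.incl_mem w)).star (by simp))
      ((hasTrace_box_of_mem_energy (Energy.incl_mem w)).star ?_)
    rw [HHalfBox.toFun_eq_toL2, hg']
    exact Lp.coeFn_star _
  obtain ⟨w', hw'⟩ := Energy.exists_incl_eq h
  refine ⟨w', fun o => ?_, ?_⟩
  · rw [Energy.comp_apply, hw']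
    cases o <;> rfl
  · rw [Energy.trace_apply, Energy.bdry_apply, hw', bdry_triple, hg']
    rfl

theorem integral_green_eq {Ω : Set Plane} (G H : Fin 2 → L2 Ω) (w v : L2 Ω) :
    ∫ x in Ω, (∑ i, G i x * H i x + w x * v x) =
      ∑ i, ⟪star (G i), H i⟫_ℂ + ⟪star w, v⟫_ℂ := by
  rw [integral_add (integrable_finsetSum _ fun i _ => integrable_mul_Lp _ _)
    (integrable_mul_Lp _ _), integral_finsetSum _ fun i _ => integrable_mul_Lp _ _]
  simp only [integral_mul_eq_inner]

/-- Test functions in the energy space have no boundary values. -/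
theorem smoothHHalf_realSmooth_eq_zero {φ : Plane → ℝ} (hφ : ContDiff ℝ ∞ φ)
    (hsupp : tsupport φ ⊆ box a b) : smoothHHalf a b (realSmooth φ hφ) = 0 := by
  refine HHalfBox.ext_toL2 (Lp.ext ?_)
  rw [map_zero]
  have h1 := (memLp_arcLength_box a b (smoothFun.contDiff (realSmooth φ hφ)).continuous).coeFn_toLp
  have h2 : ∀ᵐ x ∂(arcLength (frontier (box a b))), x ∈ frontier (box a b) := by
    rw [arcLength]
    exact ae_restrict_mem isClosed_frontier.measurableSet
  filter_upwards [h1, h2, Lp.coeFn_zero ℂ 2 (arcLength (frontier (box a b)))] with x hx hxf hx0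
  refine hx.trans (Eq.trans ?_ hx0.symm)
  rw [(isOpen_box a b).frontier_eq] at hxf
  have : x ∉ tsupport φ := fun h => hxf.2 (hsupp h)
  simp [realSmooth, image_eq_zero_of_notMem_tsupport this]

/-- Solutions of the variational problem solve the Helmholtz equation. -/
theorem hasWeakLaplacian_of_robinForm (hS : IsClosed S) {k η : ℝ} {f : HNegHalfBox a b}
    {w : Energy a b S} (h : ∀ v, robinForm k η w v = f (Energy.bdry a b S v))
    {y : Energy a b S} (hy : ∀ o, Energy.comp a b S o w = star (Energy.comp a b S o y)) :
    HasWeakLaplacian (box a b \ S) (Energy.comp a b S none y)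
      (-((k : ℂ) ^ 2 • Energy.comp a b S none y)) := by
  intro φ hφ
  have hφS : tsupport φ ⊆ Sᶜ := fun x hx => (hφ.2.2 hx).2
  obtain ⟨v, hv⟩ := Energy.exists_incl_eq (smoothTriple_mem_energy (a := a) (b := b) hφ.1 hS hφS)
  have hvD : ∀ i, Energy.comp a b S (some i) v =
      smoothL2 a b S (realSmooth _ (hφ.1.partialDeriv i)) := fun i => by
    rw [Energy.comp_apply, hv, comp_some_smoothTriple, smoothDeriv_realSmooth]
  have hvJ : Energy.comp a b S none v = smoothL2 a b S (realSmooth φ hφ.1) := by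
    rw [Energy.comp_apply, hv, comp_none_smoothTriple]
  -- Test functions supported in Ω have no boundary values, so f and the boundary term drop out and
  -- only the differential equation remains.
  have hvb : Energy.bdry a b S v = 0 := by
    rw [Energy.bdry_apply, hv, bdry_smoothTriple]
    exact smoothHHalf_realSmooth_eq_zero hφ.1 fun x hx => (hφ.2.2 hx).1
  have hin : ∀ (ψ : Plane → ℝ) (hψ : ContDiff ℝ ∞ ψ) (u : L2 (box a b \ S)),
      ⟪star u, smoothL2 a b S (realSmooth ψ hψ)⟫_ℂ = ∫ x in box a b \ S, ψ x • u x := by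
    intro ψ hψ u
    rw [← integral_mul_eq_inner]
    refine integral_congr_ae ?_
    filter_upwards [coeFn_smoothL2 (a := a) (b := b) (S := S) (realSmooth ψ hψ)] with x hx
    rw [hx]
    simp [realSmooth, mul_comm]
  have h0 := h v
  rw [robinForm, Energy.trace_apply v, hvb, map_zero, map_zero, inner_zero_right, mul_zero,
    sub_zero, Fin.sum_univ_two, hvD, hvD, hvJ, hy, hy, hy, hin, hin, hin] at h0
  have hgrad := hasWeakGrad_of_mem_energy (Energy.incl_mem y)
  have hD : ∀ i, ∫ x in box a b \ S,
      partialDeriv i (partialDeriv i φ) x • Energy.comp a b S none y x =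
      -∫ x in box a b \ S, partialDeriv i φ x • Energy.comp a b S (some i) y x := fun i =>
    hgrad i _ ⟨hφ.1.partialDeriv i, hφ.2.1.partialDeriv i,
      (tsupport_partialDeriv_subset i).trans hφ.2.2⟩
  have hint : ∀ {ψ : Plane → ℝ}, Continuous ψ → HasCompactSupport ψ → Integrable
      (fun x => ψ x • Energy.comp a b S none y x) (volume.restrict (box a b \ S)) := fun h1 h2 =>
    ((Lp.memLp (Energy.comp a b S none y)).locallyIntegrable
      (by norm_num)).integrable_smul_left_of_hasCompactSupport h1 h2
  have i2 := fun i => hint ((hφ.1.partialDeriv i).partialDeriv i).continuous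
    ((hφ.2.1.partialDeriv i).partialDeriv i)
  simp_rw [laplacian_eq_partialDeriv hφ.1, add_smul]
  rw [integral_add (i2 0) (i2 1), hD, hD, integral_smul_eq_inner hφ.1, inner_neg_right,
    inner_smul_right, ← integral_smul_eq_inner hφ.1]
  linear_combination -h0

/-- Solutions of the boundary value problem solve the variational problem after conjugation. -/
theorem exists_robinForm_eq_of_robinCondition (hS : IsClosed S) {C : ℝ}
    (hC : TraceBound a b S C) {k η : ℝ} {f : HNegHalfBox a b} {u : L2 (box a b \ S)}
    (hu : HelmholtzEquation (box a b \ S) k u)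
    (huS : HasTrace (box a b \ S) (frontier S) u 0) (hR : RobinCondition a b S η f u) :
    ∃ w : Energy a b S, Energy.comp a b S none w = star u ∧
      ∀ v, robinForm k η w v = f (Energy.bdry a b S v) := by
  obtain ⟨l, hl, hlu⟩ := hu
  obtain ⟨ψ, t, ⟨G, l', hG, hl', hψ⟩, ht, hf⟩ := hR
  -- The Laplacian in Green's identity and the one in the Helmholtz equation coincide, so −k²u may
  -- be inserted into Green's identity.
  obtain rfl := hl'.unique ((isOpen_box a b).sdiff hS) hl
  obtain ⟨y, hy⟩ := Energy.exists_incl_eq (triple_mem_energy hS hC hG huS ht)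
  obtain ⟨w, hw, hwt⟩ := Energy.exists_star hS hC y
  have hwt' : Energy.trace a b S w = star (HHalfBox.toL2 a b t) := by
    rw [hwt, Energy.trace_apply, Energy.bdry_apply, hy, bdry_triple]
  have hwJ : Energy.comp a b S none w = star u := by
    rw [hw, Energy.comp_apply, hy, comp_none_triple]
  have hwD : ∀ i, Energy.comp a b S (some i) w = star (G i) := fun i => by
    rw [hw, Energy.comp_apply, hy, comp_some_triple]
  refine ⟨w, hwJ, fun v => ?_⟩
  have h1 : ψ (Energy.bdry a b S v) = _ :=
    hψ (Energy.comp a b S none v) (fun i => Energy.comp a b S (some i) v) (Energy.bdry a b S v)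
      (hasWeakGrad_of_mem_energy (Energy.incl_mem v))
      (hasTrace_obstacle_of_mem_energy (Energy.incl_mem v))
      (hasTrace_box_of_mem_energy (Energy.incl_mem v))
  rw [integral_green_eq, eq_neg_of_add_eq_zero_left hlu, inner_star_neg_smul,
    ← sub_eq_add_neg] at h1
  rw [← hf, h1, HHalfBox.integral_toFun_mul_toFun, robinForm, hwt', hwJ, ← Energy.trace_apply]
  simp only [hwD]

/-- Conjugates of solutions of the variational problem solve the boundary value problem. -/
theorem robinCondition_of_robinForm (hS : IsClosed S) {C : ℝ} (hC : TraceBound a b S C)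
    {k η : ℝ} {f : HNegHalfBox a b} {w : Energy a b S}
    (h : ∀ v, robinForm k η w v = f (Energy.bdry a b S v))
    {y : Energy a b S} (hy : ∀ o, Energy.comp a b S o w = star (Energy.comp a b S o y))
    (hyt : Energy.trace a b S w = star (Energy.trace a b S y)) :
    RobinCondition a b S η f (Energy.comp a b S none y) := by
  -- The Robin condition dictates the normal derivative, f plus iη times the trace. That it
  -- satisfies Green's identity is then exactly the variational equation.
  obtain ⟨ψ, hψ⟩ : ∃ ψ : HNegHalfBox a b, ∀ g, ψ g = f g + Complex.I * η *
      ⟪Energy.trace a b S w, HHalfBox.toL2 a b g⟫_ℂ :=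
    ⟨f + (Complex.I * η) • (innerSL ℂ (Energy.trace a b S w)).comp (HHalfBox.toL2 a b),
      fun g => rfl⟩
  refine ⟨ψ, Energy.bdry a b S y, ⟨fun i => Energy.comp a b S (some i) y,
    -((k : ℂ) ^ 2 • Energy.comp a b S none y), hasWeakGrad_of_mem_energy (Energy.incl_mem y),
    hasWeakLaplacian_of_robinForm hS h hy, fun v H g hH hvS hvB => ?_⟩,
    hasTrace_box_of_mem_energy (Energy.incl_mem y), fun g => ?_⟩
  · obtain ⟨z, hz⟩ := Energy.exists_incl_eq (triple_mem_energy hS hC hH hvS hvB)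
    have hzb : Energy.bdry a b S z = g := by
      rw [Energy.bdry_apply, hz, bdry_triple]
    have hzJ : Energy.comp a b S none z = v := by
      rw [Energy.comp_apply, hz, comp_none_triple]
    have hzD : ∀ i, Energy.comp a b S (some i) z = H i := fun i => by
      rw [Energy.comp_apply, hz, comp_some_triple]
    have h1 := h z
    rw [robinForm, Energy.trace_apply z, hzb, hzJ] at h1
    simp only [hzD, hy] at h1
    rw [integral_green_eq, hψ, ← h1, inner_star_neg_smul, sub_add_cancel, sub_eq_add_neg]
  · rw [hψ, HHalfBox.integral_toFun_mul_toFun, ← Energy.trace_apply, hyt,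
      add_sub_cancel_right]

/-- The boundary value problem is equivalent to the variational problem for the conjugate. -/
theorem robinProblem_iff (hS : IsClosed S) {C : ℝ} (hC : TraceBound a b S C) {k η : ℝ}
    (f : HNegHalfBox a b) (u : L2 (box a b \ S)) :
    (u ∈ H1Delta (box a b \ S) ∧ HelmholtzEquation (box a b \ S) k u ∧
      HasTrace (box a b \ S) (frontier S) u 0 ∧ RobinCondition a b S η f u) ↔
      ∃ w : Energy a b S, Energy.comp a b S none w = star u ∧
        ∀ v, robinForm k η w v = f (Energy.bdry a b S v) := by
  refine ⟨fun h => exists_robinForm_eq_of_robinCondition hS hC h.2.1 h.2.2.1 h.2.2.2, ?_⟩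
  rintro ⟨w, hwu, h⟩
  obtain ⟨y, hy, hyt⟩ := Energy.exists_star hS hC w
  have hy' : ∀ o, Energy.comp a b S o w = star (Energy.comp a b S o y) := fun o => by
    rw [hy, star_star]
  obtain rfl : Energy.comp a b S none y = u := by rw [hy, hwu, star_star]
  have hlap := hasWeakLaplacian_of_robinForm hS h hy'
  exact ⟨⟨⟨_, hasWeakGrad_of_mem_energy (Energy.incl_mem y)⟩, _, hlap⟩,
    ⟨_, hlap, neg_add_cancel _⟩, hasTrace_obstacle_of_mem_energy (Energy.incl_mem y),
    robinCondition_of_robinForm hS hC h hy' (by rw [hyt, star_star])⟩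

end Conjugation

end

end HelmholtzBox

end

/-! ### The boundary value problem -/

theorem theorem1 (a b : Plane) (hab : ∀ i, a i < b i) (S : Set Plane)
    (hS : IsCompactLipschitz S) (hSB : S ⊆ box a b) (hconn : IsConnected (box a b \ S))
    (k : ℝ) (hk : 0 < k) (η : ℝ) (hη : η ≠ 0) (f : HNegHalfBox a b) :
    ∃! u : L2 (box a b \ S), u ∈ H1Delta (box a b \ S) ∧
      HelmholtzEquation (box a b \ S) k u ∧
      HasTrace (box a b \ S) (frontier S) u 0 ∧
      RobinCondition a b S η f u := by
  obtain ⟨C, hC⟩ := exists_traceBound hab hS.1 hSB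
  simp only [robinProblem_iff hS.1.isClosed hC]
  obtain ⟨w, hw⟩ := exists_forall_robinForm_eq hab hS hSB hconn (k := k) hη f
  -- The variational solution is conjugated back. Two solutions have conjugates whose difference
  -- solves the homogeneous variational problem.
  refine ⟨star (Energy.comp a b S none w), ⟨w, (star_star _).symm, hw⟩, ?_⟩
  rintro u ⟨w', hw'u, hw'⟩
  have h : w' - w = 0 := Energy.eq_zero_of_robinForm hab hS.1 hSB hconn (k := k) hη fun v => by
    rw [robinForm_sub, hw', hw, sub_self]
  rw [← sub_eq_zero.1 h, hw'u, star_star]
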